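/- Setting. A Wasserstein distributionally robust MDP has $S\ge 2$ states, $A\ge 1$ actions, costs $c\in\mathbb R^{S\times A}$, an initial distribution $p_0$, a discount factor $\lambda\in(0,1)$, observed kernels $\hat y_{i,s}\in\mathcal U=\Delta(S)^A$ ($1\le i\le N$, $s$ a state), a radius $\theta\ge 0$, a metric $d\in\{d_1,d_2,d_\infty\}$ on $\mathcal U$ (induced by the entrywise $\ell_1,\ell_2,\ell_\infty$ norm of $\mathbb R^{A\times S}$) and a type $p$. The ambiguity set $\mathbb D$ consists of all products $\mu=\bigotimes_s\mu_s$ of Borel probability measures on $\mathcal U$ with $W_p(\mu_s,\nu_s)\le\theta$ for all $s$, where $\nu_s=\frac1N\sum_i\delta_{\hat y_{i,s}}$ and $W_p$ is the type-$p$ Wasserstein distance for $d$. For a policy $x\in\Delta(A)^S$, $C(x,\mu)=\mathbb E\big[\sum_{t\ge0}\lambda^tc_{s_ta_t}\big]$, where $s_0\sim p_0$ and at each time a kernel $y\sim\mu_{s_t}$ is drawn afresh, independently $a_t\sim x_{s_t}$, and $s_{t+1}\sim y_{a_t}$. A policy $\bar x$ is $\epsilon$-optimal if $\max_{\mu\in\mathbb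 D}C(\bar x,\mu)\le\min_{x}\max_{\mu\in\mathbb D}C(x,\mu)+\epsilon$. Algorithm 1, with $k$ epochs. Let $\tilde{\mathbb B}_s$ be the set of $(y_i)_i\in\mathcal U^N$ with $\frac1N\sum_id(y_i,\hat y_{i,s})^p\le\theta^p$ (for $p=\infty$: $d(y_i,\hat y_{i,s})\le\theta$ for all $i$). Start with any $v^1\in\mathbb R^S$, $x^0_s\in\Delta(A)$ and $(y^0_{i,s})_i\in\tilde{\mathbb B}_s$. Epoch $\ell=1,\dots,k$ performs, for $t=\tau_\ell,\dots,\tau_\ell+\ell^2-1$ with $\tau_\ell=\sum_{j<\ell}j^2$ and for every state $s$, the updates $$x_s^{t+1}\in\arg\min_{z\in\Delta(A)}\ \sum_a\Big(c_{sa}+\frac{\lambda}{N}\sum_i\langle y^t_{i,s,a},v^\ell\rangle\Big)z_a+\frac{1}{2\tau}\|z-x^t_s\|_2^2,$$ $$(y^{t+1}_{i,s})_i\ \approx\ \arg\min_{(z_i)_i\in\tilde{\mathbb B}_s}\ \sum_i\Big(-\frac{\lambda}{N}\sum_{a,s'}(2x^{t+1}_{sa}-x^t_{sa})v^\ell_{s'}z_{i,a,s'}+\frac{1}{2\sigma}\|z_i-y^t_{i,s}\|_2^2\Big),$$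 where $1/\tau=\sqrt A\,\lambda\|v^\ell\|_2$ and $1/\sigma=\lambda\|v^\ell\|_2/(N\sqrt A)$; the second update is computed with accuracy $\delta>0$, i.e. it returns a point of $\tilde{\mathbb B}_s$ whose objective value is within $\delta$ of the minimum. Then $v^{\ell+1}_s=\sum_a\bar x_{sa}\big(c_{sa}+\lambda\langle\frac1N\sum_i\bar y_{i,s,a},v^\ell\rangle\big)$, where bars denote the averages of the iterates $t=\tau_\ell+1,\dots,\tau_\ell+\ell^2$ with weights proportional to $t$. The output is the average of all iterates $t=1,\dots,T=\sum_{\ell\le k}\ell^2$, with weights proportional to $t$. Theorem. Let $d=d_2$ and $p\in\{2,\infty\}$, or $d=d_1$ and $p\in\{1,\infty\}$, or $d=d_\infty$ and $p\in\{1,\infty\}$. Put $m=1$ for $d\in\{d_1,d_2\}$ and $m=3$ for $d=d_\infty$. There is a family of programs (algebraic computation trees over $\mathbb R$, with unit-cost operations $+,-,\times,/,\sqrt{\cdot}$, comparisons and natural-number constants), indexed by $N,A,S$, the number of epochs $k$ and a natural precision parameter $j$, such that for all $\lambda\in(0,1)$ and $M$ there is a constant $C$ (depending only on $d,p,\lambda,M$)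 with the following property. For all $N,A\ge1$, $S\ge2$ and $0<\epsilon\le\frac12$ there are $k$, $j$ and $0<\delta\le\epsilon$ such that for every Wasserstein distributionally robust MDP of these sizes with discount factor $\lambda$ and $|c_{sa}|\le M$, and every start of Algorithm 1 with $\|v^1\|_\infty\le M$: every execution of Algorithm 1 with $k$ epochs and accuracy $\delta$ returns an $\epsilon$-optimal policy; and the program with parameters $N,A,S,k,j$, given the data of the MDP and the start, computes the output of such an execution in at most $$C\,N A^{2.5}S^{3.5}\,\log(S)\,\log^m(1/\epsilon)\,\epsilon^{-1.5}$$ arithmetic operations. -/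

import Mathlib

open MeasureTheory
open scoped ENNReal BigOperators

noncomputable section

namespace WDRMDP

/-! ## Distributionally robust MDPs over Wasserstein balls -/

/-- The set `𝒰 = Δ(S)^A` of transition kernels out of one state:
`y a s'` is the probability of moving to `s'` when action `a` is taken. -/
def U (A S : ℕ) : Set (Fin A → Fin S → ℝ) :=
  {y | ∀ a, y a ∈ stdSimplex ℝ (Fin S)}

/-- The three norms on `ℝ^{A × S}` that define the metrics `d₁`, `d₂`, `d_∞`. -/
inductive Metric where
  | l1
  | l2
  | linf
  deriving DecidableEq

/-- The metrics `d₁`, `d₂`, `d_∞` on `ℝ^{A × S}` (the norm of the nested function space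
in the last case is the largest absolute value of an entry). -/
def Metric.dist {A S : ℕ} (d : Metric) (y z : Fin A → Fin S → ℝ) : ℝ :=
  match d with
  | .l1 => ∑ a, ∑ s, |y a s - z a s|
  | .l2 => √(∑ a, ∑ s, (y a s - z a s) ^ 2)
  | .linf => ‖y - z‖

/-- The Wasserstein distance of type `p ∈ [1, ∞]` between two measures on `𝒰`: the infimum over
all couplings `κ` of the `L^p(κ)`-norm of `d`, which is `(𝔼_κ [d ^ p])^{1/p}` for `p < ∞` and the
`κ`-essential supremum of `d` for `p = ∞`. -/
def wasserstein {A S : ℕ} (d : Metric) (p : ℝ≥0∞) (μ ν : Measure (U A S)) : ℝ≥0∞ :=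
  ⨅ κ : {κ : Measure (U A S × U A S) // κ.fst = μ ∧ κ.snd = ν},
    eLpNorm (fun z : U A S × U A S => d.dist (z.1 : Fin A → Fin S → ℝ) z.2) p κ.1

/-- The data of a Wasserstein distributionally robust MDP with states `Fin S`, actions `Fin A`
and `N` sampled transition kernels. -/
structure Model (N A S : ℕ) where
  /-- the discount factor -/
  disc : ℝ
  disc_pos : 0 < disc
  disc_lt_one : disc < 1
  /-- the state-action costs -/
  cost : Fin S → Fin A → ℝ
  /-- the initial distribution over the states -/
  init : Fin S → ℝ
  init_mem : init ∈ stdSimplex ℝ (Fin S)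
  /-- `sample i s` is the `i`-th observed kernel out of the state `s` -/
  sample : Fin N → Fin S → Fin A → Fin S → ℝ
  sample_mem : ∀ i s, sample i s ∈ U A S
  /-- the radius of the Wasserstein balls -/
  radius : ℝ
  radius_nonneg : 0 ≤ radius

namespace Model

variable {N A S : ℕ}

/-- The nominal distribution `ν_s = (1/N) ∑ᵢ δ_{ŷ_{i,s}}`. -/
def nominal (P : Model N A S) (s : Fin S) : Measure (U A S) :=
  (N : ℝ≥0∞)⁻¹ • ∑ i, Measure.dirac ⟨P.sample i s, P.sample_mem i s⟩

/-- The `s`-rectangular ambiguity set: families `μ = (μ_s)_s` (standing for the product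
`⨂ μ_s`) of Borel probability measures on `𝒰`, each in the Wasserstein ball around `ν_s`. -/
def ambiguitySet (P : Model N A S) (d : Metric) (p : ℝ≥0∞) : Set (Fin S → Measure (U A S)) :=
  {μ | ∀ s, IsProbabilityMeasure (μ s) ∧
    wasserstein d p (μ s) (P.nominal s) ≤ ENNReal.ofReal P.radius}

/-- The set `Π = Δ(A)^S` of policies. -/
def policies (_P : Model N A S) : Set (Fin S → Fin A → ℝ) :=
  {x | ∀ s, x s ∈ stdSimplex ℝ (Fin A)}

/-- The law of the state `s_t` under the policy `x` and the distribution `μ`: at each time step,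
in state `s`, a kernel `y ∼ μ_s` is drawn afresh, an action `a ∼ x_s` is drawn independently, and
the next state is drawn from `y a`. -/
def stateLaw (P : Model N A S) (x : Fin S → Fin A → ℝ) (μ : Fin S → Measure (U A S)) :
    ℕ → Fin S → ℝ
  | 0 => P.init
  | t + 1 => fun s' => ∑ s, P.stateLaw x μ t s *
      ∫ y : U A S, ∑ a, x s a * (y : Fin A → Fin S → ℝ) a s' ∂(μ s)

/-- The expected discounted cost `C(x, μ) = 𝔼 [∑ₜ λ^t c(s_t, a_t)]`.  The series converges
absolutely for every policy and every family of probability measures. -/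
def expectedCost (P : Model N A S) (x : Fin S → Fin A → ℝ) (μ : Fin S → Measure (U A S)) : ℝ :=
  ∑' t : ℕ, P.disc ^ t * ∑ s, P.stateLaw x μ t s * ∑ a, x s a * P.cost s a

/-- The worst-case cost `max_{μ ∈ 𝔻} C(x, μ)`.  The costs of a policy form a bounded set, which is
non-empty because the nominal distribution belongs to `𝔻`. -/
def worstCost (P : Model N A S) (d : Metric) (p : ℝ≥0∞) (x : Fin S → Fin A → ℝ) : ℝ :=
  sSup ((fun μ => P.expectedCost x μ) '' P.ambiguitySet d p)

/-- `x` is an `ε`-optimal policy for `min_{x ∈ Π} max_{μ ∈ 𝔻} C(x, μ)`. -/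
def IsEpsOptimal (P : Model N A S) (d : Metric) (p : ℝ≥0∞) (ε : ℝ)
    (x : Fin S → Fin A → ℝ) : Prop :=
  x ∈ P.policies ∧ ∀ x' ∈ P.policies, P.worstCost d p x ≤ P.worstCost d p x' + ε

/-! ## The first-order algorithm -/

/-- The strategy set `𝔹̃_{p,s}` of the maximizing player at the state `s`. -/
def feasible (P : Model N A S) (d : Metric) (p : ℝ≥0∞) (s : Fin S) :
    Set (Fin N → Fin A → Fin S → ℝ) :=
  {y | (∀ i, y i ∈ U A S) ∧
    ((p = ⊤ ∧ ∀ i, d.dist (y i) (P.sample i s) ≤ P.radius) ∨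
     (p ≠ ⊤ ∧ (1 / (N : ℝ)) * ∑ i, d.dist (y i) (P.sample i s) ^ p.toReal
        ≤ P.radius ^ p.toReal))}

/-- `F^{x, y}(v)_s` for `y = (1/N) ∑ᵢ yᵢ`. -/
def bellman (P : Model N A S) (s : Fin S) (x : Fin A → ℝ) (y : Fin N → Fin A → Fin S → ℝ)
    (v : Fin S → ℝ) : ℝ :=
  ∑ a, x a * (P.cost s a + P.disc * ∑ s', ((1 / (N : ℝ)) * ∑ i, y i a s') * v s')

/-- The Euclidean norm of a value vector. -/
def l2norm (v : Fin S → ℝ) : ℝ := √(∑ s, v s ^ 2)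

/-- The inverse `1/τ = √A λ ‖v‖₂` of the step size of the minimizing player. -/
def invTau (P : Model N A S) (v : Fin S → ℝ) : ℝ := √(A : ℝ) * (P.disc * l2norm v)

/-- The inverse `1/σ = λ ‖v‖₂ / (N √A)` of the step size of the maximizing player. -/
def invSigma (P : Model N A S) (v : Fin S → ℝ) : ℝ :=
  (P.disc * l2norm v) / ((N : ℝ) * √(A : ℝ))

/-- The objective of the proximal update of the minimizing player from `x'`, divided by `τ`:
`⟨c', z⟩ + (1/(2τ)) ‖z - x'‖₂²` with `c'_a = c_{sa} + λ (1/N) ∑ᵢ y_{i,a} · v`.  (In this form it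
makes sense also for `v = 0`, where the step size is infinite.) -/
def proxObjX (P : Model N A S) (s : Fin S) (v : Fin S → ℝ) (y : Fin N → Fin A → Fin S → ℝ)
    (x' z : Fin A → ℝ) : ℝ :=
  ∑ a, (P.cost s a + P.disc * ((1 / (N : ℝ)) * ∑ i, ∑ s', y i a s' * v s')) * z a
    + P.invTau v / 2 * ∑ a, (z a - x' a) ^ 2

/-- The objective of the proximal update of the maximizing player from `y'`, divided by `σ`:
`∑ᵢ ⟨h, zᵢ⟩ + (1/(2σ)) ‖zᵢ - y'ᵢ‖₂²` with `h_{a s'} = - (λ/N) (2 x⁺_a - x_a) v_{s'}`, to be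
minimized. -/
def proxObjY (P : Model N A S) (v : Fin S → ℝ) (x xnext : Fin A → ℝ)
    (y' z : Fin N → Fin A → Fin S → ℝ) : ℝ :=
  ∑ i, (∑ a, ∑ s', (-(P.disc / N) * (2 * xnext a - x a) * v s') * z i a s'
    + P.invSigma v / 2 * ∑ a, ∑ s', (z i a s' - y' i a s') ^ 2)

end Model

/-- `epochStart ℓ = 1² + ⋯ + (ℓ-1)²` is the number of iterations before epoch `ℓ ≥ 1`. -/
def epochStart (l : ℕ) : ℕ := ∑ j ∈ Finset.range l, j ^ 2

/-- The average of `z` over the times in `I` with weight `t` at time `t`. -/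
def linAvg (I : Finset ℕ) (z : ℕ → ℝ) : ℝ := (∑ t ∈ I, (t : ℝ) * z t) / ∑ t ∈ I, (t : ℝ)

/-- The initial value vector, policy and kernels of the algorithm. -/
structure Start {N A S : ℕ} (P : Model N A S) (d : Metric) (p : ℝ≥0∞) where
  v : Fin S → ℝ
  x : Fin S → Fin A → ℝ
  x_mem : x ∈ P.policies
  y : Fin S → Fin N → Fin A → Fin S → ℝ
  y_mem : ∀ s, y s ∈ P.feasible d p s

/-- `x`, `y`, `v` are the iterates of the algorithm with `k` epochs, started at `I`.
Epoch `ℓ` has `ℓ²` iterations, which produce the iterates of the times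
`epochStart ℓ + 1, …, epochStart ℓ + ℓ²` from the last iterate of the epoch before; then the value
vector is updated with the averages of the epoch.  The proximal updates of the minimizing player
are exact; those of the maximizing player are feasible points that minimize the proximal
objective up to `δ`. -/
structure IsRun {N A S : ℕ} (P : Model N A S) (d : Metric) (p : ℝ≥0∞) (I : Start P d p)
    (k : ℕ) (δ : ℝ) (x : ℕ → Fin S → Fin A → ℝ) (y : ℕ → Fin S → Fin N → Fin A → Fin S → ℝ)
    (v : ℕ → Fin S → ℝ) : Prop where
  x_zero : x 0 = I.x
  y_zero : y 0 = I.y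
  v_one : v 1 = I.v
  x_mem : ∀ l ∈ Finset.Icc 1 k, ∀ t ∈ Finset.Ico (epochStart l) (epochStart (l + 1)), ∀ s,
    x (t + 1) s ∈ stdSimplex ℝ (Fin A)
  x_min : ∀ l ∈ Finset.Icc 1 k, ∀ t ∈ Finset.Ico (epochStart l) (epochStart (l + 1)), ∀ s,
    ∀ z ∈ stdSimplex ℝ (Fin A),
      P.proxObjX s (v l) (y t s) (x t s) (x (t + 1) s) ≤ P.proxObjX s (v l) (y t s) (x t s) z
  y_mem : ∀ l ∈ Finset.Icc 1 k, ∀ t ∈ Finset.Ico (epochStart l) (epochStart (l + 1)), ∀ s,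
    y (t + 1) s ∈ P.feasible d p s
  y_min : ∀ l ∈ Finset.Icc 1 k, ∀ t ∈ Finset.Ico (epochStart l) (epochStart (l + 1)), ∀ s,
    ∀ z ∈ P.feasible d p s,
      P.proxObjY (v l) (x t s) (x (t + 1) s) (y t s) (y (t + 1) s)
        ≤ P.proxObjY (v l) (x t s) (x (t + 1) s) (y t s) z + δ
  v_step : ∀ l ∈ Finset.Icc 1 k, ∀ s,
    v (l + 1) s = P.bellman s
      (fun a => linAvg (Finset.Ioc (epochStart l) (epochStart (l + 1))) (fun t => x t s a))
      (fun i a s' => linAvg (Finset.Ioc (epochStart l) (epochStart (l + 1)))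
        (fun t => y t s i a s'))
      (v l)

/-- The policy returned after `k` epochs: the weighted average over the times
`1, …, T = 1² + ⋯ + k²`. -/
def outputX {A S : ℕ} (k : ℕ) (x : ℕ → Fin S → Fin A → ℝ) : Fin S → Fin A → ℝ :=
  fun s a => linAvg (Finset.Ioc 0 (epochStart (k + 1))) (fun t => x t s a)

/-- The kernels returned after `k` epochs. -/
def outputY {N A S : ℕ} (k : ℕ) (y : ℕ → Fin S → Fin N → Fin A → Fin S → ℝ) :
    Fin S → Fin N → Fin A → Fin S → ℝ :=
  fun s i a s' => linAvg (Finset.Ioc 0 (epochStart (k + 1))) (fun t => y t s i a s')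

/-! ## Arithmetic operations

Algebraic computation trees over the reals: programs that store exact real numbers in registers and
use arithmetic operations, square roots and comparisons. -/

/-- The binary operations. -/
inductive ArithOp where
  | add
  | sub
  | mul
  | div

/-- The value of a binary operation (division by zero returns `0`; this spares programs only a
comparison with zero). -/
def ArithOp.apply : ArithOp → ℝ → ℝ → ℝ
  | .add, a, b => a + b
  | .sub, a, b => a - b
  | .mul, a, b => a * b
  | .div, a, b => a / b

/-- Algebraic computation trees with inputs indexed by `ι` and outputs indexed by `ο`.  The
registers are the inputs (read only) and the work registers `0, 1, 2, …`; the first argument of the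
writing instructions is the work register that receives the result. -/
inductive ArithProg (ι ο : Type) where
  /-- stop, the outputs being in the given registers -/
  | ret (out : ο → ι ⊕ ℕ)
  /-- store a natural number -/
  | const (dst : ℕ) (n : ℕ) (next : ArithProg ι ο)
  /-- store the result of a binary operation -/
  | op (dst : ℕ) (o : ArithOp) (a b : ι ⊕ ℕ) (next : ArithProg ι ο)
  /-- store a square root -/
  | sqrt (dst : ℕ) (a : ι ⊕ ℕ) (next : ArithProg ι ο)
  /-- continue with `yes` if the first number is at most the second, with `no` otherwise -/
  | ifLE (a b : ι ⊕ ℕ) (yes no : ArithProg ι ο)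

namespace ArithProg

variable {ι ο : Type}

/-- The registers after the work register `dst` has received the value `r`. -/
def write (m : ι ⊕ ℕ → ℝ) (dst : ℕ) (r : ℝ) : ι ⊕ ℕ → ℝ :=
  Sum.elim (fun i => m (Sum.inl i)) (Function.update (fun n => m (Sum.inr n)) dst r)

/-- The result of a computation, with the number of instructions that were carried out. -/
def exec : ArithProg ι ο → (ι ⊕ ℕ → ℝ) → (ο → ℝ) × ℕ
  | ret out, m => (fun j => m (out j), 0)
  | const dst n next, m =>
      let r := next.exec (write m dst n)
      (r.1, r.2 + 1)
  | op dst o a b next, m =>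
      let r := next.exec (write m dst (o.apply (m a) (m b)))
      (r.1, r.2 + 1)
  | sqrt dst a next, m =>
      let r := next.exec (write m dst √(m a))
      (r.1, r.2 + 1)
  | ifLE a b yes no, m =>
      let r := if m a ≤ m b then yes.exec m else no.exec m
      (r.1, r.2 + 1)

/-- The outputs of a program on the given inputs (the work registers are initially zero). -/
def result (c : ArithProg ι ο) (inp : ι → ℝ) : ο → ℝ := (c.exec (Sum.elim inp fun _ => 0)).1

/-- The number of operations that a program carries out on the given inputs. -/
def numOps (c : ArithProg ι ο) (inp : ι → ℝ) : ℕ := (c.exec (Sum.elim inp fun _ => 0)).2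

end ArithProg

/-- The names of the real numbers that make up the input of the algorithm. -/
inductive InVar (N A S : ℕ) where
  | disc
  | radius
  | cost (s : Fin S) (a : Fin A)
  | init (s : Fin S)
  | sample (i : Fin N) (s : Fin S) (a : Fin A) (s' : Fin S)
  | v (s : Fin S)
  | x (s : Fin S) (a : Fin A)
  | y (s : Fin S) (i : Fin N) (a : Fin A) (s' : Fin S)

/-- The names of the real numbers that make up the output of the algorithm. -/
inductive OutVar (N A S : ℕ) where
  | x (s : Fin S) (a : Fin A)
  | y (s : Fin S) (i : Fin N) (a : Fin A) (s' : Fin S)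

/-- The input that describes a model and a starting point. -/
def inputOf {N A S : ℕ} {P : Model N A S} {d : Metric} {p : ℝ≥0∞} (I : Start P d p) :
    InVar N A S → ℝ
  | .disc => P.disc
  | .radius => P.radius
  | .cost s a => P.cost s a
  | .init s => P.init s
  | .sample i s a s' => P.sample i s a s'
  | .v s => I.v s
  | .x s a => I.x s a
  | .y s i a s' => I.y s i a s'

/-- The program `c` computes the output of the algorithm, with `k` epochs and proximal updates of
accuracy `δ`, for the model `P` and the starting point `I`. -/
def Computes {N A S : ℕ} (c : ArithProg (InVar N A S) (OutVar N A S)) {P : Model N A S}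
    {d : Metric} {p : ℝ≥0∞} (I : Start P d p) (k : ℕ) (δ : ℝ) : Prop :=
  ∃ x y v, IsRun P d p I k δ x y v ∧
    (∀ s a, c.result (inputOf I) (.x s a) = outputX k x s a) ∧
    (∀ s i a s', c.result (inputOf I) (.y s i a s') = outputY k y s i a s')

/-- The exponent of `log (1/ε)`. -/
def logExponent : Metric → ℕ
  | .l1 => 1
  | .l2 => 1
  | .linf => 3

end WDRMDP

end

/-!
# A first-order method for Wasserstein distributionally robust MDPs

The theorem combines a fact about convergence, which holds for every execution of the algorithm,
with a program whose operations can be counted.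

*Reduction to mean kernels.* Kernels are drawn afresh at each step, so the cost of a policy depends
on the product measure only through the mean kernel of each factor. The means of the distributions
in a Wasserstein ball are the means `1/N ∑ y i` of feasible families `y`: given a coupling with the
empirical distribution, the conditional means given the observations are no farther from the
observations, by Jensen's inequality (`exists_feasible_mean`; near-optimal couplings and
compactness of the feasible set replace the existence of an optimal coupling), and conversely the
uniform distribution on a feasible family lies in the ball (`wasserstein_uniformMeasure_le`). The
robust problem is thus a dynamic program with a contracting Bellman operator `Model.robust`, and
telescoping discounted sums shows that a policy which solves the robust Bellman equation up to `γ`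
is optimal up to `γ / (1 - λ)` (`isEpsOptimal_of_upper_le`).

*Convergence.* Within an epoch the value vector `v` is fixed and the iteration is a primal-dual
method for one bilinear saddle problem per state. The step sizes make the proximal terms dominate
the coupling, so a potential decreases and pays for the gap (`saddle_step`); the linear weights turn
this into a gap of order `√(AS) / ℓ² + √δ` for the averages of epoch `ℓ` (`IsRun.sum_gap_le`). The
inexact proximal steps cost only `√δ`, as an objective value within `δ` of the minimum gives a
variational inequality up to `O(√δ)` (`prox_inequality`). Hence the value update is the Bellman
operator up to that error, and since `1 / ℓ²` eventually decreases more slowly than any geometric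
sequence, `v ℓ` is within `O(√(AS) / ℓ²) + O(√δ)` of the fixed point (`contraction_rate`).
Averaging over all epochs leaves a residual `O(√(AS) / k²) + O(√δ)` for the policy that is returned
(`IsRun.upper_output_le`).

*The program.* Programs are assembled in a small monadic language of computation trees (`Comp`)
with a Hoare-style specification (`Comp.Does`) that bounds the number of instructions. The basic
subroutine minimizes a separable piecewise quadratic function over a simplex exactly: the
optimality condition is a piecewise affine equation for one multiplier, solved by sorting the break
points, bisection and interpolation (`does_rowSolve`). It is the whole proximal step of the
minimizing player. For the maximizing player the distance constraint is relaxed with a multiplier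
`ρ`. With `d₁` and `d₂²` the penalized problem separates into rows; with `d_∞` a ternary search for
the radius comes first. The multiplier is found by bisection, and a convex combination of the two
final trials meets the constraint exactly and is within `δ` of the minimum (`does_constrained`).
Thus what the program computes is the output of an exact execution with accuracy `δ`
(`program_spec`).

*Counting.* The program takes `O(k³)` iterations, each of order `N A S²` up to logarithms. It
suffices to take `k` of order `(AS)^(1/4) ε^(-1/2)` and a search depth `j` of order
`log (AS) log (1/ε)`, which gives `N A^1.75 S^2.75 ε^(-1.5)` up to logarithms; the factor
`(AS)^(3/4)` by which this falls short of the bound absorbs the logarithms of `A` and `S` that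
come from the searches (`exists_parameters`, `total_cost_le`).
-/

noncomputable section

namespace WDRMDP

/-! ### A language for computation trees -/

/-- Registers: the inputs and the work registers. -/
abbrev Reg (ι : Type) := ι ⊕ ℕ

/-- Computation trees whose leaves carry data of type `α` (names of registers, mostly), which is
known when the program is written down. The results of instructions are stored in fresh work
registers, so that no register is ever overwritten; the continuation receives the name of the
fresh register. -/
inductive Comp (ι α : Type) where
  | ret (a : α)
  | const (n : ℕ) (next : Reg ι → Comp ι α)
  | op (o : ArithOp) (a b : Reg ι) (next : Reg ι → Comp ι α)
  | sqrt (a : Reg ι) (next : Reg ι → Comp ι α)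
  | ifLE (a b : Reg ι) (yes no : Comp ι α)

/-- The contents of the registers; the work registers from `next` on are unused so far. -/
structure Store (ι : Type) where
  next : ℕ
  val : Reg ι → ℝ

namespace Store

variable {ι : Type}

/-- Store a number in the first unused register. -/
def push (σ : Store ι) (r : ℝ) : Store ι := ⟨σ.next + 1, ArithProg.write σ.val σ.next r⟩

/-- The register has been written to. -/
def Valid (σ : Store ι) : Reg ι → Prop
  | Sum.inl _ => True
  | Sum.inr n => n < σ.next

/-- `σ'` arises from `σ` by writing to unused registers. -/
def Ext (σ σ' : Store ι) : Prop :=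
  σ.next ≤ σ'.next ∧ ∀ r, σ.Valid r → σ'.val r = σ.val r

/-- The register `r` is in use and contains `x`. -/
def Holds (σ : Store ι) (r : Reg ι) (x : ℝ) : Prop := σ.Valid r ∧ σ.val r = x

theorem Ext.refl (σ : Store ι) : σ.Ext σ := ⟨le_rfl, fun _ _ => rfl⟩

theorem Ext.valid {σ σ' : Store ι} (h : σ.Ext σ') {r : Reg ι} (hr : σ.Valid r) : σ'.Valid r := by
  cases r with
  | inl _ => trivial
  | inr n => exact lt_of_lt_of_le hr h.1

theorem Ext.trans {σ σ' σ'' : Store ι} (h : σ.Ext σ') (h' : σ'.Ext σ'') : σ.Ext σ'' :=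
  ⟨h.1.trans h'.1, fun r hr => (h'.2 r (h.valid hr)).trans (h.2 r hr)⟩

theorem Holds.ext {σ σ' : Store ι} {r : Reg ι} {x : ℝ} (hr : σ.Holds r x) (h : σ.Ext σ') :
    σ'.Holds r x := ⟨h.valid hr.1, (h.2 r hr.1).trans hr.2⟩

theorem push_ext (σ : Store ι) (x : ℝ) : σ.Ext (σ.push x) := by
  refine ⟨Nat.le_succ _, fun r hr => ?_⟩
  cases r with
  | inl _ => rfl
  | inr n =>
    have : n ≠ σ.next := ne_of_lt hr
    simp [push, ArithProg.write, this]

theorem push_holds (σ : Store ι) (x : ℝ) : (σ.push x).Holds (Sum.inr σ.next) x :=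
  ⟨Nat.lt_succ_self _, by simp [push, ArithProg.write]⟩

end Store

namespace Comp

variable {ι ο α β : Type}

/-- Sequential composition. -/
def bind : Comp ι α → (α → Comp ι β) → Comp ι β
  | ret a, f => f a
  | const n next, f => const n fun r => (next r).bind f
  | op o a b next, f => op o a b fun r => (next r).bind f
  | sqrt a next, f => sqrt a fun r => (next r).bind f
  | ifLE a b yes no, f => ifLE a b (yes.bind f) (no.bind f)

/-- The data at the leaf that is reached, the final store and the number of instructions. -/
def run : Comp ι α → Store ι → α × Store ι × ℕ
  | ret a, σ => (a, σ, 0)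
  | const n next, σ =>
      let r := (next (Sum.inr σ.next)).run (σ.push n)
      (r.1, r.2.1, r.2.2 + 1)
  | op o a b next, σ =>
      let r := (next (Sum.inr σ.next)).run (σ.push (o.apply (σ.val a) (σ.val b)))
      (r.1, r.2.1, r.2.2 + 1)
  | sqrt a next, σ =>
      let r := (next (Sum.inr σ.next)).run (σ.push √(σ.val a))
      (r.1, r.2.1, r.2.2 + 1)
  | ifLE a b yes no, σ =>
      let r := if σ.val a ≤ σ.val b then yes.run σ else no.run σ
      (r.1, r.2.1, r.2.2 + 1)

/-- The program that carries out the computation, when the work registers from `n` on are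
unused. -/
def compile : Comp ι (ο → Reg ι) → ℕ → ArithProg ι ο
  | ret a, _ => .ret a
  | const m next, n => .const n m ((next (Sum.inr n)).compile (n + 1))
  | op o a b next, n => .op n o a b ((next (Sum.inr n)).compile (n + 1))
  | sqrt a next, n => .sqrt n a ((next (Sum.inr n)).compile (n + 1))
  | ifLE a b yes no, n => .ifLE a b (yes.compile n) (no.compile n)

theorem exec_compile (c : Comp ι (ο → Reg ι)) (σ : Store ι) :
    (c.compile σ.next).exec σ.val =
      (fun j => (c.run σ).2.1.val ((c.run σ).1 j), (c.run σ).2.2) := by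
  induction c generalizing σ with
  | ret a => rfl
  | const m next ih =>
    simp only [compile, ArithProg.exec, run]
    exact congrArg (fun r : (ο → ℝ) × ℕ => (r.1, r.2 + 1)) (ih _ (σ.push m))
  | op o a b next ih =>
    simp only [compile, ArithProg.exec, run]
    exact congrArg (fun r : (ο → ℝ) × ℕ => (r.1, r.2 + 1))
      (ih _ (σ.push (o.apply (σ.val a) (σ.val b))))
  | sqrt a next ih =>
    simp only [compile, ArithProg.exec, run]
    exact congrArg (fun r : (ο → ℝ) × ℕ => (r.1, r.2 + 1)) (ih _ (σ.push √(σ.val a)))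
  | ifLE a b yes no ih1 ih2 =>
    simp only [compile, ArithProg.exec, run]
    split_ifs
    · rw [ih1]
    · rw [ih2]

theorem run_bind (c : Comp ι α) (f : α → Comp ι β) (σ : Store ι) :
    (c.bind f).run σ = (((f (c.run σ).1).run (c.run σ).2.1).1,
      ((f (c.run σ).1).run (c.run σ).2.1).2.1,
      ((f (c.run σ).1).run (c.run σ).2.1).2.2 + (c.run σ).2.2) := by
  induction c generalizing σ with
  | ret a => rfl
  | const n next ih => simp only [bind, run, ih]; rfl
  | op o a b next ih => simp only [bind, run, ih]; rfl
  | sqrt a next ih => simp only [bind, run, ih]; rfl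
  | ifLE a b yes no ih1 ih2 =>
    simp only [bind, run]
    split_ifs
    · rw [ih1]; rfl
    · rw [ih2]; rfl

/-- Started in the store `σ`, the computation takes at most `t` instructions, overwrites nothing,
and ends in a leaf and a store that satisfy `Q`. -/
def Does (c : Comp ι α) (σ : Store ι) (t : ℕ) (Q : α → Store ι → Prop) : Prop :=
  σ.Ext (c.run σ).2.1 ∧ (c.run σ).2.2 ≤ t ∧ Q (c.run σ).1 (c.run σ).2.1

theorem Does.ret {σ : Store ι} {Q : α → Store ι → Prop} {a : α} {t : ℕ} (h : Q a σ) :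
    (Comp.ret a : Comp ι α).Does σ t Q := ⟨.refl σ, Nat.zero_le _, h⟩

theorem Does.mono {c : Comp ι α} {σ : Store ι} {t t' : ℕ} {Q Q' : α → Store ι → Prop}
    (h : c.Does σ t Q) (ht : t ≤ t') (hQ : ∀ a σ', σ.Ext σ' → Q a σ' → Q' a σ') :
    c.Does σ t' Q' := ⟨h.1, h.2.1.trans ht, hQ _ _ h.1 h.2.2⟩

theorem Does.bind {c : Comp ι α} {f : α → Comp ι β} {σ : Store ι} {t₁ : ℕ} (t₂ : ℕ) {t : ℕ}
    {Q₁ : α → Store ι → Prop} {Q : β → Store ι → Prop} (h : c.Does σ t₁ Q₁) (ht : t₁ + t₂ ≤ t)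
    (hf : ∀ a σ', σ.Ext σ' → Q₁ a σ' → (f a).Does σ' t₂ Q) : (c.bind f).Does σ t Q := by
  obtain ⟨h1, h2, h3⟩ := h
  obtain ⟨g1, g2, g3⟩ := hf _ _ h1 h3
  unfold Does
  rw [run_bind]
  exact ⟨h1.trans g1, by simp only; omega, g3⟩

theorem Does.ifLE {σ : Store ι} {a b : Reg ι} {yes no : Comp ι α} {t t' : ℕ}
    {Q : α → Store ι → Prop} (ht : t + 1 ≤ t') (h1 : σ.val a ≤ σ.val b → yes.Does σ t Q)
    (h2 : σ.val b < σ.val a → no.Does σ t Q) : (Comp.ifLE a b yes no).Does σ t' Q := by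
  unfold Does at *
  simp only [run]
  split_ifs with h
  · obtain ⟨g1, g2, g3⟩ := h1 h
    exact ⟨g1, by omega, g3⟩
  · obtain ⟨g1, g2, g3⟩ := h2 (not_le.mp h)
    exact ⟨g1, by omega, g3⟩

theorem Does.const {σ : Store ι} {n : ℕ} {next : Reg ι → Comp ι α} {t t' : ℕ}
    {Q : α → Store ι → Prop} (ht : t + 1 ≤ t')
    (h : ∀ r σ', σ.Ext σ' → σ'.Holds r n → (next r).Does σ' t Q) :
    (Comp.const n next).Does σ t' Q := by
  obtain ⟨g1, g2, g3⟩ := h _ _ (σ.push_ext n) (σ.push_holds n)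
  exact ⟨(σ.push_ext _).trans g1, by simp only [run]; omega, g3⟩

theorem Does.op {σ : Store ι} {o : ArithOp} {a b : Reg ι} {next : Reg ι → Comp ι α} {t t' : ℕ}
    {Q : α → Store ι → Prop} (ht : t + 1 ≤ t')
    (h : ∀ r σ', σ.Ext σ' → σ'.Holds r (o.apply (σ.val a) (σ.val b)) → (next r).Does σ' t Q) :
    (Comp.op o a b next).Does σ t' Q := by
  obtain ⟨g1, g2, g3⟩ := h _ _ (σ.push_ext _) (σ.push_holds _)
  exact ⟨(σ.push_ext _).trans g1, by simp only [run]; omega, g3⟩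

theorem Does.sqrt {σ : Store ι} {a : Reg ι} {next : Reg ι → Comp ι α} {t t' : ℕ}
    {Q : α → Store ι → Prop} (ht : t + 1 ≤ t')
    (h : ∀ r σ', σ.Ext σ' → σ'.Holds r √(σ.val a) → (next r).Does σ' t Q) :
    (Comp.sqrt a next).Does σ t' Q := by
  obtain ⟨g1, g2, g3⟩ := h _ _ (σ.push_ext _) (σ.push_holds _)
  exact ⟨(σ.push_ext _).trans g1, by simp only [run]; omega, g3⟩

/-- A postcondition that later computations cannot spoil. -/
def Stable (Q : α → Store ι → Prop) : Prop :=
  ∀ a σ σ', σ.Ext σ' → Q a σ → Q a σ'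

/-- Carry out `n` computations one after the other. -/
def forFin : (n : ℕ) → (Fin n → Comp ι α) → Comp ι (Fin n → α)
  | 0, _ => ret Fin.elim0
  | n + 1, f => (forFin n fun i => f i.castSucc).bind fun v =>
      (f (Fin.last n)).bind fun a => ret (Fin.snoc (α := fun _ => α) v a)

theorem Does.forFin {n : ℕ} {f : Fin n → Comp ι α} {σ : Store ι} (t : ℕ) {t' : ℕ}
    {Q : Fin n → α → Store ι → Prop} (hQ : ∀ i, Stable (Q i)) (ht : n * t ≤ t')
    (h : ∀ i σ', σ.Ext σ' → (f i).Does σ' t (Q i)) :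
    (Comp.forFin n f).Does σ t' fun v σ' => ∀ i, Q i (v i) σ' := by
  induction n generalizing t' with
  | zero => exact .ret fun i => i.elim0
  | succ n ih =>
    refine .bind t (ih (fun i => hQ i.castSucc) le_rfl fun i σ' hs => h i.castSucc σ' hs)
      ((Nat.succ_mul n t).symm.trans_le ht) fun v σ₁ h₁ hv => ?_
    refine .bind 0 (h (Fin.last n) σ₁ h₁) le_rfl fun a σ₂ h₂ ha => .ret fun i => ?_
    refine Fin.lastCases ?_ (fun i => ?_) i
    · simpa using ha
    · simpa using hQ _ _ _ _ h₂ (hv i)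

/-- Iterate a computation. -/
def iter (f : ℕ → α → Comp ι α) : ℕ → α → Comp ι α
  | 0, a => ret a
  | n + 1, a => (iter f n a).bind (f n)

theorem Does.iter {f : ℕ → α → Comp ι α} {σ : Store ι} {n : ℕ} {a : α} (t : ℕ) {t' : ℕ}
    {Q : ℕ → α → Store ι → Prop} (ht : n * t ≤ t') (h0 : Q 0 a σ)
    (h : ∀ m < n, ∀ a σ', σ.Ext σ' → Q m a σ' → (f m a).Does σ' t (Q (m + 1))) :
    (Comp.iter f n a).Does σ t' (Q n) := by
  induction n generalizing t' with
  | zero => exact .ret h0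
  | succ n ih =>
    refine .bind t (ih le_rfl fun m hm => h m (hm.trans (Nat.lt_succ_self n)))
      ((Nat.succ_mul n t).symm.trans_le ht) fun a σ₁ h₁ hv => h n (Nat.lt_succ_self n) a σ₁ h₁ hv

end Comp

/-! ### Arithmetic expressions -/

/-- Arithmetic expressions over the registers. -/
inductive Ex (ι : Type) where
  | reg (r : Reg ι)
  | nat (n : ℕ)
  | op (o : ArithOp) (a b : Ex ι)
  | sqrt (a : Ex ι)
  | max (a b : Ex ι)
  | min (a b : Ex ι)

namespace Ex

variable {ι : Type}

instance : Add (Ex ι) := ⟨.op .add⟩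
instance : Sub (Ex ι) := ⟨.op .sub⟩
instance : Mul (Ex ι) := ⟨.op .mul⟩
instance : Div (Ex ι) := ⟨.op .div⟩

/-- The sum of finitely many expressions. -/
def sum : {n : ℕ} → (Fin n → Ex ι) → Ex ι
  | 0, _ => nat 0
  | _ + 1, f => sum (fun i => f i.castSucc) + f (Fin.last _)

/-- A bound for the number of instructions that evaluate the expression. -/
def size : Ex ι → ℕ
  | reg _ => 0
  | nat _ => 1
  | op _ a b => a.size + b.size + 1
  | sqrt a => a.size + 1
  | max a b => a.size + b.size + 1
  | min a b => a.size + b.size + 1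

/-- The value of an expression. -/
def value (σ : Store ι) : Ex ι → ℝ
  | reg r => σ.val r
  | nat n => n
  | op o a b => o.apply (a.value σ) (b.value σ)
  | sqrt a => √(a.value σ)
  | max a b => Max.max (a.value σ) (b.value σ)
  | min a b => Min.min (a.value σ) (b.value σ)

/-- All registers of the expression are in use. -/
def Valid (σ : Store ι) : Ex ι → Prop
  | reg r => σ.Valid r
  | nat _ => True
  | op _ a b => a.Valid σ ∧ b.Valid σ
  | sqrt a => a.Valid σ
  | max a b => a.Valid σ ∧ b.Valid σ
  | min a b => a.Valid σ ∧ b.Valid σ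

/-- The expression has the value `x`. -/
def Has (σ : Store ι) (e : Ex ι) (x : ℝ) : Prop := e.Valid σ ∧ e.value σ = x

/-- Evaluate an expression. -/
def eval : Ex ι → Comp ι (Reg ι)
  | reg r => .ret r
  | nat n => .const n .ret
  | op o a b => a.eval.bind fun r => b.eval.bind fun r' => .op o r r' .ret
  | sqrt a => a.eval.bind fun r => .sqrt r .ret
  | max a b => a.eval.bind fun r => b.eval.bind fun r' => .ifLE r r' (.ret r') (.ret r)
  | min a b => a.eval.bind fun r => b.eval.bind fun r' => .ifLE r r' (.ret r) (.ret r')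

variable {σ σ' : Store ι} {e e₁ e₂ : Ex ι} {x y : ℝ}

theorem Has.ext (h : e.Has σ x) (hs : σ.Ext σ') : e.Has σ' x := by
  induction e generalizing x with
  | reg r => exact Store.Holds.ext (r := r) h hs
  | nat n => exact h
  | op o a b ih1 ih2 =>
    obtain ⟨⟨h1, h2⟩, rfl⟩ := h
    have g1 := ih1 ⟨h1, rfl⟩
    have g2 := ih2 ⟨h2, rfl⟩
    exact ⟨⟨g1.1, g2.1⟩, by simp only [value, g1.2, g2.2]⟩
  | sqrt a ih =>
    obtain ⟨h1, rfl⟩ := h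
    have g1 := ih ⟨h1, rfl⟩
    exact ⟨g1.1, by simp only [value, g1.2]⟩
  | max a b ih1 ih2 =>
    obtain ⟨⟨h1, h2⟩, rfl⟩ := h
    have g1 := ih1 ⟨h1, rfl⟩
    have g2 := ih2 ⟨h2, rfl⟩
    exact ⟨⟨g1.1, g2.1⟩, by simp only [value, g1.2, g2.2]⟩
  | min a b ih1 ih2 =>
    obtain ⟨⟨h1, h2⟩, rfl⟩ := h
    have g1 := ih1 ⟨h1, rfl⟩
    have g2 := ih2 ⟨h2, rfl⟩
    exact ⟨⟨g1.1, g2.1⟩, by simp only [value, g1.2, g2.2]⟩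

theorem Has.congr (h : e.Has σ x) (hxy : x = y) : e.Has σ y := hxy ▸ h

theorem Has.reg {r : Reg ι} (h : σ.Holds r x) : (Ex.reg r).Has σ x := h
theorem Has.nat (n : ℕ) : (Ex.nat n).Has σ (n : ℝ) := ⟨trivial, rfl⟩
theorem Has.add (h₁ : e₁.Has σ x) (h₂ : e₂.Has σ y) : (e₁ + e₂).Has σ (x + y) :=
  ⟨⟨h₁.1, h₂.1⟩, by rw [← h₁.2, ← h₂.2]; rfl⟩
theorem Has.sub (h₁ : e₁.Has σ x) (h₂ : e₂.Has σ y) : (e₁ - e₂).Has σ (x - y) :=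
  ⟨⟨h₁.1, h₂.1⟩, by rw [← h₁.2, ← h₂.2]; rfl⟩
theorem Has.mul (h₁ : e₁.Has σ x) (h₂ : e₂.Has σ y) : (e₁ * e₂).Has σ (x * y) :=
  ⟨⟨h₁.1, h₂.1⟩, by rw [← h₁.2, ← h₂.2]; rfl⟩
theorem Has.div (h₁ : e₁.Has σ x) (h₂ : e₂.Has σ y) : (e₁ / e₂).Has σ (x / y) :=
  ⟨⟨h₁.1, h₂.1⟩, by rw [← h₁.2, ← h₂.2]; rfl⟩
theorem Has.sqrt (h : e.Has σ x) : (Ex.sqrt e).Has σ √x := ⟨h.1, by rw [← h.2]; rfl⟩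
theorem Has.max (h₁ : e₁.Has σ x) (h₂ : e₂.Has σ y) : (Ex.max e₁ e₂).Has σ (Max.max x y) :=
  ⟨⟨h₁.1, h₂.1⟩, by rw [← h₁.2, ← h₂.2]; rfl⟩
theorem Has.min (h₁ : e₁.Has σ x) (h₂ : e₂.Has σ y) : (Ex.min e₁ e₂).Has σ (Min.min x y) :=
  ⟨⟨h₁.1, h₂.1⟩, by rw [← h₁.2, ← h₂.2]; rfl⟩

theorem Has.sum {n : ℕ} {f : Fin n → Ex ι} {x : Fin n → ℝ} (h : ∀ i, (f i).Has σ (x i)) :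
    (Ex.sum f).Has σ (∑ i, x i) := by
  induction n with
  | zero => simpa [Ex.sum] using Has.nat (σ := σ) 0
  | succ n ih =>
    rw [Fin.sum_univ_castSucc]
    exact (ih fun i => h i.castSucc).add (h (Fin.last n))

@[simp] theorem size_reg (r : Reg ι) : (Ex.reg r).size = 0 := rfl
@[simp] theorem size_nat (n : ℕ) : (Ex.nat n : Ex ι).size = 1 := rfl
@[simp] theorem size_add : (e₁ + e₂).size = e₁.size + e₂.size + 1 := rfl
@[simp] theorem size_sub : (e₁ - e₂).size = e₁.size + e₂.size + 1 := rfl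
@[simp] theorem size_mul : (e₁ * e₂).size = e₁.size + e₂.size + 1 := rfl
@[simp] theorem size_div : (e₁ / e₂).size = e₁.size + e₂.size + 1 := rfl
@[simp] theorem size_sqrt : (Ex.sqrt e).size = e.size + 1 := rfl
@[simp] theorem size_max : (Ex.max e₁ e₂).size = e₁.size + e₂.size + 1 := rfl
@[simp] theorem size_min : (Ex.min e₁ e₂).size = e₁.size + e₂.size + 1 := rfl

theorem size_sum_le {n t : ℕ} {f : Fin n → Ex ι} (h : ∀ i, (f i).size ≤ t) :
    (Ex.sum f).size ≤ n * (t + 1) + 1 := by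
  induction n with
  | zero => simp [Ex.sum]
  | succ n ih =>
    have h1 := ih fun i => h i.castSucc
    have h2 := h (Fin.last n)
    simp only [Ex.sum, size_add]
    calc _ ≤ n * (t + 1) + 1 + t + 1 := by omega
      _ = _ := by ring

theorem does_eval (h : e.Has σ x) :
    e.eval.Does σ e.size fun r σ' => σ'.Holds r x := by
  induction e generalizing x σ with
  | reg r => exact .ret h
  | nat n => exact .const (t := 0) le_rfl fun r σ' _ hr => .ret (h.2 ▸ hr)
  | op o a b ih1 ih2 =>
    obtain ⟨⟨h1, h2⟩, rfl⟩ := h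
    refine .bind (b.size + 1) (ih1 ⟨h1, rfl⟩) (by simp only [size]; omega) fun r σ₁ e₁ hr => ?_
    refine .bind 1 (ih2 (Has.ext ⟨h2, rfl⟩ e₁)) le_rfl fun r' σ₂ e₂ hr' => ?_
    refine .op (t := 0) le_rfl fun r'' σ₃ e₃ hr'' => .ret ?_
    rw [(hr.ext e₂).2, hr'.2] at hr''
    exact hr''
  | sqrt a ih =>
    obtain ⟨h1, rfl⟩ := h
    refine .bind 1 (ih ⟨h1, rfl⟩) (by simp only [size]; omega) fun r σ₁ e₁ hr => ?_
    refine .sqrt (t := 0) le_rfl fun r'' σ₃ e₃ hr'' => .ret ?_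
    rw [hr.2] at hr''
    exact hr''
  | max a b ih1 ih2 =>
    obtain ⟨⟨h1, h2⟩, rfl⟩ := h
    refine .bind (b.size + 1) (ih1 ⟨h1, rfl⟩) (by simp only [size]; omega) fun r σ₁ e₁ hr => ?_
    refine .bind 1 (ih2 (Has.ext ⟨h2, rfl⟩ e₁)) le_rfl fun r' σ₂ e₂ hr' => ?_
    have hr1 := hr.ext e₂
    refine .ifLE (t := 0) le_rfl (fun hle => .ret ?_) fun hle => .ret ?_
    · rw [hr1.2, hr'.2] at hle
      simpa only [value, max_eq_right hle] using hr'
    · rw [hr1.2, hr'.2] at hle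
      simpa only [value, max_eq_left hle.le] using hr1
  | min a b ih1 ih2 =>
    obtain ⟨⟨h1, h2⟩, rfl⟩ := h
    refine .bind (b.size + 1) (ih1 ⟨h1, rfl⟩) (by simp only [size]; omega) fun r σ₁ e₁ hr => ?_
    refine .bind 1 (ih2 (Has.ext ⟨h2, rfl⟩ e₁)) le_rfl fun r' σ₂ e₂ hr' => ?_
    have hr1 := hr.ext e₂
    refine .ifLE (t := 0) le_rfl (fun hle => .ret ?_) fun hle => .ret ?_
    · rw [hr1.2, hr'.2] at hle
      simpa only [value, min_eq_left hle] using hr1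
    · rw [hr1.2, hr'.2] at hle
      simpa only [value, min_eq_right hle.le] using hr'

/-- Evaluate an expression and continue with the register that holds its value. -/
theorem does_eval_bind {α : Type} {f : Reg ι → Comp ι α} {t' : ℕ} (t : ℕ)
    {Q : α → Store ι → Prop} (h : e.Has σ x) (ht : e.size + t ≤ t')
    (hf : ∀ r σ', σ.Ext σ' → σ'.Holds r x → (f r).Does σ' t Q) : (e.eval.bind f).Does σ t' Q :=
  .bind t (does_eval h) ht hf

end Ex

theorem stable_holds {ι : Type} (x : ℝ) :
    Comp.Stable fun (r : Reg ι) (σ : Store ι) => σ.Holds r x :=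
  fun _ _ _ hs h => h.ext hs

/-- Evaluate a vector of expressions. -/
def evalVec {ι : Type} {n : ℕ} (e : Fin n → Ex ι) : Comp ι (Fin n → Reg ι) :=
  Comp.forFin n fun i => (e i).eval

theorem does_evalVec {ι : Type} {n : ℕ} {e : Fin n → Ex ι} {x : Fin n → ℝ} {σ : Store ι} (t : ℕ)
    {t' : ℕ} (h : ∀ i, (e i).Has σ (x i)) (hs : ∀ i, (e i).size ≤ t) (ht : n * t ≤ t') :
    (evalVec e).Does σ t' fun r σ' => ∀ i, σ'.Holds (r i) (x i) :=
  .forFin t (fun i => stable_holds (x i)) ht fun i _ hσ =>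
    (Ex.does_eval ((h i).ext hσ)).mono (hs i) fun _ _ _ h => h

/-! ### Separable quadratic problems over a simplex -/

/-- The minimizer of `(1/2)(z - w)² + μ |z - y| + ν z` over `z ∈ [lo, hi]`. -/
def threshold (w y lo hi μ ν : ℝ) : ℝ := max lo (min hi (max (w - ν - μ) (min y (w - ν + μ))))

section threshold

variable {w y lo hi μ ν : ℝ}

theorem threshold_cases (h1 : lo ≤ y) (h2 : y ≤ hi) (h3 : 0 ≤ μ) :
    (ν ≤ w - μ - hi → threshold w y lo hi μ ν = hi) ∧
    (w - μ - hi ≤ ν → ν ≤ w - μ - y → threshold w y lo hi μ ν = w - ν - μ) ∧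
    (w - μ - y ≤ ν → ν ≤ w + μ - y → threshold w y lo hi μ ν = y) ∧
    (w + μ - y ≤ ν → ν ≤ w + μ - lo → threshold w y lo hi μ ν = w - ν + μ) ∧
    (w + μ - lo ≤ ν → threshold w y lo hi μ ν = lo) := by
  unfold threshold
  refine ⟨fun h => ?_, fun h h' => ?_, fun h h' => ?_, fun h h' => ?_, fun h => ?_⟩
  · rw [min_eq_left (a := y) (by linarith), max_eq_left (a := w - ν - μ) (by linarith),
      min_eq_left (a := hi) (by linarith), max_eq_right (b := hi) (by linarith)]
  · rw [min_eq_left (a := y) (by linarith), max_eq_left (a := w - ν - μ) (by linarith),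
      min_eq_right (a := hi) (by linarith), max_eq_right (a := lo) (by linarith)]
  · rw [min_eq_left (a := y) (by linarith), max_eq_right (a := w - ν - μ) (by linarith),
      min_eq_right (a := hi) (by linarith), max_eq_right (a := lo) (by linarith)]
  · rw [min_eq_right (a := y) (by linarith), max_eq_right (a := w - ν - μ) (by linarith),
      min_eq_right (a := hi) (by linarith), max_eq_right (a := lo) (by linarith)]
  · rw [min_eq_right (a := y) (by linarith), max_eq_right (a := w - ν - μ) (by linarith),
      min_eq_right (a := hi) (by linarith), max_eq_left (a := lo) (by linarith)]

theorem threshold_mem (h : lo ≤ hi) :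
    lo ≤ threshold w y lo hi μ ν ∧ threshold w y lo hi μ ν ≤ hi :=
  ⟨le_max_left _ _, max_le h (min_le_left _ _)⟩

/-- `threshold` is affine in `ν` between consecutive break points. -/
theorem threshold_affine (h1 : lo ≤ y) (h2 : y ≤ hi) (h3 : 0 ≤ μ) {b c t : ℝ} (hbc : b ≤ c)
    (hb : ∀ β ∈ ({w - μ - hi, w - μ - y, w + μ - y, w + μ - lo} : Set ℝ), β ≤ b ∨ c ≤ β)
    (ht0 : 0 ≤ t) (ht1 : t ≤ 1) :
    threshold w y lo hi μ (b + t * (c - b)) = threshold w y lo hi μ b +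
      t * (threshold w y lo hi μ c - threshold w y lo hi μ b) := by
  simp only [Set.mem_insert_iff, Set.mem_singleton_iff, forall_eq_or_imp, forall_eq] at hb
  obtain ⟨k1, k2, k3, k4⟩ := hb
  have m1 : b ≤ b + t * (c - b) := by nlinarith
  have m2 : b + t * (c - b) ≤ c := by nlinarith
  obtain ⟨cb1, cb2, cb3, cb4, cb5⟩ := threshold_cases (w := w) (ν := b) h1 h2 h3
  obtain ⟨cc1, cc2, cc3, cc4, cc5⟩ := threshold_cases (w := w) (ν := c) h1 h2 h3
  obtain ⟨cm1, cm2, cm3, cm4, cm5⟩ :=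
    threshold_cases (w := w) (ν := b + t * (c - b)) h1 h2 h3
  rcases k1 with k1 | k1
  · rcases k2 with k2 | k2
    · rcases k3 with k3 | k3
      · rcases k4 with k4 | k4
        · rw [cb5 (by linarith), cc5 (by linarith), cm5 (by linarith)]; ring
        · rw [cb4 (by linarith) (by linarith), cc4 (by linarith) (by linarith),
            cm4 (by linarith) (by linarith)]; ring
      · rw [cb3 (by linarith) (by linarith), cc3 (by linarith) (by linarith),
          cm3 (by linarith) (by linarith)]; ring
    · rw [cb2 (by linarith) (by linarith), cc2 (by linarith) (by linarith),
          cm2 (by linarith) (by linarith)]; ring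
  · rw [cb1 (by linarith), cc1 (by linarith), cm1 (by linarith)]; ring

/-- `threshold` minimizes the Lagrangian. -/
theorem threshold_le (h1 : lo ≤ y) (h2 : y ≤ hi) (h3 : 0 ≤ μ) {u : ℝ} (hu1 : lo ≤ u)
    (hu2 : u ≤ hi) :
    (1 / 2) * (threshold w y lo hi μ ν - w) ^ 2 + μ * |threshold w y lo hi μ ν - y| +
        ν * threshold w y lo hi μ ν ≤ (1 / 2) * (u - w) ^ 2 + μ * |u - y| + ν * u := by
  obtain ⟨c1, c2, c3, c4, c5⟩ := threshold_cases (w := w) (ν := ν) h1 h2 h3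
  have a1 : μ * (u - y) ≤ μ * |u - y| := mul_le_mul_of_nonneg_left (le_abs_self _) h3
  have a2 : μ * (y - u) ≤ μ * |u - y| :=
    mul_le_mul_of_nonneg_left (by rw [abs_sub_comm]; exact le_abs_self _) h3
  rcases le_total ν (w - μ - hi) with k1 | k1
  · rw [c1 k1, abs_of_nonneg (by linarith)]
    nlinarith [mul_nonneg (sub_nonneg.2 hu2) (sub_nonneg.2 k1), sq_nonneg (u - hi)]
  rcases le_total ν (w - μ - y) with k2 | k2
  · rw [c2 k1 k2, abs_of_nonneg (by linarith)]
    nlinarith [sq_nonneg (u - (w - ν - μ))]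
  rcases le_total ν (w + μ - y) with k3 | k3
  · rw [c3 k2 k3, sub_self, abs_zero]
    rcases le_total y u with k | k
    · rw [abs_of_nonneg (by linarith)] at *
      nlinarith [mul_nonneg (sub_nonneg.2 k) (sub_nonneg.2 k2), sq_nonneg (u - y)]
    · rw [abs_of_nonpos (by linarith)] at *
      nlinarith [mul_nonneg (sub_nonneg.2 k) (sub_nonneg.2 k3), sq_nonneg (u - y)]
  rcases le_total ν (w + μ - lo) with k4 | k4
  · rw [c4 k3 k4, abs_of_nonpos (by linarith)]
    nlinarith [sq_nonneg (u - (w - ν + μ))]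
  · rw [c5 k4, abs_of_nonpos (by linarith)]
    nlinarith [mul_nonneg (sub_nonneg.2 hu1) (sub_nonneg.2 k4), sq_nonneg (u - lo)]

end threshold

/-- `z` has total mass one and has the form that the optimality conditions prescribe, with
multiplier `ν` for the constraint `∑ z = 1`. -/
def IsRowSol {n : ℕ} (w y lo hi : Fin n → ℝ) (μ : ℝ) (z : Fin n → ℝ) : Prop :=
  (∃ ν, ∀ s, z s = threshold (w s) (y s) (lo s) (hi s) μ ν) ∧ ∑ s, z s = 1

theorem IsRowSol.le {n : ℕ} {w y lo hi : Fin n → ℝ} {μ : ℝ} {z : Fin n → ℝ}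
    (hz : IsRowSol w y lo hi μ z) (h1 : ∀ s, lo s ≤ y s) (h2 : ∀ s, y s ≤ hi s) (h3 : 0 ≤ μ)
    {u : Fin n → ℝ} (hu1 : ∀ s, lo s ≤ u s) (hu2 : ∀ s, u s ≤ hi s) (hu : ∑ s, u s = 1) :
    (1 / 2) * ∑ s, (z s - w s) ^ 2 + μ * ∑ s, |z s - y s| ≤
      (1 / 2) * ∑ s, (u s - w s) ^ 2 + μ * ∑ s, |u s - y s| := by
  obtain ⟨⟨ν, hν⟩, hs⟩ := hz
  have key := Finset.sum_le_sum fun s (_ : s ∈ Finset.univ) =>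
    threshold_le (w := w s) (ν := ν) (h1 s) (h2 s) h3 (hu1 s) (hu2 s)
  simp only [← hν, Finset.sum_add_distrib, ← Finset.mul_sum, hs, hu] at key
  linarith

theorem IsRowSol.mem {n : ℕ} {w y lo hi : Fin n → ℝ} {μ : ℝ} {z : Fin n → ℝ}
    (hz : IsRowSol w y lo hi μ z) (h1 : ∀ s, lo s ≤ y s) (h2 : ∀ s, y s ≤ hi s) (s : Fin n) :
    lo s ≤ z s ∧ z s ≤ hi s := by
  obtain ⟨⟨ν, hν⟩, -⟩ := hz
  rw [hν]
  exact threshold_mem ((h1 s).trans (h2 s))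

/-! ### Sorting and bisection of lists -/

namespace Comp

variable {ι α : Type}

/-- Split a list by bisection at a place where `test` changes from `false` to `true`. -/
def bisect (test : α → Comp ι Bool) : ℕ → List α → Comp ι (List α × List α)
  | 0, l => ret ([], l)
  | f + 1, l =>
    match l.drop (l.length / 2) with
    | [] => ret ([], [])
    | b :: r => (test b).bind fun c =>
        bif c then (bisect test f (l.take (l.length / 2))).bind fun p => ret (p.1, p.2 ++ b :: r)
        else (bisect test f r).bind fun p => ret (l.take (l.length / 2) ++ b :: p.1, p.2)

theorem does_bisect {test : α → Comp ι Bool} {T : α → Prop} {σ : Store ι} (t : ℕ) (f : ℕ)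
    {t' : ℕ} (l : List α) (hl : l.length < 2 ^ f) (ht : f * t ≤ t')
    (h : ∀ a ∈ l, ∀ σ', σ.Ext σ' → (test a).Does σ' t fun c _ => (c = true ↔ T a)) :
    (bisect test f l).Does σ t' fun p _ => p.1 ++ p.2 = l ∧
      (∀ p' b, p.1 = p' ++ [b] → ¬ T b) ∧ ∀ b q', p.2 = b :: q' → T b := by
  induction f generalizing l σ t' with
  | zero =>
    have : l = [] := List.length_eq_zero_iff.mp (by simpa using hl)
    subst this
    exact .ret (by simp)
  | succ f ih =>
    rw [bisect]
    have hlen : 2 ^ (f + 1) = 2 * 2 ^ f := by ring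
    have hsplit := List.take_append_drop (l.length / 2) l
    split
    · rename_i hd
      have : l = [] := by
        have := List.drop_eq_nil_iff.mp hd
        exact List.length_eq_zero_iff.mp (by omega)
      subst this
      exact .ret (by simp)
    · rename_i b r hd
      rw [hd] at hsplit
      have hlr : r.length + 1 = l.length - l.length / 2 := by
        rw [← List.length_drop, hd, List.length_cons]
      have hb : b ∈ l := by rw [← hsplit]; simp
      refine .bind (f * t) (h b hb σ (.refl σ))
        ((by ring : t + f * t = (f + 1) * t).trans_le ht) fun c σ₁ e₁ hc => ?_
      cases c with
      | true =>
        have hT : T b := hc.mp rfl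
        refine .bind 0 (ih _ (by rw [List.length_take]; omega) le_rfl fun a ha σ' hσ =>
          h a (List.mem_of_mem_take ha) σ' (e₁.trans hσ)) (by simp) fun p σ₂ e₂ hp => .ret ?_
        refine ⟨by rw [← List.append_assoc, hp.1, hsplit], hp.2.1, fun b' q' hq => ?_⟩
        match hp2 : p.2 with
        | [] => simp [hp2] at hq; rw [← hq.1]; exact hT
        | a :: q =>
          simp [hp2] at hq
          rw [← hq.1]
          exact hp.2.2 a q hp2
      | false =>
        have hT : ¬ T b := fun hT => by simpa using hc.mpr hT
        refine .bind 0 (ih r (by omega) le_rfl fun a ha σ' hσ =>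
          h a (by rw [← hsplit]; simp [ha]) σ' (e₁.trans hσ)) (by simp) fun p σ₂ e₂ hp => .ret ?_
        refine ⟨by rw [List.append_assoc, List.cons_append, hp.1, hsplit],
          fun p' b' hq => ?_, hp.2.2⟩
        rcases List.eq_nil_or_concat p.1 with hp1 | ⟨q, a, hp1⟩
        · simp only [hp1] at hq
          have := List.append_inj' hq rfl
          simp at this
          rw [← this.2]; exact hT
        · simp only [hp1, List.concat_eq_append, ← List.cons_append, ← List.append_assoc] at hq
          have := List.append_inj' hq rfl
          simp at this
          rw [← this.2]
          exact hp.2.1 q a (by simpa using hp1)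

/-- Sort registers by their contents (binary insertion). -/
def sort (f : ℕ) : List (Reg ι) → Comp ι (List (Reg ι))
  | [] => ret []
  | r :: l => (sort f l).bind fun l' =>
      (bisect (fun b => ifLE r b (ret true) (ret false)) f l').bind fun p => ret (p.1 ++ r :: p.2)

theorem does_sort {σ : Store ι} (f : ℕ) {t : ℕ} (l : List (Reg ι)) (hl : l.length ≤ 2 ^ f)
    (ht : l.length * f ≤ t) (hv : ∀ r ∈ l, σ.Valid r) :
    (sort f l).Does σ t fun l' _ => l'.Perm l ∧ l'.Pairwise fun a b => σ.val a ≤ σ.val b := by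
  induction l generalizing t with
  | nil => exact .ret (by simp)
  | cons r l ih =>
    rw [List.length_cons] at hl
    refine .bind f (ih (by omega) le_rfl fun r hr => hv r (by simp [hr]))
      ((Nat.succ_mul l.length f).symm.trans_le ht) fun l' σ₁ e₁ ⟨hp, hs⟩ => ?_
    have hval : ∀ b ∈ r :: l, ∀ σ', σ.Ext σ' → σ'.val b = σ.val b := fun b hb σ' hσ =>
      hσ.2 b (hv b hb)
    refine .bind 0 (does_bisect (T := fun b => σ.val r ≤ σ.val b) 1 f l'
      (by rw [hp.length_eq]; omega) le_rfl fun a ha σ' hσ => ?_) (by simp)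
      fun p σ₂ e₂ ⟨h1, h2, h3⟩ => .ret ⟨?_, ?_⟩
    · have hr := hval r (by simp) σ' (e₁.trans hσ)
      have ha := hval a (by simp [hp.mem_iff.mp ha]) σ' (e₁.trans hσ)
      rw [hr.symm, ha.symm]
      exact .ifLE (t := 0) le_rfl (fun h => .ret (by simpa using h))
        fun h => .ret (by simpa using h)
    · refine List.perm_middle.trans ?_
      rw [h1]
      exact hp.cons r
    · rw [← h1, List.pairwise_append] at hs
      obtain ⟨s1, s2, s3⟩ := hs
      have k2 : ∀ b ∈ p.2, σ.val r ≤ σ.val b := by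
        match hp2 : p.2 with
        | [] => simp
        | b :: q =>
          have hb := h3 b q hp2
          rw [hp2, List.pairwise_cons] at s2
          intro c hc
          rcases List.mem_cons.mp hc with rfl | hc
          · exact hb
          · exact hb.trans (s2.1 c hc)
      have k1 : ∀ b ∈ p.1, σ.val b ≤ σ.val r := by
        rcases List.eq_nil_or_concat p.1 with hp1 | ⟨q, a, hp1⟩
        · simp [hp1]
        · rw [List.concat_eq_append] at hp1
          have ha := h2 q a hp1
          rw [hp1, List.pairwise_append] at s1
          intro c hc
          rw [hp1, List.mem_append] at hc
          rcases hc with hc | hc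
          · exact (s1.2.2 c hc a (by simp)).trans (not_le.mp ha).le
          · rw [List.mem_singleton.mp hc]; exact (not_le.mp ha).le
      rw [List.pairwise_append, List.pairwise_cons]
      refine ⟨s1, ⟨k2, s2⟩, fun a ha b hb => ?_⟩
      rcases List.mem_cons.mp hb with rfl | hb
      · exact k1 a ha
      · exact s3 a ha b hb

end Comp

/-! ### Exact solution of the separable problem over a simplex -/

section RowSolver

variable {ι : Type}

/-- The expression for `threshold`. -/
def thresholdEx (w y lo hi μ ν : Reg ι) : Ex ι :=
  .max (.reg lo) (.min (.reg hi) (.max (.reg w - .reg ν - .reg μ)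
    (.min (.reg y) (.reg w - .reg ν + .reg μ))))

theorem has_thresholdEx {σ : Store ι} {w y lo hi μ ν : Reg ι} {w' y' lo' hi' μ' ν' : ℝ}
    (hw : σ.Holds w w') (hy : σ.Holds y y') (hlo : σ.Holds lo lo') (hhi : σ.Holds hi hi')
    (hμ : σ.Holds μ μ') (hν : σ.Holds ν ν') :
    (thresholdEx w y lo hi μ ν).Has σ (threshold w' y' lo' hi' μ' ν') :=
  .max (.reg hlo) (.min (.reg hhi) (.max (((Ex.Has.reg hw).sub (.reg hν)).sub (.reg hμ))
    (.min (.reg hy) (((Ex.Has.reg hw).sub (.reg hν)).add (.reg hμ)))))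

/-- A depth of sorting and bisection that suffices for the `4 n` break points. -/
def rowDepth (n : ℕ) : ℕ := Nat.log 2 (4 * n) + 1

/-- The solution of the optimality conditions `IsRowSol`: the break points of the piecewise affine
function `ν ↦ ∑ threshold` are sorted, the consecutive ones between which it takes the value `1`
are found by bisection, and the values there are interpolated. -/
def rowSolve {n : ℕ} (w y lo hi : Fin n → Reg ι) (μ : Reg ι) : Comp ι (Fin n → Reg ι) :=
  (evalVec fun s => .reg (w s) - .reg μ - .reg (hi s)).bind fun β₁ =>
  (evalVec fun s => .reg (w s) - .reg μ - .reg (y s)).bind fun β₂ =>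
  (evalVec fun s => .reg (w s) + .reg μ - .reg (y s)).bind fun β₃ =>
  (evalVec fun s => .reg (w s) + .reg μ - .reg (lo s)).bind fun β₄ =>
  (Comp.sort (rowDepth n)
    (List.ofFn β₁ ++ (List.ofFn β₂ ++ (List.ofFn β₃ ++ List.ofFn β₄)))).bind fun l =>
  (Ex.nat 1).eval.bind fun one =>
  (Comp.bisect (fun b => (Ex.sum fun s => thresholdEx (w s) (y s) (lo s) (hi s) μ b).eval.bind
    fun r => .ifLE r one (.ret true) (.ret false)) (rowDepth n) l).bind fun p =>
  let c := p.2.headD μ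
  let b := p.1.getLastD c
  (evalVec fun s => thresholdEx (w s) (y s) (lo s) (hi s) μ b).bind fun f₁ =>
  (evalVec fun s => thresholdEx (w s) (y s) (lo s) (hi s) μ c).bind fun f₂ =>
  (((Ex.sum fun s => .reg (f₁ s)) - .nat 1) /
    ((Ex.sum fun s => .reg (f₁ s)) - (Ex.sum fun s => .reg (f₂ s)))).eval.bind fun t =>
  evalVec fun s => .reg (f₁ s) + .reg t * (.reg (f₂ s) - .reg (f₁ s))

/-- A bound for the number of instructions of `rowSolve`. -/
def rowCost (n : ℕ) : ℕ := n * (15 * rowDepth n + 40)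

theorem isRowSol_of_adjacent {n : ℕ} {w y lo hi : Fin n → ℝ} {μ b c : ℝ}
    (h1 : ∀ s, lo s ≤ y s) (h2 : ∀ s, y s ≤ hi s) (h3 : 0 ≤ μ) (hbc : b ≤ c)
    (hsep : ∀ s, ∀ β ∈ ({w s - μ - hi s, w s - μ - y s, w s + μ - y s, w s + μ - lo s} : Set ℝ),
      β ≤ b ∨ c ≤ β)
    (hb : 1 ≤ ∑ s, threshold (w s) (y s) (lo s) (hi s) μ b)
    (hc : ∑ s, threshold (w s) (y s) (lo s) (hi s) μ c ≤ 1)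
    (heq : b = c ∨ 1 < ∑ s, threshold (w s) (y s) (lo s) (hi s) μ b) :
    IsRowSol w y lo hi μ fun s => threshold (w s) (y s) (lo s) (hi s) μ b +
      ((∑ s, threshold (w s) (y s) (lo s) (hi s) μ b - 1) /
        (∑ s, threshold (w s) (y s) (lo s) (hi s) μ b -
          ∑ s, threshold (w s) (y s) (lo s) (hi s) μ c)) *
      (threshold (w s) (y s) (lo s) (hi s) μ c - threshold (w s) (y s) (lo s) (hi s) μ b) := by
  rcases heq with rfl | hlt
  · refine ⟨⟨b, fun s => by ring⟩, ?_⟩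
    simp only [sub_self, mul_zero, add_zero]
    exact le_antisymm hc hb
  · set B := ∑ s, threshold (w s) (y s) (lo s) (hi s) μ b
    set C := ∑ s, threshold (w s) (y s) (lo s) (hi s) μ c
    have hpos : 0 < B - C := by linarith
    have ht0 : 0 ≤ (B - 1) / (B - C) := div_nonneg (by linarith) hpos.le
    have ht1 : (B - 1) / (B - C) ≤ 1 := (div_le_one hpos).2 (by linarith)
    refine ⟨⟨b + (B - 1) / (B - C) * (c - b), fun s =>
      (threshold_affine (h1 s) (h2 s) h3 hbc (hsep s) ht0 ht1).symm⟩, ?_⟩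
    rw [Finset.sum_add_distrib, ← Finset.mul_sum, Finset.sum_sub_distrib]
    change B + (B - 1) / (B - C) * (C - B) = 1
    field_simp
    ring

theorem does_rowSolve {n : ℕ} (hn : 0 < n) {w y lo hi : Fin n → Reg ι} {μ : Reg ι}
    {w' y' lo' hi' : Fin n → ℝ} {μ' : ℝ} {σ : Store ι}
    (hw : ∀ s, σ.Holds (w s) (w' s)) (hy : ∀ s, σ.Holds (y s) (y' s))
    (hlo : ∀ s, σ.Holds (lo s) (lo' s)) (hhi : ∀ s, σ.Holds (hi s) (hi' s))
    (hμ : σ.Holds μ μ') (h1 : ∀ s, lo' s ≤ y' s) (h2 : ∀ s, y' s ≤ hi' s) (h3 : 0 ≤ μ')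
    (hl1 : ∑ s, lo' s ≤ 1) (hh1 : 1 ≤ ∑ s, hi' s) :
    (rowSolve w y lo hi μ).Does σ (rowCost n) fun r σ' =>
      ∃ z, (∀ s, σ'.Holds (r s) (z s)) ∧ IsRowSol w' y' lo' hi' μ' z := by
  have hdepth : 4 * n < 2 ^ rowDepth n := Nat.lt_pow_succ_log_self (by norm_num) _
  set f := rowDepth n with hf
  have hcost : 2 * n + (2 * n + (2 * n + (2 * n + (4 * n * f + (1 + (f * (9 * n + 2) + (8 * n +
      (8 * n + (3 * n + 9 + 3 * n))))))))) ≤ rowCost n := by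
    have hf1 : 1 ≤ f := Nat.le_add_left _ _
    have : f ≤ n * f := Nat.le_mul_of_pos_left f hn
    rw [rowCost, ← hf]
    ring_nf
    ring_nf at this
    omega
  unfold rowSolve
  refine .bind _ (does_evalVec (t' := 2 * n) 2
    (fun s => ((Ex.Has.reg (hw s)).sub (.reg hμ)).sub (.reg (hhi s))) (fun s => by simp)
    (by omega)) hcost fun β₁ σ₁ e₁ b1 => ?_
  refine .bind _ (does_evalVec (t' := 2 * n) 2
    (fun s => (((Ex.Has.reg (hw s)).sub (.reg hμ)).sub (.reg (hy s))).ext e₁) (fun s => by simp)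
    (by omega)) le_rfl fun β₂ σ₂ e₂' b2 => ?_
  have e₂ := e₁.trans e₂'
  refine .bind _ (does_evalVec (t' := 2 * n) 2
    (fun s => (((Ex.Has.reg (hw s)).add (.reg hμ)).sub (.reg (hy s))).ext e₂) (fun s => by simp)
    (by omega)) le_rfl fun β₃ σ₃ e₃' b3 => ?_
  have e₃ := e₂.trans e₃'
  refine .bind _ (does_evalVec (t' := 2 * n) 2
    (fun s => (((Ex.Has.reg (hw s)).add (.reg hμ)).sub (.reg (hlo s))).ext e₃) (fun s => by simp)
    (by omega)) le_rfl fun β₄ σ₄ e₄' b4 => ?_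
  have e₄ := e₃.trans e₄'
  replace b1 := fun s => (b1 s).ext (e₂'.trans (e₃'.trans e₄'))
  replace b2 := fun s => (b2 s).ext (e₃'.trans e₄')
  replace b3 := fun s => (b3 s).ext e₄'
  set l₀ := List.ofFn β₁ ++ (List.ofFn β₂ ++ (List.ofFn β₃ ++ List.ofFn β₄)) with hl₀
  have hlen : l₀.length = 4 * n := by simp [hl₀]; ring
  have hmem : ∀ r ∈ l₀, ∃ s, ∃ β ∈ ({w' s - μ' - hi' s, w' s - μ' - y' s, w' s + μ' - y' s,
      w' s + μ' - lo' s} : Set ℝ), σ₄.Holds r β := by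
    intro r hr
    simp only [hl₀, List.mem_append, List.mem_ofFn] at hr
    rcases hr with ⟨s, rfl⟩ | ⟨s, rfl⟩ | ⟨s, rfl⟩ | ⟨s, rfl⟩
    · exact ⟨s, _, by simp, b1 s⟩
    · exact ⟨s, _, by simp, b2 s⟩
    · exact ⟨s, _, by simp, b3 s⟩
    · exact ⟨s, _, by simp, b4 s⟩
  have hmem' : ∀ s, ∀ β ∈ ({w' s - μ' - hi' s, w' s - μ' - y' s, w' s + μ' - y' s,
      w' s + μ' - lo' s} : Set ℝ), ∃ r ∈ l₀, σ₄.Holds r β := by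
    intro s β hβ
    simp only [Set.mem_insert_iff, Set.mem_singleton_iff] at hβ
    rcases hβ with rfl | rfl | rfl | rfl
    · exact ⟨_, by simp [hl₀], b1 s⟩
    · exact ⟨_, by simp [hl₀], b2 s⟩
    · exact ⟨_, by simp [hl₀], b3 s⟩
    · exact ⟨_, by simp [hl₀], b4 s⟩
  have hvalid : ∀ r ∈ l₀, σ₄.Valid r := fun r hr => by
    obtain ⟨s, β, -, h⟩ := hmem r hr
    exact h.1
  refine .bind _ (Comp.does_sort f l₀ (by omega) (t := 4 * n * f) (by rw [hlen]) hvalid) le_rfl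
    fun l σ₅ e₅ ⟨hperm, hsort⟩ => ?_
  refine Ex.does_eval_bind _ (Ex.Has.nat 1) le_rfl fun one σ₆ e₆ hone => ?_
  have e₄₆ := e₅.trans e₆
  set Φ : ℝ → ℝ := fun ν => ∑ s, threshold (w' s) (y' s) (lo' s) (hi' s) μ' ν with hΦ
  have hthr : ∀ {ν : Reg ι} {x : ℝ} {σ' : Store ι}, σ₄.Ext σ' → σ'.Holds ν x → ∀ s,
      (thresholdEx (w s) (y s) (lo s) (hi s) μ ν).Has σ'
        (threshold (w' s) (y' s) (lo' s) (hi' s) μ' x) := fun hσ hν s =>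
    have e := e₄.trans hσ
    has_thresholdEx ((hw s).ext e) ((hy s).ext e) ((hlo s).ext e) ((hhi s).ext e) (hμ.ext e) hν
  have hsize : ∀ (ν : Reg ι) (s : Fin n),
      (thresholdEx (w s) (y s) (lo s) (hi s) μ ν).size ≤ 8 := fun ν s => by simp [thresholdEx]
  refine .bind _ (Comp.does_bisect (T := fun b => Φ (σ₄.val b) ≤ 1) (9 * n + 2) f l
    (by rw [hperm.length_eq]; omega) le_rfl fun b hb σ' hσ => ?_) le_rfl fun p σ₇ e₇ hp => ?_
  · have hb' := Store.Holds.ext ⟨hvalid b (hperm.mem_iff.mp hb), rfl⟩ (e₄₆.trans hσ)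
    refine Ex.does_eval_bind 1 (Ex.Has.sum (hthr (e₄₆.trans hσ) hb')) ?_ fun r σ'' e hr => ?_
    · have := Ex.size_sum_le (hsize b)
      omega
    · have h1 := hone.ext (hσ.trans e)
      refine .ifLE (t := 0) le_rfl (fun h => .ret ?_) fun h => .ret ?_
      · rw [hr.2, h1.2] at h
        simpa using h
      · rw [hr.2, h1.2] at h
        simpa using h
  obtain ⟨hp1, hp2, hp3⟩ := hp
  have hsort' := hsort
  rw [← hp1] at hperm hsort
  have hin : ∀ r, r ∈ p.1 ++ p.2 ↔ r ∈ l₀ := fun r => hperm.mem_iff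
  have hΦhi : ∀ c, (∀ r ∈ l₀, c ≤ σ₄.val r) → Φ c = ∑ s, hi' s := fun c hc =>
    Finset.sum_congr rfl fun s _ => by
      obtain ⟨r, hr, hβ⟩ := hmem' s (w' s - μ' - hi' s) (by simp)
      exact (threshold_cases (h1 s) (h2 s) h3).1 (hβ.2 ▸ hc r hr)
  have hΦlo : ∀ b, (∀ r ∈ l₀, σ₄.val r ≤ b) → Φ b = ∑ s, lo' s := fun b hb =>
    Finset.sum_congr rfl fun s _ => by
      obtain ⟨r, hr, hβ⟩ := hmem' s (w' s + μ' - lo' s) (by simp)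
      exact (threshold_cases (h1 s) (h2 s) h3).2.2.2.2 (hβ.2 ▸ hb r hr)
  obtain ⟨b, c, hb, hc, hbv, hcv, hbc, hsep, hΦb, hΦc, heq⟩ : ∃ b c, p.1.getLastD (p.2.headD μ) = b ∧
      p.2.headD μ = c ∧ σ₄.Valid b ∧ σ₄.Valid c ∧ σ₄.val b ≤ σ₄.val c ∧
      (∀ r ∈ l₀, σ₄.val r ≤ σ₄.val b ∨ σ₄.val c ≤ σ₄.val r) ∧ 1 ≤ Φ (σ₄.val b) ∧
      Φ (σ₄.val c) ≤ 1 ∧ (σ₄.val b = σ₄.val c ∨ 1 < Φ (σ₄.val b)) := by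
    rw [List.pairwise_append] at hsort
    obtain ⟨s1, s2, s3⟩ := hsort
    have hlast : ∀ p' b, p.1 = p' ++ [b] → ∀ r ∈ p.1, σ₄.val r ≤ σ₄.val b := by
      intro p' b h r hr
      rw [h] at s1 hr
      rw [List.pairwise_append] at s1
      rcases List.mem_append.mp hr with hr | hr
      · exact s1.2.2 r hr b (by simp)
      · rw [List.mem_singleton.mp hr]
    match hq : p.2 with
    | [] =>
      rcases List.eq_nil_or_concat p.1 with hp' | ⟨p', b, hp'⟩
      · have := hperm.length_eq
        rw [hp', hq, hlen] at this
        simp at this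
        omega
      · rw [List.concat_eq_append] at hp'
        have h := hp2 p' b hp'
        rw [hΦlo _ fun r hr => hlast p' b hp' r (by
          have := (hin r).mpr hr
          simpa [hq] using this)] at h
        exact absurd hl1 h
    | c :: q =>
      rw [hq, List.pairwise_cons] at s2
      have hcl : c ∈ l₀ := (hin c).mp (by simp [hq])
      have hΦc := hp3 c q hq
      have hge : ∀ r ∈ p.2, σ₄.val c ≤ σ₄.val r := by
        intro r hr
        rw [hq] at hr
        rcases List.mem_cons.mp hr with rfl | hr
        · exact le_rfl
        · exact s2.1 r hr
      rcases List.eq_nil_or_concat p.1 with hp' | ⟨p', b, hp'⟩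
      · refine ⟨c, c, by simp [hp'], by simp, hvalid c hcl, hvalid c hcl, le_rfl,
          fun r _ => le_total _ _, ?_, hΦc, .inl rfl⟩
        rw [hΦhi _ fun r hr => hge r (by
          have := (hin r).mpr hr
          simpa [hp'] using this)]
        exact hh1
      · rw [List.concat_eq_append] at hp'
        have hb := hp2 p' b hp'
        refine ⟨b, c, by simp [hp'], by simp, hvalid b ((hin b).mp (by simp [hp'])), hvalid c hcl,
          s3 b (by simp [hp']) c (by simp [hq]), fun r hr => ?_, (not_le.mp hb).le, hΦc,
          .inr (not_le.mp hb)⟩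
        rcases List.mem_append.mp ((hin r).mpr hr) with h | h
        · exact .inl (hlast p' b hp' r h)
        · exact .inr (hge r h)
  rw [hc] at hb
  simp only [hc, hb]
  have e₄₇ := e₄₆.trans e₇
  refine .bind _ (does_evalVec (t' := 8 * n) 8 (hthr e₄₇ (Store.Holds.ext ⟨hbv, rfl⟩ e₄₇))
    (hsize b) (by omega)) le_rfl fun f₁ σ₈ e₈ hf₁ => ?_
  have e₄₈ := e₄₇.trans e₈
  refine .bind _ (does_evalVec (t' := 8 * n) 8 (hthr e₄₈ (Store.Holds.ext ⟨hcv, rfl⟩ e₄₈))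
    (hsize c) (by omega)) le_rfl fun f₂ σ₉ e₉ hf₂ => ?_
  replace hf₁ := fun s => (hf₁ s).ext e₉
  have hS₁ := Ex.Has.sum fun s => Ex.Has.reg (hf₁ s)
  have hS₂ := Ex.Has.sum fun s => Ex.Has.reg (hf₂ s)
  refine Ex.does_eval_bind (3 * n) ((hS₁.sub (.nat 1)).div (hS₁.sub hS₂)) ?_
    fun t σ₁₀ e₁₀ ht => ?_
  · have k1 := Ex.size_sum_le (t := 0) (f := fun s => Ex.reg (f₁ s)) (by simp)
    have k2 := Ex.size_sum_le (t := 0) (f := fun s => Ex.reg (f₂ s)) (by simp)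
    simp only [Ex.size_div, Ex.size_sub, Ex.size_nat]
    omega
  refine (does_evalVec 3 (fun s => ((Ex.Has.reg (hf₁ s)).ext e₁₀).add
    ((Ex.Has.reg ht).mul (((Ex.Has.reg (hf₂ s)).sub (.reg (hf₁ s))).ext e₁₀))) (fun s => by simp)
    (by omega)).mono le_rfl fun r σ' e' hr => ⟨_, hr, ?_⟩
  have := isRowSol_of_adjacent h1 h2 h3 hbc (fun s β hβ => ?_) hΦb hΦc heq
  · simpa using this
  · obtain ⟨r, hr, hβ⟩ := hmem' s β hβ
    exact hβ.2 ▸ hsep r hr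

end RowSolver

/-! ### The penalized problem for one kernel -/

/-- The penalty that belongs to a metric: `d₁`, `d₂²` and `d_∞`. -/
def Metric.penalty {A S : ℕ} (d : Metric) (y z : Fin A → Fin S → ℝ) : ℝ :=
  match d with
  | .l1 => ∑ a, ∑ s, |y a s - z a s|
  | .l2 => ∑ a, ∑ s, (y a s - z a s) ^ 2
  | .linf => ‖y - z‖

/-- The squared Euclidean distance of two kernels. -/
def sqDist {A S : ℕ} (z w : Fin A → Fin S → ℝ) : ℝ := ∑ a, ∑ s, (z a s - w a s) ^ 2

/-- `z` minimizes `(1/2) ‖z - w‖² + ρ * penalty` over the kernels, up to `η`, where `g` is an upper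
estimate of the penalty of `z` that counts in place of the penalty. -/
structure IsPenalized {A S : ℕ} (d : Metric) (w y : Fin A → Fin S → ℝ) (ρ η : ℝ)
    (z : Fin A → Fin S → ℝ) (g : ℝ) : Prop where
  mem : z ∈ U A S
  penalty_le : d.penalty z y ≤ g
  le_card : g ≤ A * S
  le : ∀ u ∈ U A S, (1 / 2) * sqDist z w + ρ * g ≤ (1 / 2) * sqDist u w + ρ * d.penalty u y + η

section simplex

variable {A S : ℕ} {y z : Fin A → Fin S → ℝ}

theorem U.nonneg (h : y ∈ U A S) (a : Fin A) (s : Fin S) : 0 ≤ y a s := (h a).1 s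

theorem U.le_one (h : y ∈ U A S) (a : Fin A) (s : Fin S) : y a s ≤ 1 := by
  rw [← (h a).2]
  exact Finset.single_le_sum (fun i _ => (h a).1 i) (Finset.mem_univ s)

theorem U.sum_eq (h : y ∈ U A S) (a : Fin A) : ∑ s, y a s = 1 := (h a).2

theorem U.abs_sub_le (hy : y ∈ U A S) (hz : z ∈ U A S) (a : Fin A) (s : Fin S) :
    |y a s - z a s| ≤ 1 := by
  rw [abs_le]
  constructor <;> linarith [U.nonneg hy a s, U.nonneg hz a s, U.le_one hy a s, U.le_one hz a s]

theorem U.convex : Convex ℝ (U A S) := by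
  intro x hx y hy a b ha hb hab i
  exact convex_stdSimplex ℝ (Fin S) (hx i) (hy i) ha hb hab

theorem sum_sum_le_card {f : Fin A → Fin S → ℝ} (h : ∀ a s, f a s ≤ 1) :
    ∑ a, ∑ s, f a s ≤ A * S := by
  calc ∑ a, ∑ s, f a s ≤ ∑ _a : Fin A, ∑ _s : Fin S, (1 : ℝ) :=
        Finset.sum_le_sum fun a _ => Finset.sum_le_sum fun s _ => h a s
    _ = A * S := by simp

theorem norm_kernel_le_iff {r : ℝ} (hr : 0 ≤ r) :
    ‖y - z‖ ≤ r ↔ ∀ a s, |y a s - z a s| ≤ r := by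
  rw [pi_norm_le_iff_of_nonneg hr]
  refine forall_congr' fun a => ?_
  rw [pi_norm_le_iff_of_nonneg hr]
  simp

end simplex

theorem rows_le {A S : ℕ} {w y lo hi z : Fin A → Fin S → ℝ} {μ : ℝ}
    (hz : ∀ a, IsRowSol (w a) (y a) (lo a) (hi a) μ (z a)) (h1 : ∀ a s, lo a s ≤ y a s)
    (h2 : ∀ a s, y a s ≤ hi a s) (h3 : 0 ≤ μ) {u : Fin A → Fin S → ℝ}
    (hu1 : ∀ a s, lo a s ≤ u a s) (hu2 : ∀ a s, u a s ≤ hi a s) (hu : ∀ a, ∑ s, u a s = 1) :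
    (1 / 2) * sqDist z w + μ * ∑ a, ∑ s, |z a s - y a s| ≤
      (1 / 2) * sqDist u w + μ * ∑ a, ∑ s, |u a s - y a s| := by
  have key := Finset.sum_le_sum fun a (_ : a ∈ Finset.univ) =>
    (hz a).le (h1 a) (h2 a) h3 (hu1 a) (hu2 a) (hu a)
  simp only [Finset.sum_add_distrib, ← Finset.mul_sum] at key
  exact key

theorem rows_mem {A S : ℕ} {w y lo hi z : Fin A → Fin S → ℝ} {μ : ℝ}
    (hz : ∀ a, IsRowSol (w a) (y a) (lo a) (hi a) μ (z a)) (h1 : ∀ a s, lo a s ≤ y a s)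
    (h2 : ∀ a s, y a s ≤ hi a s) (h0 : ∀ a s, 0 ≤ lo a s) : z ∈ U A S := fun a =>
  ⟨fun s => (h0 a s).trans ((hz a).mem (h1 a) (h2 a) s).1, (hz a).2⟩

theorem sqDist_convex {A S : ℕ} (w z z' : Fin A → Fin S → ℝ) {t : ℝ} (h0 : 0 ≤ t) (h1 : t ≤ 1) :
    sqDist (fun a s => z a s + t * (z' a s - z a s)) w ≤
      (1 - t) * sqDist z w + t * sqDist z' w := by
  simp only [sqDist, Finset.mul_sum, ← Finset.sum_add_distrib]
  refine Finset.sum_le_sum fun a _ => Finset.sum_le_sum fun s _ => ?_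
  nlinarith [mul_nonneg (mul_nonneg h0 (sub_nonneg.2 h1)) (sq_nonneg (z a s - z' a s))]

/-- The kernels whose entries differ from those of `y` by at most `r`. -/
def box {A S : ℕ} (y : Fin A → Fin S → ℝ) (r : ℝ) : Set (Fin A → Fin S → ℝ) :=
  {z | z ∈ U A S ∧ ∀ a s, |z a s - y a s| ≤ r}

theorem box_convex {A S : ℕ} {y z z' : Fin A → Fin S → ℝ} {r r' t : ℝ} (hz : z ∈ box y r)
    (hz' : z' ∈ box y r') (h0 : 0 ≤ t) (h1 : t ≤ 1) :
    (fun a s => z a s + t * (z' a s - z a s)) ∈ box y (r + t * (r' - r)) := by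
  constructor
  · have := U.convex hz.1 hz'.1 (sub_nonneg.2 h1) h0 (by ring)
    convert this using 1
    ext a s
    simp only [Pi.add_apply, Pi.smul_apply, smul_eq_mul]
    ring
  · intro a s
    have k1 := abs_le.mp (hz.2 a s)
    have k2 := abs_le.mp (hz'.2 a s)
    rw [abs_le]
    constructor <;> nlinarith

/-- `v` is the minimum of `(1/2) ‖z - w‖² + ρ r` over the box of radius `r`. -/
def IsBoxMin {A S : ℕ} (w y : Fin A → Fin S → ℝ) (ρ r : ℝ) (z : Fin A → Fin S → ℝ) (v : ℝ) : Prop :=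
  z ∈ box y r ∧ v = (1 / 2) * sqDist z w + ρ * r ∧
    ∀ u ∈ box y r, v ≤ (1 / 2) * sqDist u w + ρ * r

/-- Radii outside `[a, b]` are not needed for the minimization over the radius. -/
def Brackets {A S : ℕ} (w y : Fin A → Fin S → ℝ) (ρ a b : ℝ) : Prop :=
  0 ≤ a ∧ a ≤ b ∧ b ≤ 1 ∧ ∀ r, 0 ≤ r → r ≤ 1 → ∀ u ∈ box y r, ∃ r', a ≤ r' ∧ r' ≤ b ∧
    ∃ u' ∈ box y r', (1 / 2) * sqDist u' w + ρ * r' ≤ (1 / 2) * sqDist u w + ρ * r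

/-- A radius beyond a point where the minimal value is no smaller than at an earlier point is
dominated, since the minimal value is a convex function of the radius. -/
theorem IsBoxMin.le_of_between {A S : ℕ} {w y : Fin A → Fin S → ℝ} {ρ r₁ r₂ r v₁ v₂ t : ℝ}
    {z₁ z₂ u : Fin A → Fin S → ℝ} (h₁ : IsBoxMin w y ρ r₁ z₁ v₁) (h₂ : IsBoxMin w y ρ r₂ z₂ v₂)
    (h : v₁ ≤ v₂) (ht0 : 0 < t) (ht1 : t ≤ 1) (hr : r₂ = r₁ + t * (r - r₁)) (hu : u ∈ box y r) :
    v₁ ≤ (1 / 2) * sqDist u w + ρ * r := by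
  have k := h₂.2.2 _ (hr ▸ box_convex h₁.1 hu ht0.le ht1)
  have k' := sqDist_convex w z₁ u ht0.le ht1
  have hv := h₁.2.1
  have : t * v₁ ≤ t * ((1 / 2) * sqDist u w + ρ * r) := by
    have e : ρ * r₂ = (1 - t) * (ρ * r₁) + t * (ρ * r) := by rw [hr]; ring
    nlinarith
  exact le_of_mul_le_mul_left this ht0

theorem Brackets.step {A S : ℕ} {w y : Fin A → Fin S → ℝ} {ρ a b v₁ v₂ : ℝ}
    {z₁ z₂ : Fin A → Fin S → ℝ} (hab : Brackets w y ρ a b)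
    (h₁ : IsBoxMin w y ρ ((a + a + b) / 3) z₁ v₁) (h₂ : IsBoxMin w y ρ ((a + b + b) / 3) z₂ v₂) :
    (v₁ ≤ v₂ → Brackets w y ρ a ((a + b + b) / 3)) ∧
      (v₂ ≤ v₁ → Brackets w y ρ ((a + a + b) / 3) b) := by
  obtain ⟨ha, hle, hb, hall⟩ := hab
  refine ⟨fun h => ⟨ha, by linarith, by linarith, fun r hr0 hr1 u hu => ?_⟩,
    fun h => ⟨by linarith, by linarith, hb, fun r hr0 hr1 u hu => ?_⟩⟩
  · obtain ⟨r', k1, k2, u', hu', k3⟩ := hall r hr0 hr1 u hu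
    by_cases hr : r' ≤ (a + b + b) / 3
    · exact ⟨r', k1, hr, u', hu', k3⟩
    · push Not at hr
      refine ⟨(a + a + b) / 3, by linarith, by linarith, z₁, h₁.1, ?_⟩
      rw [← h₁.2.1]
      refine le_trans ?_ k3
      have hpos : 0 < r' - (a + a + b) / 3 := by linarith
      rcases eq_or_lt_of_le hle with rfl | hlt
      · linarith
      · exact h₁.le_of_between h₂ h
          (t := ((a + b + b) / 3 - (a + a + b) / 3) / (r' - (a + a + b) / 3))
          (div_pos (by linarith) hpos) ((div_le_one hpos).2 (by linarith))
          (by rw [div_mul_cancel₀ _ hpos.ne']; ring) hu'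
  · obtain ⟨r', k1, k2, u', hu', k3⟩ := hall r hr0 hr1 u hu
    by_cases hr : (a + a + b) / 3 ≤ r'
    · exact ⟨r', hr, k2, u', hu', k3⟩
    · push Not at hr
      refine ⟨(a + b + b) / 3, by linarith, by linarith, z₂, h₂.1, ?_⟩
      rw [← h₂.2.1]
      refine le_trans ?_ k3
      have hpos : r' - (a + b + b) / 3 < 0 := by linarith
      rcases eq_or_lt_of_le hle with rfl | hlt
      · linarith
      · refine h₂.le_of_between h₁ h
          (t := ((a + a + b) / 3 - (a + b + b) / 3) / (r' - (a + b + b) / 3))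
          (div_pos_of_neg_of_neg (by linarith) hpos) ?_ ?_ hu'
        · rw [div_le_one_of_neg hpos]; linarith
        · rw [div_mul_cancel₀ _ hpos.ne]; ring

theorem Brackets.isPenalized {A S : ℕ} {w y : Fin A → Fin S → ℝ} {ρ η a b v : ℝ}
    {z : Fin A → Fin S → ℝ} (hA : 0 < A) (hS : 0 < S) (hy : y ∈ U A S) (hρ : 0 ≤ ρ)
    (hab : Brackets w y ρ a b) (h : IsBoxMin w y ρ b z v) (hη : ρ * (b - a) ≤ η) :
    IsPenalized .linf w y ρ η z b := by
  obtain ⟨ha, hle, hb, hall⟩ := hab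
  refine ⟨h.1.1, (norm_kernel_le_iff (ha.trans hle)).2 h.1.2, hb.trans ?_, fun u hu => ?_⟩
  · have : 1 ≤ A * S := Nat.mul_pos hA hS
    exact_mod_cast this
  · have hn : ‖u - y‖ ≤ 1 := (norm_kernel_le_iff zero_le_one).2 (U.abs_sub_le hu hy)
    obtain ⟨r', k1, k2, u', hu', k3⟩ := hall ‖u - y‖ (norm_nonneg _) hn u
      ⟨hu, (norm_kernel_le_iff (norm_nonneg _)).1 le_rfl⟩
    have k4 := h.2.2 u' ⟨hu'.1, fun a s => (hu'.2 a s).trans k2⟩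
    rw [h.2.1] at k4
    simp only [Metric.penalty]
    nlinarith

section programs

variable {ι : Type} {A S : ℕ}

/-- Solve the separable problems of all rows. -/
def solveRows (w y lo hi : Fin A → Fin S → Reg ι) (μ : Reg ι) :
    Comp ι (Fin A → Fin S → Reg ι) :=
  Comp.forFin A fun a => rowSolve (w a) (y a) (lo a) (hi a) μ

/-- Evaluate a matrix of expressions. -/
def evalMat (e : Fin A → Fin S → Ex ι) : Comp ι (Fin A → Fin S → Reg ι) :=
  Comp.forFin A fun a => evalVec (e a)

theorem does_evalMat {e : Fin A → Fin S → Ex ι} {x : Fin A → Fin S → ℝ} {σ : Store ι} (t : ℕ)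
    {t' : ℕ} (h : ∀ a s, (e a s).Has σ (x a s)) (hs : ∀ a s, (e a s).size ≤ t)
    (ht : A * (S * t) ≤ t') :
    (evalMat e).Does σ t' fun r σ' => ∀ a s, σ'.Holds (r a s) (x a s) :=
  .forFin (S * t) (fun _ _ _ _ hs h s => (h s).ext hs) ht fun a _ hσ =>
    does_evalVec t (fun s => (h a s).ext hσ) (hs a) le_rfl

theorem does_solveRows (hS : 0 < S) {w y lo hi : Fin A → Fin S → Reg ι} {μ : Reg ι}
    {w' y' lo' hi' : Fin A → Fin S → ℝ} {μ' : ℝ} {σ : Store ι} {t : ℕ}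
    (hw : ∀ a s, σ.Holds (w a s) (w' a s)) (hy : ∀ a s, σ.Holds (y a s) (y' a s))
    (hlo : ∀ a s, σ.Holds (lo a s) (lo' a s)) (hhi : ∀ a s, σ.Holds (hi a s) (hi' a s))
    (hμ : σ.Holds μ μ') (h1 : ∀ a s, lo' a s ≤ y' a s) (h2 : ∀ a s, y' a s ≤ hi' a s)
    (h3 : 0 ≤ μ') (hu : y' ∈ U A S) (ht : A * rowCost S ≤ t) :
    (solveRows w y lo hi μ).Does σ t fun r σ' => ∃ z : Fin A → Fin S → ℝ,
      (∀ a s, σ'.Holds (r a s) (z a s)) ∧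
      ∀ a, IsRowSol (w' a) (y' a) (lo' a) (hi' a) μ' (z a) := by
  refine (Comp.Does.forFin (rowCost S) (Q := fun a r σ' => ∃ z : Fin S → ℝ,
    (∀ s, σ'.Holds (r s) (z s)) ∧ IsRowSol (w' a) (y' a) (lo' a) (hi' a) μ' z)
    (fun a r σ₁ σ₂ e ⟨z, h1, h2⟩ => ⟨z, fun s => (h1 s).ext e, h2⟩) ht
    fun a σ' e => ?_).mono le_rfl fun r σ' e h => ?_
  · refine does_rowSolve hS (fun s => (hw a s).ext e) (fun s => (hy a s).ext e)
      (fun s => (hlo a s).ext e) (fun s => (hhi a s).ext e) (hμ.ext e) (h1 a) (h2 a) h3 ?_ ?_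
    · exact (Finset.sum_le_sum fun s _ => h1 a s).trans_eq (U.sum_eq hu a)
    · exact (U.sum_eq hu a).symm.trans_le (Finset.sum_le_sum fun s _ => h2 a s)
  · choose z hz using h
    exact ⟨z, fun a => (hz a).1, fun a => (hz a).2⟩

/-- Sum of a matrix of expressions. -/
def Ex.sum₂ (e : Fin A → Fin S → Ex ι) : Ex ι := .sum fun a => .sum (e a)

theorem Ex.Has.sum₂ {e : Fin A → Fin S → Ex ι} {x : Fin A → Fin S → ℝ} {σ : Store ι}
    (h : ∀ a s, (e a s).Has σ (x a s)) : (Ex.sum₂ e).Has σ (∑ a, ∑ s, x a s) :=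
  .sum fun a => .sum (h a)

theorem Ex.size_sum₂_le {e : Fin A → Fin S → Ex ι} {t : ℕ} (hA : 0 < A) (hS : 0 < S)
    (h : ∀ a s, (e a s).size ≤ t) : (Ex.sum₂ e).size ≤ A * (S * (t + 4)) := by
  refine (Ex.size_sum_le fun a => Ex.size_sum_le (h a)).trans ?_
  have h1 : A ≤ A * S := Nat.le_mul_of_pos_right A hS
  have h2 : 1 ≤ A * S := Nat.mul_pos hA hS
  ring_nf
  ring_nf at h1 h2
  omega

/-- Solution of the problem for a box of given radius, and its value. -/
def boxEval (w y : Fin A → Fin S → Reg ι) (zero one ρ r : Reg ι) :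
    Comp ι ((Fin A → Fin S → Reg ι) × Reg ι) :=
  (evalMat fun a s => .max (.reg zero) (.reg (y a s) - .reg r)).bind fun lo =>
  (evalMat fun a s => .min (.reg one) (.reg (y a s) + .reg r)).bind fun hi =>
  (solveRows w y lo hi zero).bind fun z =>
  ((.nat 1 / .nat 2) * (Ex.sum₂ fun a s => (.reg (z a s) - .reg (w a s)) *
    (.reg (z a s) - .reg (w a s))) + .reg ρ * .reg r : Ex ι).eval.bind fun v => .ret (z, v)

theorem does_boxEval (hA : 0 < A) (hS : 0 < S) {w y : Fin A → Fin S → Reg ι}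
    {zero one ρ r : Reg ι} {w' y' : Fin A → Fin S → ℝ} {ρ' r' : ℝ} {σ : Store ι}
    (hw : ∀ a s, σ.Holds (w a s) (w' a s)) (hy : ∀ a s, σ.Holds (y a s) (y' a s))
    (h0 : σ.Holds zero 0) (h1 : σ.Holds one 1) (hρ : σ.Holds ρ ρ') (hr : σ.Holds r r')
    (hr0 : 0 ≤ r') (hu : y' ∈ U A S) :
    (boxEval w y zero one ρ r).Does σ (A * rowCost S + 20 * (A * S)) fun p σ' => ∃ z v,
      (∀ a s, σ'.Holds (p.1 a s) (z a s)) ∧ σ'.Holds p.2 v ∧ IsBoxMin w' y' ρ' r' z v := by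
  have hAS : 1 ≤ A * S := Nat.mul_pos hA hS
  refine .bind (A * rowCost S + 18 * (A * S)) (does_evalMat (t' := 2 * (A * S)) 2 (fun a s => (Ex.Has.reg h0).max
    ((Ex.Has.reg (hy a s)).sub (.reg hr))) (fun a s => by simp) (le_of_eq (by ring))) (le_of_eq (by ring))
    fun lo σ₁ e₁ hlo => ?_
  refine .bind (A * rowCost S + 16 * (A * S)) (does_evalMat (t' := 2 * (A * S)) 2 (fun a s => ((Ex.Has.reg h1).min
    ((Ex.Has.reg (hy a s)).add (.reg hr))).ext e₁) (fun a s => by simp) (le_of_eq (by ring)))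
    (le_of_eq (by ring)) fun hi σ₂ e₂' hhi => ?_
  have e₂ := e₁.trans e₂'
  have ho1 : ∀ a s, max 0 (y' a s - r') ≤ y' a s := fun a s =>
    max_le (U.nonneg hu a s) (by linarith)
  have ho2 : ∀ a s, y' a s ≤ min 1 (y' a s + r') := fun a s =>
    le_min (U.le_one hu a s) (by linarith)
  refine .bind (16 * (A * S)) (does_solveRows hS (fun a s => (hw a s).ext e₂)
    (fun a s => (hy a s).ext e₂) (fun a s => (hlo a s).ext e₂') hhi (h0.ext e₂) ho1 ho2 le_rfl hu
    le_rfl) le_rfl fun zr σ₃ e₃' ⟨z, hz, hrow⟩ => ?_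
  have e₃ := e₂.trans e₃'
  have hd := fun a s => (Ex.Has.reg (hz a s)).sub ((Ex.Has.reg (hw a s)).ext e₃)
  refine Ex.does_eval_bind 0 ((((Ex.Has.nat 1).div (.nat 2)).mul (.sum₂ fun a s =>
    (hd a s).mul (hd a s))).add (((Ex.Has.reg hρ).mul (.reg hr)).ext e₃)) ?_
    fun v σ₄ e₄ hv => .ret ⟨z, _, fun a s => (hz a s).ext e₄, hv, ?_, ?_, ?_⟩
  · have := Ex.size_sum₂_le (t := 3) (e := fun a s => (.reg (zr a s) - .reg (w a s)) *
      (.reg (zr a s) - .reg (w a s))) hA hS (fun a s => by simp)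
    simp only [Ex.size_add, Ex.size_mul, Ex.size_div, Ex.size_nat, Ex.size_reg] at this ⊢
    ring_nf at this hAS ⊢
    omega
  · refine ⟨rows_mem hrow ho1 ho2 fun a s => le_max_left _ _, fun a s => ?_⟩
    have := (hrow a).mem (ho1 a) (ho2 a) s
    rw [abs_le]
    constructor
    · linarith [le_max_right 0 (y' a s - r')]
    · linarith [min_le_right 1 (y' a s + r')]
  · simp only [sqDist, sq, Nat.cast_one, Nat.cast_ofNat]
  · intro u hub
    have := rows_le hrow ho1 ho2 le_rfl (u := u)
      (fun a s => max_le (U.nonneg hub.1 a s) (by linarith [(abs_le.mp (hub.2 a s)).1]))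
      (fun a s => le_min (U.le_one hub.1 a s) (by linarith [(abs_le.mp (hub.2 a s)).2]))
      (U.sum_eq hub.1)
    simp only [sqDist, sq, Nat.cast_one, Nat.cast_ofNat] at this ⊢
    linarith

/-- One step of ternary search for the radius. -/
def ternaryStep (w y : Fin A → Fin S → Reg ι) (zero one ρ : Reg ι) (q : Reg ι × Reg ι) :
    Comp ι (Reg ι × Reg ι) :=
  ((.reg q.1 + .reg q.1 + .reg q.2) / .nat 3 : Ex ι).eval.bind fun m₁ =>
  ((.reg q.1 + .reg q.2 + .reg q.2) / .nat 3 : Ex ι).eval.bind fun m₂ =>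
  (boxEval w y zero one ρ m₁).bind fun p₁ =>
  (boxEval w y zero one ρ m₂).bind fun p₂ =>
  .ifLE p₁.2 p₂.2 (.ret (q.1, m₂)) (.ret (m₁, q.2))

/-- Approximate solution of the penalized problem. -/
def penalized (d : Metric) (j : ℕ) (w y : Fin A → Fin S → Reg ι) (ρ : Reg ι) :
    Comp ι ((Fin A → Fin S → Reg ι) × Reg ι) :=
  (Ex.nat 0).eval.bind fun zero =>
  (Ex.nat 1).eval.bind fun one =>
  match d with
  | .l1 =>
    (solveRows w y (fun _ _ => zero) (fun _ _ => one) ρ).bind fun z =>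
    (Ex.sum₂ fun a s => .max (.reg (z a s) - .reg (y a s)) (.reg (y a s) - .reg (z a s))).eval.bind
      fun g => .ret (z, g)
  | .l2 =>
    (evalMat fun a s => (.reg (w a s) + .nat 2 * .reg ρ * .reg (y a s)) /
      (.nat 1 + .nat 2 * .reg ρ)).bind fun w' =>
    (solveRows w' y (fun _ _ => zero) (fun _ _ => one) zero).bind fun z =>
    (Ex.sum₂ fun a s => (.reg (z a s) - .reg (y a s)) * (.reg (z a s) - .reg (y a s))).eval.bind
      fun g => .ret (z, g)
  | .linf =>
    (Comp.iter (fun _ => ternaryStep w y zero one ρ) (4 * j) (zero, one)).bind fun q =>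
    (boxEval w y zero one ρ q.2).bind fun p => .ret (p.1, q.2)

/-- The number of separable problems that are solved for one kernel and one penalty. -/
def Metric.innerSteps (d : Metric) (j : ℕ) : ℕ :=
  match d with
  | .l1 => 1
  | .l2 => 1
  | .linf => 8 * j + 1

/-- A bound for the number of instructions of `boxEval`, with some room. -/
def kernelCost (A S : ℕ) : ℕ := A * rowCost S + 30 * (A * S)

theorem does_ternaryStep (hA : 0 < A) (hS : 0 < S) {w y : Fin A → Fin S → Reg ι}
    {zero one ρ : Reg ι} {q : Reg ι × Reg ι} {w' y' : Fin A → Fin S → ℝ} {ρ' a b : ℝ} {σ : Store ι}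
    (hw : ∀ a s, σ.Holds (w a s) (w' a s)) (hy : ∀ a s, σ.Holds (y a s) (y' a s))
    (h0 : σ.Holds zero 0) (h1 : σ.Holds one 1) (hρ : σ.Holds ρ ρ') (ha : σ.Holds q.1 a)
    (hb : σ.Holds q.2 b) (hu : y' ∈ U A S) (hab : Brackets w' y' ρ' a b) :
    (ternaryStep w y zero one ρ q).Does σ (2 * kernelCost A S) fun q' σ' => ∃ a' b',
      σ'.Holds q'.1 a' ∧ σ'.Holds q'.2 b' ∧ b' - a' = 2 / 3 * (b - a) ∧
        Brackets w' y' ρ' a' b' := by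
  have hAS : 1 ≤ A * S := Nat.mul_pos hA hS
  set B := A * rowCost S + 20 * (A * S) with hB
  have hcost : 4 + (4 + (B + (B + 1))) ≤ 2 * kernelCost A S := by rw [kernelCost]; omega
  obtain ⟨k1, k2, k3, -⟩ := id hab
  have ea := Ex.Has.reg ha
  have eb := Ex.Has.reg hb
  refine Ex.does_eval_bind _ (((ea.add ea).add eb).div (.nat 3)) hcost fun m₁ σ₁ e₁ hm₁ => ?_
  refine Ex.does_eval_bind _ ((((ea.add eb).add eb).div (.nat 3)).ext e₁) le_rfl
    fun m₂ σ₂ e₂' hm₂ => ?_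
  have e₂ := e₁.trans e₂'
  replace hm₁ := hm₁.ext e₂'
  refine .bind _ (does_boxEval hA hS (fun a s => (hw a s).ext e₂) (fun a s => (hy a s).ext e₂)
    (h0.ext e₂) (h1.ext e₂) (hρ.ext e₂) hm₁ (by push_cast; linarith) hu) le_rfl
    fun p₁ σ₃ e₃' ⟨z₁, v₁, _, hv₁, hmin₁⟩ => ?_
  have e₃ := e₂.trans e₃'
  refine .bind _ (does_boxEval hA hS (fun a s => (hw a s).ext e₃) (fun a s => (hy a s).ext e₃)
    (h0.ext e₃) (h1.ext e₃) (hρ.ext e₃) (hm₂.ext e₃') (by push_cast; linarith) hu) le_rfl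
    fun p₂ σ₄ e₄' ⟨z₂, v₂, _, hv₂, hmin₂⟩ => ?_
  have e₄ := e₃.trans e₄'
  replace hv₁ := hv₁.ext e₄'
  push_cast at hmin₁ hmin₂ hm₁ hm₂
  have hstep := hab.step hmin₁ hmin₂
  refine .ifLE (t := 0) le_rfl (fun h => .ret ?_) fun h => .ret ?_
  · rw [hv₁.2, hv₂.2] at h
    exact ⟨_, _, ha.ext e₄, hm₂.ext (e₃'.trans e₄'), by ring, hstep.1 h⟩
  · rw [hv₁.2, hv₂.2] at h
    exact ⟨_, _, hm₁.ext (e₃'.trans e₄'), hb.ext e₄, by ring, hstep.2 h.le⟩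

theorem sqDist_penalty_eq {w y z : Fin A → Fin S → ℝ} {ρ : ℝ} (hρ : 0 ≤ ρ) :
    (1 / 2) * sqDist z w + ρ * sqDist z y =
      (1 + 2 * ρ) * ((1 / 2) * sqDist z fun a s => (w a s + 2 * ρ * y a s) / (1 + 2 * ρ)) +
      ∑ a, ∑ s, ((1 / 2) * w a s ^ 2 + ρ * y a s ^ 2 -
        (1 / 2) * (w a s + 2 * ρ * y a s) ^ 2 / (1 + 2 * ρ)) := by
  simp only [sqDist, Finset.mul_sum, ← Finset.sum_add_distrib]
  refine Finset.sum_congr rfl fun a _ => Finset.sum_congr rfl fun s _ => ?_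
  have : 1 + 2 * ρ ≠ 0 := by positivity
  field_simp
  ring

theorem does_penalized (d : Metric) (j : ℕ) (hA : 0 < A) (hS : 0 < S)
    {w y : Fin A → Fin S → Reg ι} {ρ : Reg ι} {w' y' : Fin A → Fin S → ℝ} {ρ' : ℝ} {σ : Store ι}
    (hw : ∀ a s, σ.Holds (w a s) (w' a s)) (hy : ∀ a s, σ.Holds (y a s) (y' a s))
    (hρ : σ.Holds ρ ρ') (hu : y' ∈ U A S) (hρ0 : 0 ≤ ρ') :
    (penalized d j w y ρ).Does σ (d.innerSteps j * kernelCost A S) fun p σ' => ∃ z g,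
      (∀ a s, σ'.Holds (p.1 a s) (z a s)) ∧ σ'.Holds p.2 g ∧
        IsPenalized d w' y' ρ' (ρ' * (1 / 4) ^ j) z g := by
  have hAS : 1 ≤ A * S := Nat.mul_pos hA hS
  have hη : 0 ≤ ρ' * (1 / 4) ^ j := by positivity
  unfold penalized
  refine Ex.does_eval_bind (d.innerSteps j * kernelCost A S - 1) (Ex.Has.nat 0) ?_
    fun zero σ₁ e₁ h0 => ?_
  · have : 1 ≤ d.innerSteps j * kernelCost A S := by
      refine Nat.mul_pos ?_ (by rw [kernelCost]; omega)
      cases d <;> simp [Metric.innerSteps]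
    simp only [Ex.size_nat]
    omega
  refine Ex.does_eval_bind (d.innerSteps j * kernelCost A S - 2) (Ex.Has.nat 1) ?_
    fun one σ₂ e₂' h1 => ?_
  · have : 2 ≤ d.innerSteps j * kernelCost A S := by
      refine le_trans (by rw [kernelCost]; omega) (Nat.le_mul_of_pos_left (kernelCost A S) ?_)
      cases d <;> simp [Metric.innerSteps]
    simp only [Ex.size_nat]
    omega
  have e₂ := e₁.trans e₂'
  replace h0 := h0.ext e₂'
  replace hw := fun a s => (hw a s).ext e₂
  replace hy := fun a s => (hy a s).ext e₂
  replace hρ := hρ.ext e₂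
  simp only [Nat.cast_zero, Nat.cast_one] at h0 h1
  clear e₂ e₁ e₂'
  cases d with
  | l1 =>
    simp only [Metric.innerSteps, one_mul]
    refine .bind (20 * (A * S)) (does_solveRows hS hw hy (fun _ _ => h0) (fun _ _ => h1) hρ
      (fun a s => U.nonneg hu a s) (fun a s => U.le_one hu a s) hρ0 hu le_rfl)
      (by rw [kernelCost]; omega) fun zr σ₃ e₃ ⟨z, hz, hrow⟩ => ?_
    have hy3 := fun a s => (hy a s).ext e₃
    refine Ex.does_eval_bind 0 (.sum₂ fun a s => ((Ex.Has.reg (hz a s)).sub (.reg (hy3 a s))).max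
      ((Ex.Has.reg (hy3 a s)).sub (.reg (hz a s)))) ?_ fun g σ₄ e₄ hg => .ret
      ⟨z, _, fun a s => (hz a s).ext e₄, hg, ?_⟩
    · have := Ex.size_sum₂_le (t := 3) (e := fun a s => .max (.reg (zr a s) - .reg (y a s))
        (.reg (y a s) - .reg (zr a s))) hA hS (fun a s => by simp)
      ring_nf at this ⊢
      omega
    · have habs : ∀ a s, max (z a s - y' a s) (y' a s - z a s) = |z a s - y' a s| := fun a s => by
        rw [abs_eq_max_neg, neg_sub]
      simp only [habs]
      have hmem := rows_mem hrow (fun a s => U.nonneg hu a s) (fun a s => U.le_one hu a s)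
        fun a s => le_rfl
      refine ⟨hmem, le_rfl, sum_sum_le_card fun a s => U.abs_sub_le hmem hu a s, fun u hu' => ?_⟩
      have := rows_le hrow (fun a s => U.nonneg hu a s) (fun a s => U.le_one hu a s) hρ0
        (fun a s => U.nonneg hu' a s) (fun a s => U.le_one hu' a s) (U.sum_eq hu')
      simp only [Metric.penalty]
      linarith
  | l2 =>
    simp only [Metric.innerSteps, one_mul]
    refine .bind (A * rowCost S + 18 * (A * S)) (does_evalMat (t' := 9 * (A * S)) 9 (fun a s =>
      ((Ex.Has.reg (hw a s)).add (((Ex.Has.nat 2).mul (.reg hρ)).mul (.reg (hy a s)))).div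
        ((Ex.Has.nat 1).add ((Ex.Has.nat 2).mul (.reg hρ)))) (fun a s => by simp)
      (le_of_eq (by ring))) (by rw [kernelCost]; omega) fun w₂ σ₃ e₃ hw₂ => ?_
    simp only [Nat.cast_ofNat, Nat.cast_one] at hw₂
    replace hy := fun a s => (hy a s).ext e₃
    refine .bind (18 * (A * S)) (does_solveRows hS hw₂ hy (fun _ _ => h0.ext e₃)
      (fun _ _ => h1.ext e₃) (h0.ext e₃) (fun a s => U.nonneg hu a s)
      (fun a s => U.le_one hu a s) le_rfl hu le_rfl) le_rfl fun zr σ₄ e₄ ⟨z, hz, hrow⟩ => ?_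
    have hd := fun a s => (Ex.Has.reg (hz a s)).sub (.reg ((hy a s).ext e₄))
    refine Ex.does_eval_bind 0 (.sum₂ fun a s => (hd a s).mul (hd a s)) ?_ fun g σ₅ e₅ hg => .ret
      ⟨z, _, fun a s => (hz a s).ext e₅, hg, ?_⟩
    · have := Ex.size_sum₂_le (t := 3) (e := fun a s => (.reg (zr a s) - .reg (y a s)) *
        (.reg (zr a s) - .reg (y a s))) hA hS (fun a s => by simp)
      ring_nf at this ⊢
      omega
    · simp only [← sq]
      have hmem := rows_mem hrow (fun a s => U.nonneg hu a s) (fun a s => U.le_one hu a s)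
        fun a s => le_rfl
      refine ⟨hmem, le_rfl, sum_sum_le_card fun a s => ?_, fun u hu' => ?_⟩
      · rw [sq_le_one_iff_abs_le_one]
        exact U.abs_sub_le hmem hu a s
      · have h := rows_le hrow (fun a s => U.nonneg hu a s) (fun a s => U.le_one hu a s) le_rfl
          (fun a s => U.nonneg hu' a s) (fun a s => U.le_one hu' a s) (U.sum_eq hu')
        have k1 := sqDist_penalty_eq (w := w') (y := y') (z := z) hρ0
        have k2 := sqDist_penalty_eq (w := w') (y := y') (z := u) hρ0
        have k3 := mul_le_mul_of_nonneg_left h (by positivity : 0 ≤ 1 + 2 * ρ')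
        change _ + ρ' * sqDist z y' ≤ _ + ρ' * sqDist u y' + _
        rw [zero_mul, add_zero, zero_mul, add_zero] at k3
        linarith
  | linf =>
    refine .bind (A * rowCost S + 20 * (A * S)) (Comp.Does.iter (2 * kernelCost A S)
      (Q := fun m q σ' => ∃ a b, σ'.Holds q.1 a ∧ σ'.Holds q.2 b ∧ b - a = (2 / 3) ^ m ∧
        Brackets w' y' ρ' a b) le_rfl ?_ fun m _ q σ' e hq => ?_) ?_ fun q σ₃ e₃ hq => ?_
    · exact ⟨0, 1, h0, h1, by simp, le_rfl, zero_le_one, le_rfl,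
        fun r hr0 hr1 u hu => ⟨r, hr0, hr1, u, hu, le_rfl⟩⟩
    · obtain ⟨a, b, ha, hb, hlen, hbr⟩ := hq
      refine (does_ternaryStep hA hS (fun a s => (hw a s).ext e) (fun a s => (hy a s).ext e)
        (h0.ext e) (h1.ext e) (hρ.ext e) ha hb hu hbr).mono le_rfl ?_
      rintro q' σ'' - ⟨a', b', ha', hb', hlen', hbr'⟩
      exact ⟨a', b', ha', hb', by rw [hlen', hlen]; ring, hbr'⟩
    · simp only [Metric.innerSteps]
      have : 4 * j * (2 * kernelCost A S) + kernelCost A S = (8 * j + 1) * kernelCost A S := by ring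
      rw [← this]
      generalize 4 * j * (2 * kernelCost A S) = X
      rw [kernelCost]
      omega
    · obtain ⟨a, b, ha, hb, hlen, hbr⟩ := hq
      refine .bind 0 (does_boxEval hA hS (fun a s => (hw a s).ext e₃) (fun a s => (hy a s).ext e₃)
        (h0.ext e₃) (h1.ext e₃) (hρ.ext e₃) hb (hbr.1.trans hbr.2.1) hu) le_rfl
        fun p σ₄ e₄ ⟨z, v, hz, hv, hmin⟩ => .ret ⟨z, b, hz, hb.ext e₄,
          hbr.isPenalized hA hS hu hρ0 hmin (mul_le_mul_of_nonneg_left ?_ hρ0)⟩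
      rw [hlen, pow_mul]
      exact pow_le_pow_left₀ (by norm_num) (by norm_num) j

end programs

/-! ### Projection onto a ball of tuples of kernels -/

section penalty

variable {A S : ℕ}

theorem Metric.penalty_nonneg (d : Metric) (y z : Fin A → Fin S → ℝ) : 0 ≤ d.penalty y z := by
  cases d with
  | l1 => exact Finset.sum_nonneg fun a _ => Finset.sum_nonneg fun s _ => abs_nonneg _
  | l2 => exact Finset.sum_nonneg fun a _ => Finset.sum_nonneg fun s _ => sq_nonneg _
  | linf => exact norm_nonneg _

theorem Metric.penalty_self (d : Metric) (y : Fin A → Fin S → ℝ) : d.penalty y y = 0 := by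
  cases d <;> simp [Metric.penalty]

theorem Metric.penalty_convex (d : Metric) (y z z' : Fin A → Fin S → ℝ) {t : ℝ} (h0 : 0 ≤ t)
    (h1 : t ≤ 1) : d.penalty (fun a s => z a s + t * (z' a s - z a s)) y ≤
      (1 - t) * d.penalty z y + t * d.penalty z' y := by
  cases d with
  | l1 =>
    simp only [Metric.penalty, Finset.mul_sum, ← Finset.sum_add_distrib]
    refine Finset.sum_le_sum fun a _ => Finset.sum_le_sum fun s _ => ?_
    have : z a s + t * (z' a s - z a s) - y a s =
        (1 - t) * (z a s - y a s) + t * (z' a s - y a s) := by ring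
    rw [this]
    refine (abs_add_le _ _).trans_eq ?_
    rw [abs_mul, abs_mul, abs_of_nonneg h0, abs_of_nonneg (sub_nonneg.2 h1)]
  | l2 => exact sqDist_convex y z z' h0 h1
  | linf =>
    have : (fun a s => z a s + t * (z' a s - z a s)) - y = (1 - t) • (z - y) + t • (z' - y) := by
      ext a s
      simp only [Pi.sub_apply, Pi.add_apply, Pi.smul_apply, smul_eq_mul]
      ring
    simp only [Metric.penalty, this]
    refine (norm_add_le _ _).trans_eq ?_
    rw [norm_smul, norm_smul, Real.norm_of_nonneg h0, Real.norm_of_nonneg (sub_nonneg.2 h1)]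

end penalty

theorem U.segment_mem {A S : ℕ} {z z' : Fin A → Fin S → ℝ} (hz : z ∈ U A S) (hz' : z' ∈ U A S)
    {t : ℝ} (h0 : 0 ≤ t) (h1 : t ≤ 1) : (fun a s => z a s + t * (z' a s - z a s)) ∈ U A S := by
  convert U.convex hz hz' (sub_nonneg.2 h1) h0 (by ring) using 1
  ext a s
  simp only [Pi.add_apply, Pi.smul_apply, smul_eq_mul]
  ring

theorem IsPenalized.mono {A S : ℕ} {d : Metric} {w y : Fin A → Fin S → ℝ} {ρ η η' : ℝ}
    {z : Fin A → Fin S → ℝ} {g : ℝ} (h : IsPenalized d w y ρ η z g) (hη : η ≤ η') :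
    IsPenalized d w y ρ η' z g :=
  ⟨h.mem, h.penalty_le, h.le_card, fun u hu => (h.le u hu).trans (by linarith)⟩

/-- For a large penalty parameter it is optimal, up to a small error, to stay at the center. -/
theorem isPenalized_center {A S : ℕ} (d : Metric) {w y : Fin A → Fin S → ℝ} {ρ η R : ℝ}
    (hA : 0 < A) (hS : 0 < S) (hy : y ∈ U A S) (hR : ∀ a s, |w a s - y a s| ≤ R) (hρ : 0 < ρ)
    (h1 : A * S * R ≤ ρ) (h2 : A * S * R ^ 2 ≤ 4 * ρ * η) : IsPenalized d w y ρ η y 0 := by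
  have hAS : (1 : ℝ) ≤ A * S := by exact_mod_cast Nat.mul_pos hA hS
  have hR0 : 0 ≤ R := (abs_nonneg _).trans (hR ⟨0, hA⟩ ⟨0, hS⟩)
  have hη : 0 ≤ η := by
    have : 0 ≤ 4 * ρ * η := le_trans (by positivity) h2
    by_contra hneg
    push Not at hneg
    nlinarith
  refine ⟨hy, (d.penalty_self y).le, by positivity, fun u hu => ?_⟩
  have hR1 : R ≤ ρ := le_trans (by nlinarith) h1
  have key : (1 / 2) * sqDist y w ≤ (1 / 2) * sqDist u w + ∑ a, ∑ s, R * |u a s - y a s| := by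
    simp only [sqDist, Finset.mul_sum, ← Finset.sum_add_distrib]
    refine Finset.sum_le_sum fun a _ => Finset.sum_le_sum fun s _ => ?_
    have h : (w a s - y a s) * (u a s - y a s) ≤ R * |u a s - y a s| :=
      (le_abs_self _).trans (by rw [abs_mul]; gcongr; exact hR a s)
    nlinarith [sq_nonneg (u a s - y a s)]
  rw [mul_zero, add_zero]
  refine key.trans ?_
  rw [add_assoc]
  gcongr
  cases d with
  | l1 =>
    simp only [Metric.penalty, Finset.mul_sum]
    refine (Finset.sum_le_sum fun a _ => Finset.sum_le_sum fun s _ =>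
      mul_le_mul_of_nonneg_right hR1 (abs_nonneg (u a s - y a s))).trans (by linarith)
  | l2 =>
    have : ∑ a, ∑ s, R * |u a s - y a s| ≤
        ∑ a : Fin A, ∑ s : Fin S, (ρ * (u a s - y a s) ^ 2 + R ^ 2 / (4 * ρ)) := by
      refine Finset.sum_le_sum fun a _ => Finset.sum_le_sum fun s _ => ?_
      have e : ρ * (u a s - y a s) ^ 2 + R ^ 2 / (4 * ρ) - R * |u a s - y a s| =
          (2 * ρ * |u a s - y a s| - R) ^ 2 / (4 * ρ) := by
        rw [← sq_abs (u a s - y a s)]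
        field_simp
        ring
      have : 0 ≤ (2 * ρ * |u a s - y a s| - R) ^ 2 / (4 * ρ) := by positivity
      linarith
    refine this.trans ?_
    simp only [Finset.sum_add_distrib, Metric.penalty, Finset.mul_sum, Finset.sum_const,
      Finset.card_univ, Fintype.card_fin, nsmul_eq_mul]
    have : (A : ℝ) * (S * (R ^ 2 / (4 * ρ))) = A * S * R ^ 2 / (4 * ρ) := by ring
    rw [this]
    gcongr
    rw [div_le_iff₀ (by positivity)]
    linarith
  | linf =>
    have hn := (norm_kernel_le_iff (norm_nonneg (u - y))).1 le_rfl
    calc ∑ a, ∑ s, R * |u a s - y a s| ≤ ∑ _a : Fin A, ∑ _s : Fin S, R * ‖u - y‖ :=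
          Finset.sum_le_sum fun a _ => Finset.sum_le_sum fun s _ =>
            mul_le_mul_of_nonneg_left (hn a s) hR0
      _ = A * S * R * ‖u - y‖ := by simp; ring
      _ ≤ ρ * ‖u - y‖ := by gcongr
      _ ≤ _ := by simp only [Metric.penalty]; linarith

/-- Solutions of the penalized problems of `n` kernels, with total penalty estimate `G`. -/
def IsPenalizedAll {n A S : ℕ} (d : Metric) (w y : Fin n → Fin A → Fin S → ℝ) (ρ η : ℝ)
    (z : Fin n → Fin A → Fin S → ℝ) (G : ℝ) : Prop :=
  ∃ g : Fin n → ℝ, (∀ i, IsPenalized d (w i) (y i) ρ η (z i) (g i)) ∧ G = ∑ i, g i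

section IsPenalizedAll

variable {n A S : ℕ} {d : Metric} {w y z : Fin n → Fin A → Fin S → ℝ} {ρ η G : ℝ}

theorem IsPenalizedAll.penalty_le (h : IsPenalizedAll d w y ρ η z G) :
    ∑ i, d.penalty (z i) (y i) ≤ G := by
  obtain ⟨g, hg, rfl⟩ := h
  exact Finset.sum_le_sum fun i _ => (hg i).penalty_le

theorem IsPenalizedAll.le_card (h : IsPenalizedAll d w y ρ η z G) : G ≤ n * (A * S) := by
  obtain ⟨g, hg, rfl⟩ := h
  exact (Finset.sum_le_sum fun i _ => (hg i).le_card).trans_eq (by simp)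

theorem IsPenalizedAll.le (h : IsPenalizedAll d w y ρ η z G) {u : Fin n → Fin A → Fin S → ℝ}
    (hu : ∀ i, u i ∈ U A S) : (1 / 2) * ∑ i, sqDist (z i) (w i) + ρ * G ≤
      (1 / 2) * ∑ i, sqDist (u i) (w i) + ρ * ∑ i, d.penalty (u i) (y i) + n * η := by
  obtain ⟨g, hg, rfl⟩ := h
  have := Finset.sum_le_sum fun i (_ : i ∈ Finset.univ) => (hg i).le (u i) (hu i)
  simpa [Finset.sum_add_distrib, ← Finset.mul_sum] using this

theorem IsPenalizedAll.mem (h : IsPenalizedAll d w y ρ η z G) (i : Fin n) : z i ∈ U A S := by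
  obtain ⟨g, hg, rfl⟩ := h
  exact (hg i).mem

end IsPenalizedAll

/-- `z` minimizes the sum of the squared distances to `w` among the tuples of kernels with total
penalty at most `c`, up to an error of `E`. -/
structure IsConstrained {n A S : ℕ} (d : Metric) (w y : Fin n → Fin A → Fin S → ℝ) (c E : ℝ)
    (z : Fin n → Fin A → Fin S → ℝ) : Prop where
  mem : ∀ i, z i ∈ U A S
  penalty_le : ∑ i, d.penalty (z i) (y i) ≤ c
  le : ∀ u : Fin n → Fin A → Fin S → ℝ, (∀ i, u i ∈ U A S) →
    ∑ i, d.penalty (u i) (y i) ≤ c →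
    (1 / 2) * ∑ i, sqDist (z i) (w i) ≤ (1 / 2) * ∑ i, sqDist (u i) (w i) + E

/-- Two approximate minimizers of the Lagrangian for neighbouring multipliers, an infeasible one
and a feasible one, have a convex combination with the right estimate of the total penalty; it is
feasible and almost optimal. -/
theorem isConstrained_of_bracket {n A S : ℕ} {d : Metric} {w y z z' : Fin n → Fin A → Fin S → ℝ}
    {ρ ρ' η G G' c E : ℝ} (hρ : 0 ≤ ρ) (hρρ : ρ ≤ ρ') (h : IsPenalizedAll d w y ρ η z G)
    (h' : IsPenalizedAll d w y ρ' η z' G') (hc : 0 ≤ c) (hG : c < G) (hG' : G' ≤ c)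
    (hE : n * η + (ρ' - ρ) * (n * (A * S)) ≤ E) :
    IsConstrained d w y c E fun i a s =>
      z' i a s + (c - G') / (G - G') * (z i a s - z' i a s) := by
  have hpos : 0 < G - G' := by linarith
  set t := (c - G') / (G - G') with ht
  have h0 : 0 ≤ t := div_nonneg (by linarith) hpos.le
  have h1 : t ≤ 1 := (div_le_one hpos).2 (by linarith)
  have htG : t * (G - G') = c - G' := by rw [ht, div_mul_cancel₀ _ hpos.ne']
  refine ⟨fun i => U.segment_mem (h'.mem i) (h.mem i) h0 h1, ?_, fun u hu huc => ?_⟩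
  · have := Finset.sum_le_sum fun i (_ : i ∈ Finset.univ) =>
      d.penalty_convex (y i) (z' i) (z i) h0 h1
    rw [Finset.sum_add_distrib, ← Finset.mul_sum, ← Finset.mul_sum] at this
    nlinarith [mul_le_mul_of_nonneg_left h.penalty_le h0,
      mul_le_mul_of_nonneg_left h'.penalty_le (sub_nonneg.2 h1)]
  · have hconv := Finset.sum_le_sum fun i (_ : i ∈ Finset.univ) =>
      sqDist_convex (w i) (z' i) (z i) h0 h1
    rw [Finset.sum_add_distrib, ← Finset.mul_sum, ← Finset.mul_sum] at hconv
    have k := mul_le_mul_of_nonneg_left (h.le hu) h0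
    have k' := mul_le_mul_of_nonneg_left (h'.le hu) (sub_nonneg.2 h1)
    have kc := mul_le_mul_of_nonneg_left huc (mul_nonneg h0 hρ)
    have kc' := mul_le_mul_of_nonneg_left huc (mul_nonneg (sub_nonneg.2 h1) (hρ.trans hρρ))
    have hm : t * (G - c) = (1 - t) * (c - G') := by linarith
    have hm' : t * (G - c) ≤ n * (A * S) := by
      have := h.le_card
      nlinarith
    have hm'' := mul_le_mul_of_nonneg_left hm' (sub_nonneg.2 hρρ)
    set X := (1 / 2) * ∑ i, sqDist (u i) (w i)
    have e1 : (ρ' - ρ) * (t * (G - c)) = ρ' * ((1 - t) * (c - G')) - ρ * (t * (G - c)) := by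
      rw [← hm]; ring
    linarith

section programs

variable {ι : Type} {n A S : ℕ}

theorem stable_holds₂ (x : Fin A → Fin S → ℝ) :
    Comp.Stable fun (r : Fin A → Fin S → Reg ι) (σ : Store ι) => ∀ a s, σ.Holds (r a s) (x a s) :=
  fun _ _ _ hs h a s => (h a s).ext hs

/-- Solve the penalized problems of several kernels and add the penalty estimates. -/
def penalizedAll (d : Metric) (j : ℕ) (w y : Fin n → Fin A → Fin S → Reg ι) (ρ : Reg ι) :
    Comp ι ((Fin n → Fin A → Fin S → Reg ι) × Reg ι) :=
  (Comp.forFin n fun i => penalized d j (w i) (y i) ρ).bind fun p =>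
  (Ex.sum fun i => .reg (p i).2).eval.bind fun G => .ret (fun i => (p i).1, G)

theorem does_penalizedAll (d : Metric) (j : ℕ) (hA : 0 < A) (hS : 0 < S)
    {w y : Fin n → Fin A → Fin S → Reg ι} {ρ : Reg ι} {w' y' : Fin n → Fin A → Fin S → ℝ} {ρ' η : ℝ}
    {σ : Store ι} (hw : ∀ i a s, σ.Holds (w i a s) (w' i a s))
    (hy : ∀ i a s, σ.Holds (y i a s) (y' i a s)) (hρ : σ.Holds ρ ρ') (hu : ∀ i, y' i ∈ U A S)
    (hρ0 : 0 ≤ ρ') (hη : ρ' * (1 / 4) ^ j ≤ η) :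
    (penalizedAll d j w y ρ).Does σ (n * (d.innerSteps j * kernelCost A S + 1) + 1) fun p σ' =>
      ∃ z G, (∀ i a s, σ'.Holds (p.1 i a s) (z i a s)) ∧ σ'.Holds p.2 G ∧
        IsPenalizedAll d w' y' ρ' η z G := by
  refine .bind (n * (0 + 1) + 1) (Comp.Does.forFin (d.innerSteps j * kernelCost A S)
    (t' := n * (d.innerSteps j * kernelCost A S)) (Q := fun i p σ' => ∃ z g,
      (∀ a s, σ'.Holds (p.1 a s) (z a s)) ∧ σ'.Holds p.2 g ∧
        IsPenalized d (w' i) (y' i) ρ' (ρ' * (1 / 4) ^ j) z g)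
    (fun i p σ₁ σ₂ e h => by
      obtain ⟨z, g, h1, h2, h3⟩ := h
      exact ⟨z, g, fun a s => (h1 a s).ext e, h2.ext e, h3⟩) le_rfl
    fun i σ' e => does_penalized d j hA hS (fun a s => (hw i a s).ext e)
      (fun a s => (hy i a s).ext e) (hρ.ext e) (hu i) hρ0) (le_of_eq (by ring))
    fun p σ₁ e₁ hp => ?_
  choose z g hz hg hpen using hp
  refine Ex.does_eval_bind 0 (.sum fun i => .reg (hg i)) (Ex.size_sum_le fun i => le_rfl)
    fun G σ₂ e₂ hG => .ret ⟨z, _, fun i a s => (hz i a s).ext e₂, hG,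
      g, fun i => (hpen i).mono hη, rfl⟩

/-- The state of the bisection for the multiplier: the multiplier, the solution of the penalized
problems and its total penalty estimate. -/
abbrev Trial (ι : Type) (n A S : ℕ) := Reg ι × (Fin n → Fin A → Fin S → Reg ι) × Reg ι

/-- One step of the bisection for the multiplier. -/
def multiplierStep (d : Metric) (j : ℕ) (w y : Fin n → Fin A → Fin S → Reg ι) (c : Reg ι)
    (q : Trial ι n A S × Trial ι n A S) : Comp ι (Trial ι n A S × Trial ι n A S) :=
  ((.reg q.1.1 + .reg q.2.1) / .nat 2 : Ex ι).eval.bind fun ρ =>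
  (penalizedAll d j w y ρ).bind fun p =>
  .ifLE p.2 c (.ret (q.1, (ρ, p))) (.ret ((ρ, p), q.2))

/-- Approximate projection of `w` onto the set of tuples of kernels with total penalty at most `c`
relative to `y`. -/
def constrained (d : Metric) (j : ℕ) (w y : Fin n → Fin A → Fin S → Reg ι) (c : Reg ι) :
    Comp ι (Fin n → Fin A → Fin S → Reg ι) :=
  (Ex.nat 0).eval.bind fun zero =>
  (penalizedAll d j w y zero).bind fun p =>
  .ifLE p.2 c (.ret p.1)
    ((Ex.nat (2 ^ j)).eval.bind fun top =>
    (Comp.iter (fun _ => multiplierStep d j w y c) (2 * j) ((zero, p), (top, y, zero))).bind fun q =>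
    ((.reg c - .reg q.2.2.2) / (.reg q.1.2.2 - .reg q.2.2.2) : Ex ι).eval.bind fun t =>
    Comp.forFin n fun i => evalMat fun a s =>
      .reg (q.2.2.1 i a s) + .reg t * (.reg (q.1.2.1 i a s) - .reg (q.2.2.1 i a s)))

/-- The registers of a trial hold an approximate solution for the multiplier. -/
def Trial.Ok (d : Metric) (w y : Fin n → Fin A → Fin S → ℝ) (η ρ G : ℝ) (q : Trial ι n A S)
    (σ : Store ι) : Prop :=
  σ.Holds q.1 ρ ∧ σ.Holds q.2.2 G ∧ ∃ z : Fin n → Fin A → Fin S → ℝ,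
    (∀ i a s, σ.Holds (q.2.1 i a s) (z i a s)) ∧ IsPenalizedAll d w y ρ η z G

theorem Trial.Ok.ext {d : Metric} {w y : Fin n → Fin A → Fin S → ℝ} {η ρ G : ℝ}
    {q : Trial ι n A S} {σ σ' : Store ι} (h : q.Ok d w y η ρ G σ) (e : σ.Ext σ') :
    q.Ok d w y η ρ G σ' := by
  obtain ⟨h1, h2, z, h3, h4⟩ := h
  exact ⟨h1.ext e, h2.ext e, z, fun i a s => (h3 i a s).ext e, h4⟩

/-- A bound for the number of instructions of `constrained`. -/
def constrainedCost (d : Metric) (j n A S : ℕ) : ℕ :=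
  (2 * j + 2) * (n * (d.innerSteps j * kernelCost A S + 10))

theorem does_constrained (d : Metric) (j : ℕ) (hn : 0 < n) (hA : 0 < A) (hS : 0 < S)
    {w y : Fin n → Fin A → Fin S → Reg ι} {c : Reg ι} {w' y' : Fin n → Fin A → Fin S → ℝ}
    {c' R : ℝ} {σ : Store ι} (hw : ∀ i a s, σ.Holds (w i a s) (w' i a s))
    (hy : ∀ i a s, σ.Holds (y i a s) (y' i a s)) (hc : σ.Holds c c') (hu : ∀ i, y' i ∈ U A S)
    (hc0 : 0 ≤ c') (hR : ∀ i a s, |w' i a s - y' i a s| ≤ R) (hj : A * S * R ≤ 2 ^ j) :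
    (constrained d j w y c).Does σ (constrainedCost d j n A S) fun r σ' =>
      ∃ z : Fin n → Fin A → Fin S → ℝ, (∀ i a s, σ'.Holds (r i a s) (z i a s)) ∧
        IsConstrained d w' y' c' (n * ((A * S * (R ^ 2 + 1) + 1) * (1 / 2) ^ j)) z := by
  have hAS : 1 ≤ A * S := Nat.mul_pos hA hS
  set η : ℝ := (A * S * R ^ 2 + 1) * (1 / 2) ^ j with hη
  have hη1 : (1 / 2 : ℝ) ^ j ≤ η := le_mul_of_one_le_left (by positivity)
    (by have : (0 : ℝ) ≤ A * S * R ^ 2 := by positivity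
        linarith)
  have h24 : (2 : ℝ) ^ j * (1 / 4) ^ j = (1 / 2) ^ j := by rw [← mul_pow]; norm_num
  have h22 : (2 : ℝ) ^ j * (1 / 2) ^ j = 1 := by rw [← mul_pow]; norm_num
  have hηρ : ∀ ρ : ℝ, ρ ≤ 2 ^ j → ρ * (1 / 4) ^ j ≤ η := fun ρ hρ =>
    le_trans (by rw [← h24]; gcongr) hη1
  set K := d.innerSteps j * kernelCost A S with hK
  have hK1 : 85 * (A * S) ≤ K := by
    have h1 : 1 ≤ d.innerSteps j := by cases d <;> simp [Metric.innerSteps]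
    have h2 : 85 * (A * S) ≤ kernelCost A S := by
      rw [kernelCost, rowCost, rowDepth]
      have : 55 * (A * S) ≤ A * (S * (15 * (Nat.log 2 (4 * S) + 1) + 40)) := by
        rw [← mul_assoc]
        nlinarith [Nat.zero_le (Nat.log 2 (4 * S))]
      omega
    exact h2.trans (Nat.le_mul_of_pos_left _ h1)
  have hcost : 1 + (n * (K + 1) + 1 + (1 + (2 * j * (n * (K + 1) + 6) + (3 + 3 * (n * (A * S))))) + 1)
      ≤ constrainedCost d j n A S := by
    rw [constrainedCost, ← hK]
    have h1 : n * (K + 1) + 6 ≤ n * (K + 10) := by nlinarith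
    have h2 := Nat.mul_le_mul_left (2 * j) h1
    have h3 : n * (K + 1) + 3 * (n * (A * S)) + 7 ≤ 2 * (n * (K + 10)) := by nlinarith
    have h4 : (2 * j + 2) * (n * (K + 10)) = 2 * j * (n * (K + 10)) + 2 * (n * (K + 10)) := by ring
    omega
  unfold constrained
  refine Ex.does_eval_bind _ (Ex.Has.nat 0) hcost fun zero σ₁ e₁ h0 => ?_
  rw [Nat.cast_zero] at h0
  refine .bind (1 + (2 * j * (n * (K + 1) + 6) + (3 + 3 * (n * (A * S)))) + 1)
    (does_penalizedAll d j hA hS (η := η) (fun i a s => (hw i a s).ext e₁)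
    (fun i a s => (hy i a s).ext e₁) h0 hu le_rfl (hηρ 0 (by positivity))) (by rw [← hK]; omega)
    fun p σ₂ e₂' ⟨z, G, hz, hG, hpen⟩ => ?_
  have e₂ := e₁.trans e₂'
  replace h0 := h0.ext e₂'
  have hc2 := hc.ext e₂
  refine .ifLE le_rfl (fun hle => .ret ⟨z, hz, hpen.mem, ?_, fun u hu' huc => ?_⟩) fun hlt => ?_
  · rw [hG.2, hc2.2] at hle
    exact hpen.penalty_le.trans hle
  · have := hpen.le hu'
    rw [zero_mul, add_zero, zero_mul, add_zero] at this
    refine this.trans (add_le_add_right (mul_le_mul_of_nonneg_left ?_ (by positivity)) _)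
    rw [hη]
    gcongr
    linarith
  rw [hG.2, hc2.2] at hlt
  refine Ex.does_eval_bind _ (Ex.Has.nat (2 ^ j)) le_rfl fun top σ₃ e₃' htop => ?_
  push_cast at htop
  have e₃ := e₂.trans e₃'
  refine .bind _ (Comp.Does.iter (n * (K + 1) + 6) (Q := fun m q σ' => ∃ ρ G ρ' G' : ℝ,
      q.1.Ok d w' y' η ρ G σ' ∧ q.2.Ok d w' y' η ρ' G' σ' ∧ 0 ≤ ρ ∧ ρ' - ρ = 2 ^ j * (1 / 2) ^ m ∧
      ρ' ≤ 2 ^ j ∧ c' < G ∧ G' ≤ c') le_rfl ?_ fun m _ q σ' e hq => ?_) le_rfl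
    fun q σ₄ e₄' hq => ?_
  · refine ⟨0, G, 2 ^ j, 0, ⟨h0.ext e₃', hG.ext e₃', z, fun i a s => (hz i a s).ext e₃', hpen⟩,
      ⟨htop, h0.ext e₃', y', fun i a s => (hy i a s).ext e₃, fun _ => 0, fun i => ?_, by simp⟩,
      le_rfl, by simp, le_rfl, hlt, hc0⟩
    refine isPenalized_center d hA hS (hu i) (hR i) (by positivity) hj ?_
    have e4 : 4 * (2 : ℝ) ^ j * η = 4 * (A * S * R ^ 2 + 1) := by
      rw [hη]; linear_combination 4 * ((A : ℝ) * S * R ^ 2 + 1) * h22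
    rw [e4]
    have : (0 : ℝ) ≤ A * S * R ^ 2 := by positivity
    linarith
  · obtain ⟨ρ, G, ρ', G', hq1, hq2, hρ0, hdiff, htop', hGc, hGc'⟩ := hq
    have hpos : 0 ≤ ρ' - ρ := by rw [hdiff]; positivity
    have e' := e₃.trans e
    unfold multiplierStep
    refine Ex.does_eval_bind (n * (K + 1) + 3) (((Ex.Has.reg hq1.1).add (.reg hq2.1)).div (.nat 2))
      (by simp; omega) fun r σ₅ e₅ hr => ?_
    push_cast at hr
    refine .bind 1 (does_penalizedAll d j hA hS (η := η) (fun i a s => (hw i a s).ext (e'.trans e₅))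
      (fun i a s => (hy i a s).ext (e'.trans e₅)) hr hu (by linarith) (hηρ _ (by linarith)))
      (by rw [← hK]; omega) fun p σ₆ e₆ ⟨z, G'', hz, hG'', hpen⟩ => ?_
    have hc6 := hc.ext (e'.trans (e₅.trans e₆))
    refine .ifLE (t := 0) le_rfl (fun h => .ret ?_) fun h => .ret ?_
    · rw [hG''.2, hc6.2] at h
      exact ⟨ρ, G, _, G'', hq1.ext (e₅.trans e₆), ⟨hr.ext e₆, hG'', z, hz, hpen⟩, hρ0,
        by rw [pow_succ]; linarith, by linarith, hGc, h⟩
    · rw [hG''.2, hc6.2] at h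
      exact ⟨_, G'', ρ', G', ⟨hr.ext e₆, hG'', z, hz, hpen⟩, hq2.ext (e₅.trans e₆), by linarith,
        by rw [pow_succ]; linarith, htop', h, hGc'⟩
  · obtain ⟨ρ, G, ρ', G', hq1, hq2, hρ0, hdiff, htop', hGc, hGc'⟩ := hq
    have hpos : 0 ≤ ρ' - ρ := by rw [hdiff]; positivity
    obtain ⟨hr1, hG1, z1, hz1, hpen1⟩ := hq1
    obtain ⟨hr2, hG2, z2, hz2, hpen2⟩ := hq2
    refine Ex.does_eval_bind (3 * (n * (A * S))) (((Ex.Has.reg (hc.ext (e₃.trans e₄'))).sub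
      (.reg hG2)).div ((Ex.Has.reg hG1).sub (.reg hG2))) (by simp) fun t σ₅ e₅ ht => ?_
    refine (Comp.Does.forFin (A * (S * 3)) (Q := fun i r σ' => ∀ a s, σ'.Holds (r a s)
        (z2 i a s + (c' - G') / (G - G') * (z1 i a s - z2 i a s)))
      (fun i => stable_holds₂ _) (le_of_eq (by ring)) fun i σ' e => does_evalMat 3
        (fun a s => ((Ex.Has.reg ((hz2 i a s).ext (e₅.trans e))).add ((Ex.Has.reg (ht.ext e)).mul
          ((Ex.Has.reg ((hz1 i a s).ext (e₅.trans e))).sub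
          (.reg ((hz2 i a s).ext (e₅.trans e))))))) (fun a s => by simp) le_rfl).mono le_rfl ?_
    intro r σ' e hr
    refine ⟨_, hr, isConstrained_of_bracket hρ0 (sub_nonneg.1 hpos) hpen1 hpen2 hc0 hGc hGc' ?_⟩
    have : (2 : ℝ) ^ j * (1 / 2) ^ (2 * j) = (1 / 2) ^ j := by
      rw [two_mul, pow_add, ← mul_assoc, h22, one_mul]
    rw [hdiff, hη, this]
    apply le_of_eq
    ring

end programs

/-! ### The proximal update of the minimizing player -/

section argmin

variable {ι : Type} {n : ℕ}

/-- The index of the smallest number among those with an index in the list and the one with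
index `b`. -/
def argmin (r : Fin n → Reg ι) : List (Fin n) → Fin n → Comp ι (Fin n)
  | [], b => .ret b
  | a :: l, b => .ifLE (r b) (r a) (argmin r l b) (argmin r l a)

theorem does_argmin {r : Fin n → Reg ι} {σ : Store ι} (l : List (Fin n)) (b : Fin n) :
    (argmin r l b).Does σ l.length fun m _ =>
      σ.val (r m) ≤ σ.val (r b) ∧ ∀ a ∈ l, σ.val (r m) ≤ σ.val (r a) := by
  induction l generalizing b with
  | nil => exact .ret (by simp)
  | cons a l ih =>
    refine .ifLE le_rfl (fun h => (ih b).mono le_rfl fun m _ _ hm => ?_)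
      fun h => (ih a).mono le_rfl fun m _ _ hm => ?_
    · exact ⟨hm.1, by simpa using ⟨hm.1.trans h, hm.2⟩⟩
    · exact ⟨hm.1.trans h.le, by simpa using hm⟩

end argmin

namespace Model

variable {N A S : ℕ} (P : Model N A S)

/-- The linear coefficients in the proximal update of the minimizing player. -/
def coefX (s : Fin S) (v : Fin S → ℝ) (y : Fin N → Fin A → Fin S → ℝ) (a : Fin A) : ℝ :=
  P.cost s a + P.disc * ((1 / (N : ℝ)) * ∑ i, ∑ s', y i a s' * v s')

theorem l2norm_nonneg (v : Fin S → ℝ) : 0 ≤ l2norm v := Real.sqrt_nonneg _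

theorem abs_le_l2norm (v : Fin S → ℝ) (s : Fin S) : |v s| ≤ l2norm v := by
  rw [l2norm, ← Real.sqrt_sq_eq_abs]
  exact Real.sqrt_le_sqrt (Finset.single_le_sum (f := fun s => v s ^ 2) (fun i _ => sq_nonneg _)
    (Finset.mem_univ s))

theorem invTau_nonneg (v : Fin S → ℝ) : 0 ≤ P.invTau v := by
  have := P.disc_pos.le
  have := l2norm_nonneg v
  unfold invTau
  positivity

theorem invSigma_nonneg (v : Fin S → ℝ) : 0 ≤ P.invSigma v := by
  have := P.disc_pos.le
  have := l2norm_nonneg v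
  unfold invSigma
  positivity

theorem proxObjX_eq {s : Fin S} {v : Fin S → ℝ} {y : Fin N → Fin A → Fin S → ℝ} {x z : Fin A → ℝ}
    (h : P.invTau v ≠ 0) : P.proxObjX s v y x z =
      P.invTau v * ((1 / 2) * ∑ a, (z a - (x a - P.coefX s v y a / P.invTau v)) ^ 2) +
      ∑ a, (P.coefX s v y a * x a - P.coefX s v y a ^ 2 / (2 * P.invTau v)) := by
  change ∑ a, P.coefX s v y a * z a + P.invTau v / 2 * ∑ a, (z a - x a) ^ 2 = _
  simp only [Finset.mul_sum, ← Finset.sum_add_distrib]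
  refine Finset.sum_congr rfl fun a _ => ?_
  field_simp
  ring

end Model

section programs

variable {ι : Type} {N A S : ℕ}

/-- The Euclidean norm of a value vector. -/
def l2normEx (v : Fin S → Reg ι) : Ex ι := .sqrt (.sum fun s => .reg (v s) * .reg (v s))

theorem has_l2normEx {σ : Store ι} {v : Fin S → Reg ι} {v' : Fin S → ℝ}
    (hv : ∀ s, σ.Holds (v s) (v' s)) : (l2normEx v).Has σ (Model.l2norm v') := by
  have := (Ex.Has.sum fun s => (Ex.Has.reg (hv s)).mul (.reg (hv s))).sqrt
  simp only [Model.l2norm, sq]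
  exact this

theorem size_l2normEx_le (v : Fin S → Reg ι) : (l2normEx v).size ≤ S * 2 + 2 := by
  have := Ex.size_sum_le (t := 1) (f := fun s => .reg (v s) * .reg (v s)) fun s => by simp
  simp only [l2normEx, Ex.size_sqrt]
  omega

/-- The proximal update of the minimizing player at one state. If the step size is infinite, it
selects the best action. -/
def stepX (disc : Reg ι) (c : Fin A → Reg ι) (v : Fin S → Reg ι)
    (y : Fin N → Fin A → Fin S → Reg ι) (x : Fin A → Reg ι) : Comp ι (Fin A → Reg ι) :=
  (Ex.nat 0).eval.bind fun zero =>
  (Ex.nat 1).eval.bind fun one =>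
  (.sqrt (.nat A) * (.reg disc * l2normEx v) : Ex ι).eval.bind fun β =>
  (evalVec fun a => .reg (c a) + .reg disc * ((.nat 1 / .nat N) *
    .sum fun i => .sum fun s' => .reg (y i a s') * .reg (v s'))).bind fun q =>
  .ifLE β zero
    (match List.finRange A with
      | [] => .ret fun _ => zero
      | b :: l => (argmin q l b).bind fun m => .ret fun a => if a = m then one else zero)
    ((evalVec fun a => .reg (x a) - .reg (q a) / .reg β).bind fun w =>
      rowSolve w x (fun _ => zero) (fun _ => one) zero)

/-- A bound for the number of instructions of `stepX`. -/
def stepXCost (N A S : ℕ) : ℕ := rowCost A + 30 * (N * (A * S))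

theorem does_stepX (P : Model N A S) (hN : 0 < N) (hA : 0 < A) (hS : 0 < S) {σ : Store ι}
    {disc : Reg ι} {c x : Fin A → Reg ι} {v : Fin S → Reg ι} {y : Fin N → Fin A → Fin S → Reg ι}
    {s : Fin S} {v' : Fin S → ℝ} {y' : Fin N → Fin A → Fin S → ℝ} {x' : Fin A → ℝ}
    (hd : σ.Holds disc P.disc) (hc : ∀ a, σ.Holds (c a) (P.cost s a))
    (hv : ∀ s, σ.Holds (v s) (v' s)) (hy : ∀ i a s, σ.Holds (y i a s) (y' i a s))
    (hx : ∀ a, σ.Holds (x a) (x' a)) (hx' : x' ∈ stdSimplex ℝ (Fin A)) :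
    (stepX disc c v y x).Does σ (stepXCost N A S) fun r σ' => ∃ z : Fin A → ℝ,
      (∀ a, σ'.Holds (r a) (z a)) ∧ z ∈ stdSimplex ℝ (Fin A) ∧
      ∀ u ∈ stdSimplex ℝ (Fin A), P.proxObjX s v' y' x' z ≤ P.proxObjX s v' y' x' u := by
  have hAS : 1 ≤ A * S := Nat.mul_pos hA hS
  have hcost : 1 + (1 + ((2 * S + 6) + (A * (N * (2 * S + 2) + 7) + (2 * A + rowCost A + 1)))) ≤
      stepXCost N A S := by
    rw [stepXCost]
    have h1 : S ≤ N * (A * S) := by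
      rw [← mul_assoc]; exact Nat.le_mul_of_pos_left S (Nat.mul_pos hN hA)
    have h2 : A * N ≤ N * (A * S) := by
      rw [← mul_assoc, mul_comm A N]; exact Nat.le_mul_of_pos_right _ hS
    have h3 : A ≤ A * N := Nat.le_mul_of_pos_right _ hN
    have h4 : 1 ≤ A * N := Nat.mul_pos hA hN
    have h5 : A * (N * (2 * S + 2) + 7) = 2 * (N * (A * S)) + 2 * (A * N) + 7 * A := by ring
    omega
  unfold stepX
  refine Ex.does_eval_bind _ (Ex.Has.nat 0) hcost fun zero σ₁ e₁ h0 => ?_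
  refine Ex.does_eval_bind _ ((Ex.Has.nat 1).ext e₁) le_rfl fun one σ₂ e₂' h1 => ?_
  have e₂ := e₁.trans e₂'
  refine Ex.does_eval_bind _ (((Ex.Has.nat A).sqrt.mul ((Ex.Has.reg hd).mul
    (has_l2normEx hv))).ext e₂) (Nat.add_le_add_right ?_ _) fun β σ₃ e₃' hβ => ?_
  · have := size_l2normEx_le v
    simp only [Ex.size_mul, Ex.size_sqrt, Ex.size_nat, Ex.size_reg]
    omega
  have e₃ := e₂.trans e₃'
  change σ₃.Holds β (P.invTau v') at hβ
  refine .bind _ (does_evalVec (t' := A * (N * (2 * S + 2) + 7)) (N * (2 * S + 2) + 7)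
    (fun a => ((Ex.Has.reg (hc a)).add ((Ex.Has.reg hd).mul
    (((Ex.Has.nat 1).div (.nat N)).mul (.sum fun i => .sum fun s' =>
      (Ex.Has.reg (hy i a s')).mul (.reg (hv s')))))).ext e₃) (fun a => ?_) le_rfl) le_rfl
    fun q σ₄ e₄' hq => ?_
  · have := Ex.size_sum_le (t := S * 2 + 1) (f := fun i => Ex.sum fun s' =>
      .reg (y i a s') * .reg (v s')) fun i => Ex.size_sum_le fun s' => by simp
    simp only [Ex.size_add, Ex.size_mul, Ex.size_div, Ex.size_nat, Ex.size_reg]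
    have e : N * (S * 2 + 1 + 1) = N * (2 * S + 2) := by ring
    omega
  have e₄ := e₃.trans e₄'
  replace h0 := h0.ext (e₂'.trans (e₃'.trans e₄'))
  replace h1 := h1.ext (e₃'.trans e₄')
  replace hβ := hβ.ext e₄'
  rw [Nat.cast_zero] at h0
  rw [Nat.cast_one] at h1
  replace hq : ∀ a, σ₄.Holds (q a) (P.coefX s v' y' a) := fun a => by
    simpa only [Model.coefX, Nat.cast_one] using hq a
  refine .ifLE le_rfl (fun hle => ?_) fun hlt => ?_
  · rw [hβ.2, h0.2] at hle
    have hβ0 : P.invTau v' = 0 := le_antisymm hle (P.invTau_nonneg v')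
    match hl : List.finRange A with
    | [] => simp at hl; omega
    | b :: l =>
      have hlen : l.length + 1 = A := by
        rw [← List.length_cons (a := b), ← hl, List.length_finRange]
      refine .bind 0 (does_argmin l b) (by omega) fun m σ₅ e₅ hm => .ret
        ⟨fun a => if a = m then 1 else 0, fun a => ?_, ⟨fun a => ?_, by simp⟩, fun u hu => ?_⟩
      · dsimp only
        split_ifs
        · exact h1.ext e₅
        · exact h0.ext e₅
      · dsimp only
        split_ifs <;> norm_num
      · have hmin : ∀ a, P.coefX s v' y' m ≤ P.coefX s v' y' a := fun a => by
          have : a ∈ b :: l := by rw [← hl]; exact List.mem_finRange a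
          rw [← (hq m).2, ← (hq a).2]
          rcases List.mem_cons.mp this with rfl | h
          · exact hm.1
          · exact hm.2 a h
        change ∑ a, P.coefX s v' y' a * _ + P.invTau v' / 2 * _ ≤
          ∑ a, P.coefX s v' y' a * u a + P.invTau v' / 2 * _
        rw [hβ0, zero_div, zero_mul, add_zero, zero_mul, add_zero]
        calc _ = P.coefX s v' y' m * ∑ a, u a := by simp [hu.2]
          _ ≤ _ := by
            rw [Finset.mul_sum]
            exact Finset.sum_le_sum fun a _ => mul_le_mul_of_nonneg_right (hmin a) (hu.1 a)
  · rw [hβ.2, h0.2] at hlt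
    have hx4 := fun a => (hx a).ext e₄
    have hx1 : ∀ u ∈ stdSimplex ℝ (Fin A), ∀ a, u a ≤ 1 := fun u hu a => by
      rw [← hu.2]
      exact Finset.single_le_sum (fun i _ => hu.1 i) (Finset.mem_univ a)
    refine .bind _ (does_evalVec (t' := 2 * A) 2 (fun a => (Ex.Has.reg (hx4 a)).sub
      ((Ex.Has.reg (hq a)).div (.reg hβ))) (fun a => by simp) (le_of_eq (by ring))) le_rfl
      fun w σ₅ e₅ hw => ?_
    refine (does_rowSolve hA hw (fun a => (hx4 a).ext e₅) (fun _ => h0.ext e₅)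
      (fun _ => h1.ext e₅) (h0.ext e₅) (fun a => hx'.1 a) (hx1 x' hx') le_rfl (by simp)
      (by simpa using Nat.succ_le_of_lt hA)).mono le_rfl fun r σ' _ ⟨z, hz, hrow⟩ => ?_
    refine ⟨z, hz, ⟨fun a => (hrow.mem (fun a => hx'.1 a) (hx1 x' hx') a).1, hrow.2⟩,
      fun u hu => ?_⟩
    have := hrow.le (fun a => hx'.1 a) (hx1 x' hx') le_rfl (fun a => hu.1 a) (hx1 u hu) hu.2
    rw [zero_mul, add_zero, zero_mul, add_zero] at this
    rw [P.proxObjX_eq hlt.ne', P.proxObjX_eq hlt.ne']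
    gcongr

end programs

/-! ### The proximal update of the maximizing player -/

/-- The combinations of metric and type of the Wasserstein distance that are treated. -/
def Admissible (d : Metric) (p : ℝ≥0∞) : Prop :=
  (d = Metric.l2 ∧ (p = 2 ∨ p = ⊤)) ∨ (d = Metric.l1 ∧ (p = 1 ∨ p = ⊤)) ∨
    (d = Metric.linf ∧ (p = 1 ∨ p = ⊤))

/-- The bound for the penalty that corresponds to the bound `θ` for the metric. -/
def Metric.budget (d : Metric) (θ : ℝ) : ℝ :=
  match d with
  | .l1 => θ
  | .l2 => θ * θ
  | .linf => θ

theorem Metric.budget_nonneg (d : Metric) {θ : ℝ} (h : 0 ≤ θ) : 0 ≤ d.budget θ := by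
  cases d
  · exact h
  · exact mul_nonneg h h
  · exact h

theorem Metric.dist_nonneg {A S : ℕ} (d : Metric) (y z : Fin A → Fin S → ℝ) : 0 ≤ d.dist y z := by
  cases d with
  | l1 => exact Finset.sum_nonneg fun a _ => Finset.sum_nonneg fun s _ => abs_nonneg _
  | l2 => exact Real.sqrt_nonneg _
  | linf => exact norm_nonneg _

theorem Metric.dist_le_iff {A S : ℕ} (d : Metric) (y z : Fin A → Fin S → ℝ) {θ : ℝ} (h : 0 ≤ θ) :
    d.dist y z ≤ θ ↔ d.penalty y z ≤ d.budget θ := by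
  cases d with
  | l1 => rfl
  | l2 =>
    simp only [Metric.dist, Metric.penalty, Metric.budget, ← sq]
    exact Real.sqrt_le_left h
  | linf => rfl

theorem Admissible.dist_rpow {A S : ℕ} {d : Metric} {p : ℝ≥0∞} (h : Admissible d p) (hp : p ≠ ⊤)
    (y z : Fin A → Fin S → ℝ) : d.dist y z ^ p.toReal = d.penalty y z := by
  rcases h with ⟨rfl, rfl | rfl⟩ | ⟨rfl, rfl | rfl⟩ | ⟨rfl, rfl | rfl⟩
  · simp only [Metric.dist, Metric.penalty, ENNReal.toReal_ofNat, Real.rpow_ofNat]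
    exact Real.sq_sqrt (Metric.penalty_nonneg .l2 y z)
  · exact absurd rfl hp
  · simp [Metric.dist, Metric.penalty]
  · exact absurd rfl hp
  · simp [Metric.dist, Metric.penalty]
  · exact absurd rfl hp

theorem Admissible.budget_eq {d : Metric} {p : ℝ≥0∞} (h : Admissible d p) (hp : p ≠ ⊤) (θ : ℝ) :
    θ ^ p.toReal = d.budget θ := by
  rcases h with ⟨rfl, rfl | rfl⟩ | ⟨rfl, rfl | rfl⟩ | ⟨rfl, rfl | rfl⟩
  · simp [Metric.budget, sq]
  · exact absurd rfl hp
  · simp [Metric.budget]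
  · exact absurd rfl hp
  · simp [Metric.budget]
  · exact absurd rfl hp

namespace Model

variable {N A S : ℕ} (P : Model N A S)

theorem mem_feasible_top_iff {d : Metric} {s : Fin S} {y : Fin N → Fin A → Fin S → ℝ} :
    y ∈ P.feasible d ⊤ s ↔
      (∀ i, y i ∈ U A S) ∧ ∀ i, d.penalty (y i) (P.sample i s) ≤ d.budget P.radius := by
  simp only [feasible, Set.mem_ofPred_eq, true_and, ne_eq, not_true_eq_false, false_and, or_false,
    Metric.dist_le_iff d _ _ P.radius_nonneg]

theorem mem_feasible_iff {d : Metric} {p : ℝ≥0∞} (h : Admissible d p) (hp : p ≠ ⊤) (hN : 0 < N)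
    {s : Fin S} {y : Fin N → Fin A → Fin S → ℝ} : y ∈ P.feasible d p s ↔
      (∀ i, y i ∈ U A S) ∧ ∑ i, d.penalty (y i) (P.sample i s) ≤ N * d.budget P.radius := by
  have hN' : (0 : ℝ) < N := by exact_mod_cast hN
  simp only [feasible, Set.mem_ofPred_eq, hp, false_and, ne_eq, not_false_eq_true, true_and,
    false_or, h.dist_rpow hp, h.budget_eq hp]
  rw [one_div, inv_mul_le_iff₀ hN']

/-- The unconstrained minimizer in the proximal update of the maximizing player. -/
def centerY (v : Fin S → ℝ) (x xn : Fin A → ℝ) (y : Fin N → Fin A → Fin S → ℝ) (i : Fin N)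
    (a : Fin A) (s : Fin S) : ℝ :=
  y i a s + P.disc / N * (2 * xn a - x a) * v s / P.invSigma v

theorem proxObjY_eq {v : Fin S → ℝ} {x xn : Fin A → ℝ} {y z : Fin N → Fin A → Fin S → ℝ}
    (h : P.invSigma v ≠ 0) : P.proxObjY v x xn y z =
      P.invSigma v * ((1 / 2) * ∑ i, sqDist (z i) (P.centerY v x xn y i)) +
      ∑ i, ∑ a, ∑ s, (-(P.disc / N) * (2 * xn a - x a) * v s * y i a s -
        (P.disc / N * (2 * xn a - x a) * v s) ^ 2 / (2 * P.invSigma v)) := by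
  simp only [proxObjY, sqDist, Finset.mul_sum, ← Finset.sum_add_distrib]
  refine Finset.sum_congr rfl fun i _ => Finset.sum_congr rfl fun a _ =>
    Finset.sum_congr rfl fun s _ => ?_
  simp only [centerY]
  rw [show -(P.disc / N) * (2 * xn a - x a) * v s = -(P.disc / N * (2 * xn a - x a) * v s) by ring]
  generalize P.disc / N * (2 * xn a - x a) * v s = q
  field_simp
  ring

theorem invSigma_eq_zero (hN : 0 < N) (hA : 0 < A) {v : Fin S → ℝ} (h : P.invSigma v = 0) :
    v = 0 := by
  have hN' : (N : ℝ) ≠ 0 := by exact_mod_cast hN.ne'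
  have hA' : √(A : ℝ) ≠ 0 := (Real.sqrt_pos.2 (by exact_mod_cast hA)).ne'
  simp only [invSigma, div_eq_zero_iff, mul_eq_zero, P.disc_pos.ne', hN', hA', or_self, or_false,
    false_or] at h
  ext s
  have := abs_le_l2norm v s
  rw [h] at this
  simpa using this

theorem proxObjY_of_zero (x xn : Fin A → ℝ) (y z : Fin N → Fin A → Fin S → ℝ) :
    P.proxObjY 0 x xn y z = 0 := by
  simp [proxObjY, invSigma, l2norm]

theorem invSigma_mul (hN : 0 < N) (hA : 0 < A) (v : Fin S → ℝ) :
    P.invSigma v * N * √(A : ℝ) = P.disc * l2norm v := by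
  have hN' : (N : ℝ) ≠ 0 := by exact_mod_cast hN.ne'
  have hA' : √(A : ℝ) ≠ 0 := (Real.sqrt_pos.2 (by exact_mod_cast hA)).ne'
  unfold invSigma
  field_simp

theorem abs_centerY_sub_le (hN : 0 < N) (hA : 0 < A) {v : Fin S → ℝ} {x xn : Fin A → ℝ}
    {y : Fin N → Fin A → Fin S → ℝ} {s : Fin S} (hx : x ∈ stdSimplex ℝ (Fin A))
    (hxn : xn ∈ stdSimplex ℝ (Fin A)) (hy : ∀ i, y i ∈ U A S) (i : Fin N) (a : Fin A)
    (s' : Fin S) : |P.centerY v x xn y i a s' - P.sample i s a s'| ≤ 3 * A := by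
  have hA1 : (1 : ℝ) ≤ A := by exact_mod_cast hA
  have hN' : (0 : ℝ) < N := by exact_mod_cast hN
  have hsq : √(A : ℝ) ≤ A := by
    rw [Real.sqrt_le_left (by positivity)]
    nlinarith
  have h1 := U.abs_sub_le (hy i) (P.sample_mem i s) a s'
  have h2 : |P.disc / N * (2 * xn a - x a) * v s' / P.invSigma v| ≤ 2 * √(A : ℝ) := by
    rcases (P.invSigma_nonneg v).eq_or_lt with h0 | hpos
    · rw [← h0, div_zero, abs_zero]; positivity
    · rw [abs_div, abs_of_pos hpos, div_le_iff₀ hpos, abs_mul, abs_mul,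
        abs_of_nonneg (div_nonneg P.disc_pos.le hN'.le)]
      have k1 : |2 * xn a - x a| ≤ 2 := by
        have b1 : xn a ≤ 1 := by
          rw [← hxn.2]; exact Finset.single_le_sum (fun i _ => hxn.1 i) (Finset.mem_univ a)
        have b2 : x a ≤ 1 := by
          rw [← hx.2]; exact Finset.single_le_sum (fun i _ => hx.1 i) (Finset.mem_univ a)
        rw [abs_le]
        constructor <;> linarith [hx.1 a, hxn.1 a]
      have k2 := abs_le_l2norm v s'
      have k3 := P.invSigma_mul hN hA v
      have k4 : 2 * √(A : ℝ) * P.invSigma v = P.disc / N * 2 * l2norm v := by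
        field_simp
        linarith
      rw [k4]
      have := P.disc_pos.le
      gcongr
  have : P.centerY v x xn y i a s' - P.sample i s a s' = (y i a s' - P.sample i s a s') +
      P.disc / N * (2 * xn a - x a) * v s' / P.invSigma v := by
    rw [centerY]; ring
  rw [this]
  refine (abs_add_le _ _).trans ?_
  linarith

end Model

section programs

variable {ι : Type} {N A S : ℕ}

/-- The expression for `Metric.budget`. -/
def budgetEx (d : Metric) (θ : Reg ι) : Ex ι :=
  match d with
  | .l1 => .reg θ
  | .l2 => .reg θ * .reg θ
  | .linf => .reg θ

theorem has_budgetEx (d : Metric) {σ : Store ι} {θ : Reg ι} {θ' : ℝ} (h : σ.Holds θ θ') :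
    (budgetEx d θ).Has σ (d.budget θ') := by
  cases d
  · exact .reg h
  · exact (Ex.Has.reg h).mul (.reg h)
  · exact .reg h

/-- The proximal update of the maximizing player at one state; `b` tells whether the type of the
Wasserstein distance is infinite, in which case each kernel has a budget of its own. -/
def stepY (d : Metric) (b : Bool) (j : ℕ) (disc θ : Reg ι) (v : Fin S → Reg ι)
    (x xn : Fin A → Reg ι) (y sample : Fin N → Fin A → Fin S → Reg ι) :
    Comp ι (Fin N → Fin A → Fin S → Reg ι) :=
  ((.reg disc * l2normEx v) / (.nat N * .sqrt (.nat A)) : Ex ι).eval.bind fun κ =>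
  (evalVec fun a => .reg disc / .nat N * (.nat 2 * .reg (xn a) - .reg (x a))).bind fun u =>
  (Comp.forFin N fun i => evalMat fun a s =>
    .reg (y i a s) + .reg (u a) * .reg (v s) / .reg κ).bind fun w =>
  (.nat (bif b then 1 else N) * budgetEx d θ : Ex ι).eval.bind fun c =>
  bif b then Comp.forFin N fun i =>
      (constrained d j (fun _ : Fin 1 => w i) (fun _ => sample i) c).bind fun z => .ret (z 0)
    else constrained d j w sample c

/-- A bound for the number of instructions of `stepY`. -/
def stepYCost (d : Metric) (j N A S : ℕ) : ℕ := constrainedCost d j N A S + 30 * (N * (A * S))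

theorem does_stepY (P : Model N A S) {d : Metric} {p : ℝ≥0∞} (hdp : Admissible d p) {b : Bool}
    (hb : b = true ↔ p = ⊤) (j : ℕ) (hN : 0 < N) (hA : 0 < A) (hS : 0 < S) {σ : Store ι}
    {disc θ : Reg ι} {x xn : Fin A → Reg ι} {v : Fin S → Reg ι}
    {y sample : Fin N → Fin A → Fin S → Reg ι} {s : Fin S} {v' : Fin S → ℝ}
    {y' : Fin N → Fin A → Fin S → ℝ} {x' xn' : Fin A → ℝ} {δ : ℝ}
    (hd : σ.Holds disc P.disc) (hθ : σ.Holds θ P.radius) (hv : ∀ s, σ.Holds (v s) (v' s))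
    (hx : ∀ a, σ.Holds (x a) (x' a)) (hxn : ∀ a, σ.Holds (xn a) (xn' a))
    (hy : ∀ i a s, σ.Holds (y i a s) (y' i a s))
    (hsample : ∀ i a s', σ.Holds (sample i a s') (P.sample i s a s'))
    (hx' : x' ∈ stdSimplex ℝ (Fin A)) (hxn' : xn' ∈ stdSimplex ℝ (Fin A)) (hy' : ∀ i, y' i ∈ U A S)
    (hj : (A : ℝ) * S * (3 * A) ≤ 2 ^ j)
    (hδ : P.invSigma v' * (N * ((A * S * ((3 * A) ^ 2 + 1) + 1) * (1 / 2) ^ j)) ≤ δ) :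
    (stepY d b j disc θ v x xn y sample).Does σ (stepYCost d j N A S) fun r σ' =>
      ∃ z : Fin N → Fin A → Fin S → ℝ, (∀ i a s, σ'.Holds (r i a s) (z i a s)) ∧
      z ∈ P.feasible d p s ∧ ∀ u ∈ P.feasible d p s,
        P.proxObjY v' x' xn' y' z ≤ P.proxObjY v' x' xn' y' u + δ := by
  have hδ0 : 0 ≤ δ := le_trans (by have := P.invSigma_nonneg v'; positivity) hδ
  have hbud := d.budget_nonneg P.radius_nonneg
  have hcost : (2 * S + 8) + (A * 7 + (N * (A * (S * 3)) + (3 + constrainedCost d j N A S))) ≤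
      stepYCost d j N A S := by
    rw [stepYCost]
    have h1 : S ≤ N * (A * S) := by
      rw [← mul_assoc]; exact Nat.le_mul_of_pos_left S (Nat.mul_pos hN hA)
    have h2 : A ≤ N * (A * S) := by
      calc A ≤ A * S := Nat.le_mul_of_pos_right _ hS
        _ ≤ _ := Nat.le_mul_of_pos_left _ hN
    have h3 : N * (A * (S * 3)) = 3 * (N * (A * S)) := by ring
    omega
  unfold stepY
  refine Ex.does_eval_bind (A * 7 + (N * (A * (S * 3)) + (3 + constrainedCost d j N A S)))
    (((Ex.Has.reg hd).mul (has_l2normEx hv)).div ((Ex.Has.nat N).mul (Ex.Has.nat A).sqrt))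
    ?_ fun κ σ₁ e₁ hκ => ?_
  · have := size_l2normEx_le v
    simp only [Ex.size_mul, Ex.size_div, Ex.size_sqrt, Ex.size_nat, Ex.size_reg]
    omega
  change σ₁.Holds κ (P.invSigma v') at hκ
  refine .bind _ (does_evalVec (t' := A * 7) 7 (fun a => (((Ex.Has.reg hd).div (.nat N)).mul
    (((Ex.Has.nat 2).mul (.reg (hxn a))).sub (.reg (hx a)))).ext e₁) (fun a => by simp) le_rfl)
    le_rfl fun u σ₂ e₂' hu => ?_
  have e₂ := e₁.trans e₂'
  refine .bind _ (Comp.Does.forFin (A * (S * 3)) (Q := fun i (r : Fin A → Fin S → Reg ι) σ' =>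
    ∀ a s, σ'.Holds (r a s) (P.centerY v' x' xn' y' i a s)) (fun i => stable_holds₂ _)
    (le_refl (N * (A * (S * 3)))) fun i σ' e => does_evalMat 3 (fun a s => Ex.Has.congr
      (((Ex.Has.reg (hy i a s)).ext (e₂.trans e)).add ((((Ex.Has.reg (hu a)).ext e).mul
      ((Ex.Has.reg (hv s)).ext (e₂.trans e))).div ((Ex.Has.reg hκ).ext (e₂'.trans e)))) (by
        rw [Model.centerY]; push_cast; rfl)) (fun a s => by simp) le_rfl) le_rfl fun w σ₃ e₃' hw => ?_
  have e₃ := e₂.trans e₃'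
  refine Ex.does_eval_bind (constrainedCost d j N A S) ((Ex.Has.nat _).mul
    ((has_budgetEx d hθ).ext e₃)) ?_ fun c σ₄ e₄' hc => ?_
  · have : (budgetEx d θ).size ≤ 1 := by cases d <;> simp [budgetEx]
    simp only [Ex.size_mul, Ex.size_nat]
    omega
  have e₄ := e₃.trans e₄'
  have hR := fun i a s' => P.abs_centerY_sub_le (v := v') (s := s) hN hA hx' hxn' hy' i a s'
  -- the error of the projection is an error of the proximal objective
  have hfinal : ∀ z u : Fin N → Fin A → Fin S → ℝ,
      (1 / 2) * ∑ i, sqDist (z i) (P.centerY v' x' xn' y' i) ≤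
        (1 / 2) * ∑ i, sqDist (u i) (P.centerY v' x' xn' y' i) +
          N * ((A * S * ((3 * A) ^ 2 + 1) + 1) * (1 / 2) ^ j) →
      P.proxObjY v' x' xn' y' z ≤ P.proxObjY v' x' xn' y' u + δ := by
    intro z u h
    by_cases h0 : P.invSigma v' = 0
    · rw [P.invSigma_eq_zero hN hA h0, P.proxObjY_of_zero, P.proxObjY_of_zero]
      linarith
    · rw [P.proxObjY_eq h0, P.proxObjY_eq h0]
      have := mul_le_mul_of_nonneg_left h (P.invSigma_nonneg v')
      rw [mul_add] at this
      linarith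
  cases b with
  | true =>
    have hp := hb.mp rfl
    subst hp
    simp only [cond_true, Nat.cast_one, one_mul] at hc
    simp only [cond_true]
    refine (Comp.Does.forFin (constrainedCost d j 1 A S)
      (Q := fun i (r : Fin A → Fin S → Reg ι) σ' => ∃ z : Fin A → Fin S → ℝ,
        (∀ a s, σ'.Holds (r a s) (z a s)) ∧ z ∈ U A S ∧
        d.penalty z (P.sample i s) ≤ d.budget P.radius ∧ ∀ u ∈ U A S,
        d.penalty u (P.sample i s) ≤ d.budget P.radius →
        (1 / 2) * sqDist z (P.centerY v' x' xn' y' i) ≤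
        (1 / 2) * sqDist u (P.centerY v' x' xn' y' i) +
          (A * S * ((3 * A) ^ 2 + 1) + 1) * (1 / 2) ^ j)
      (fun i r σ σ' e h => ?_) (le_of_eq ?_) fun i σ' e => ?_).mono le_rfl fun r σ' _ h => ?_
    · obtain ⟨z, h1, h2⟩ := h
      exact ⟨z, fun a s => (h1 a s).ext e, h2⟩
    · simp only [constrainedCost]; ring
    · refine .bind 0 (does_constrained d j Nat.one_pos hA hS (R := 3 * A)
        (fun _ a s => (hw i a s).ext (e₄'.trans e)) (fun _ a s => (hsample i a s).ext (e₄.trans e))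
        (hc.ext e) (fun _ => P.sample_mem i s) hbud (fun _ => hR i) hj) le_rfl
        fun z σ₅ e₅ hz => .ret ?_
      obtain ⟨z', hz', hz1, hz2, hz3⟩ := hz
      simp only [Fin.sum_univ_one, Nat.cast_one, one_mul] at hz2 hz3
      exact ⟨z' 0, hz' 0, hz1 0, hz2, fun u hu hu' => hz3 (fun _ => u) (fun _ => hu) hu'⟩
    · choose z hz hz1 hz2 hz3 using h
      refine ⟨z, hz, P.mem_feasible_top_iff.2 ⟨hz1, hz2⟩, fun u hu => hfinal z u ?_⟩
      obtain ⟨hu1, hu2⟩ := P.mem_feasible_top_iff.1 hu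
      have := Finset.sum_le_sum fun i (_ : i ∈ Finset.univ) => hz3 i (u i) (hu1 i) (hu2 i)
      simp only [Finset.sum_add_distrib, ← Finset.mul_sum, Finset.sum_const, Finset.card_univ,
        Fintype.card_fin, nsmul_eq_mul] at this
      linarith
  | false =>
    have hp : p ≠ ⊤ := fun h => by simpa using hb.mpr h
    simp only [cond_false] at hc
    simp only [cond_false]
    refine (does_constrained d j hN hA hS (R := 3 * A) (fun i a s => (hw i a s).ext e₄')
      (fun i a s => (hsample i a s).ext e₄) hc (fun i => P.sample_mem i s) (by positivity) hR
      hj).mono le_rfl fun r σ' _ ⟨z, hz, hz1, hz2, hz3⟩ => ?_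
    refine ⟨z, hz, (P.mem_feasible_iff hdp hp hN).2 ⟨hz1, hz2⟩, fun u hu => hfinal z u ?_⟩
    obtain ⟨hu1, hu2⟩ := (P.mem_feasible_iff hdp hp hN).1 hu
    exact hz3 u hu1 hu2

end programs

/-! ### The program -/

theorem epochStart_succ (l : ℕ) : epochStart (l + 1) = epochStart l + l ^ 2 :=
  Finset.sum_range_succ _ _

theorem epochStart_mono : Monotone epochStart :=
  monotone_nat_of_le_succ fun l => by rw [epochStart_succ]; exact Nat.le_add_right _ _

theorem epochStart_one : epochStart 1 = 0 := by simp [epochStart]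

/-- The names of the registers that hold the iterates. No iterate is ever overwritten. -/
structure Hist (N A S : ℕ) where
  x : ℕ → Fin S → Fin A → Reg (InVar N A S)
  y : ℕ → Fin S → Fin N → Fin A → Fin S → Reg (InVar N A S)
  v : ℕ → Fin S → Reg (InVar N A S)

namespace Hist

variable {N A S : ℕ}

/-- The policies in a given store. -/
def xv (h : Hist N A S) (σ : Store (InVar N A S)) (t : ℕ) : Fin S → Fin A → ℝ :=
  fun s a => σ.val (h.x t s a)

/-- The kernels in a given store. -/
def yv (h : Hist N A S) (σ : Store (InVar N A S)) (t : ℕ) : Fin S → Fin N → Fin A → Fin S → ℝ :=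
  fun s i a s' => σ.val (h.y t s i a s')

/-- The value vectors in a given store. -/
def vv (h : Hist N A S) (σ : Store (InVar N A S)) (l : ℕ) : Fin S → ℝ := fun s => σ.val (h.v l s)

/-- All iterates are in the registers of the start. -/
def start (N A S : ℕ) : Hist N A S where
  x _ s a := .inl (.x s a)
  y _ s i a s' := .inl (.y s i a s')
  v _ s := .inl (.v s)

/-- The history after the iterates of time `t` have been written. -/
def setXY (h : Hist N A S) (t : ℕ) (xn : Fin S → Fin A → Reg (InVar N A S))
    (yn : Fin S → Fin N → Fin A → Fin S → Reg (InVar N A S)) : Hist N A S where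
  x := Function.update h.x t xn
  y := Function.update h.y t yn
  v := h.v

/-- The history after the value vector of epoch `l` has been written. -/
def setV (h : Hist N A S) (l : ℕ) (vn : Fin S → Reg (InVar N A S)) : Hist N A S where
  x := h.x
  y := h.y
  v := Function.update h.v l vn

variable {h : Hist N A S} {t t' l l' : ℕ} {xn : Fin S → Fin A → Reg (InVar N A S)}
  {yn : Fin S → Fin N → Fin A → Fin S → Reg (InVar N A S)} {vn : Fin S → Reg (InVar N A S)}
  (σ : Store (InVar N A S))

theorem setXY_x_of_ne (ht : t' ≠ t) : (h.setXY t xn yn).x t' = h.x t' :=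
  Function.update_of_ne ht _ _

theorem setXY_y_of_ne (ht : t' ≠ t) : (h.setXY t xn yn).y t' = h.y t' :=
  Function.update_of_ne ht _ _

theorem setXY_x_self : (h.setXY t xn yn).x t = xn := Function.update_self _ _ _

theorem setXY_y_self : (h.setXY t xn yn).y t = yn := Function.update_self _ _ _

theorem setV_v_of_ne (hl : l' ≠ l) : (h.setV l vn).v l' = h.v l' := Function.update_of_ne hl _ _

theorem setV_v_self : (h.setV l vn).v l = vn := Function.update_self _ _ _

theorem xv_setXY_of_ne (ht : t' ≠ t) : (h.setXY t xn yn).xv σ t' = h.xv σ t' := by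
  unfold xv; rw [setXY_x_of_ne ht]

theorem yv_setXY_of_ne (ht : t' ≠ t) : (h.setXY t xn yn).yv σ t' = h.yv σ t' := by
  unfold yv; rw [setXY_y_of_ne ht]

theorem xv_setXY_self : (h.setXY t xn yn).xv σ t = fun s a => σ.val (xn s a) := by
  unfold xv; rw [setXY_x_self]

theorem yv_setXY_self : (h.setXY t xn yn).yv σ t = fun s i a s' => σ.val (yn s i a s') := by
  unfold yv; rw [setXY_y_self]

theorem vv_setXY : (h.setXY t xn yn).vv σ = h.vv σ := rfl

theorem xv_setV : (h.setV l vn).xv σ = h.xv σ := rfl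

theorem yv_setV : (h.setV l vn).yv σ = h.yv σ := rfl

theorem vv_setV_of_ne (hl : l' ≠ l) : (h.setV l vn).vv σ l' = h.vv σ l' := by
  unfold vv; rw [setV_v_of_ne hl]

theorem vv_setV_self : (h.setV l vn).vv σ l = fun s => σ.val (vn s) := by
  unfold vv; rw [setV_v_self]

end Hist

/-- The requirements of `IsRun` for one iteration. -/
def StepAt {N A S : ℕ} (P : Model N A S) (d : Metric) (p : ℝ≥0∞) (δ : ℝ) (v : Fin S → ℝ)
    (x : Fin S → Fin A → ℝ) (y : Fin S → Fin N → Fin A → Fin S → ℝ) (xn : Fin S → Fin A → ℝ)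
    (yn : Fin S → Fin N → Fin A → Fin S → ℝ) : Prop :=
  ∀ s, xn s ∈ stdSimplex ℝ (Fin A) ∧
    (∀ z ∈ stdSimplex ℝ (Fin A), P.proxObjX s v (y s) (x s) (xn s) ≤ P.proxObjX s v (y s) (x s) z) ∧
    yn s ∈ P.feasible d p s ∧
    ∀ z ∈ P.feasible d p s,
      P.proxObjY v (x s) (xn s) (y s) (yn s) ≤ P.proxObjY v (x s) (xn s) (y s) z + δ

/-- The requirement of `IsRun` for the update of the value vector. -/
def ValueAt {N A S : ℕ} (P : Model N A S) (l : ℕ) (x : ℕ → Fin S → Fin A → ℝ)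
    (y : ℕ → Fin S → Fin N → Fin A → Fin S → ℝ) (v : Fin S → ℝ) (vn : Fin S → ℝ) : Prop :=
  ∀ s, vn s = P.bellman s
    (fun a => linAvg (Finset.Ioc (epochStart l) (epochStart (l + 1))) (fun t => x t s a))
    (fun i a s' => linAvg (Finset.Ioc (epochStart l) (epochStart (l + 1)))
      (fun t => y t s i a s')) v

theorem linAvg_congr {I : Finset ℕ} {z z' : ℕ → ℝ} (h : ∀ t ∈ I, z t = z' t) :
    linAvg I z = linAvg I z' := by
  unfold linAvg
  congr 1
  exact Finset.sum_congr rfl fun t ht => by rw [h t ht]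

theorem ValueAt.congr {N A S : ℕ} {P : Model N A S} {l : ℕ} {x x' : ℕ → Fin S → Fin A → ℝ}
    {y y' : ℕ → Fin S → Fin N → Fin A → Fin S → ℝ} {v vn : Fin S → ℝ} (H : ValueAt P l x y v vn)
    (hx : ∀ t ∈ Finset.Ioc (epochStart l) (epochStart (l + 1)), x t = x' t)
    (hy : ∀ t ∈ Finset.Ioc (epochStart l) (epochStart (l + 1)), y t = y' t) :
    ValueAt P l x' y' v vn := by
  intro s
  rw [H s]
  congr 1
  · ext a
    exact linAvg_congr fun t ht => by rw [hx t ht]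
  · ext i a s'
    exact linAvg_congr fun t ht => by rw [hy t ht]

section programs

variable {N A S : ℕ}

/-- One iteration at time `t` of epoch `l`. -/
def iteration (d : Metric) (b : Bool) (j l t : ℕ) (h : Hist N A S) :
    Comp (InVar N A S) (Hist N A S) :=
  (Comp.forFin S fun s => stepX (.inl .disc) (fun a => .inl (.cost s a)) (h.v l) (h.y t s)
    (h.x t s)).bind fun xn =>
  (Comp.forFin S fun s => stepY d b j (.inl .disc) (.inl .radius) (h.v l) (h.x t s) (xn s)
    (h.y t s) (fun i a s' => .inl (.sample i s a s'))).bind fun yn =>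
  .ret (h.setXY (t + 1) xn yn)

/-- The weighted average of the registers of the times in `(a, b]`. -/
def avgEx {ι : Type} (a b : ℕ) (r : ℕ → Reg ι) : Ex ι :=
  (.sum fun i : Fin (b - a) => .nat (a + 1 + i) * .reg (r (a + 1 + i))) /
    .nat (∑ t ∈ Finset.Ioc a b, t)

theorem has_avgEx {ι : Type} {σ : Store ι} {a b : ℕ} {r : ℕ → Reg ι} {x : ℕ → ℝ}
    (h : ∀ t ∈ Finset.Ioc a b, σ.Holds (r t) (x t)) :
    (avgEx a b r).Has σ (linAvg (Finset.Ioc a b) x) := by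
  refine Ex.Has.congr ((Ex.Has.sum fun i : Fin (b - a) => (Ex.Has.nat (a + 1 + i)).mul
    (Ex.Has.reg (h (a + 1 + i) (by rw [Finset.mem_Ioc]; omega)))).div (.nat _)) ?_
  rw [linAvg, Nat.cast_sum]
  congr 1
  rw [Fin.sum_univ_eq_sum_range (fun i => ((a + 1 + i : ℕ) : ℝ) * x (a + 1 + i)) (b - a)]
  have : Finset.Ioc a b = Finset.Ico (a + 1) (b + 1) := by
    ext t
    simp only [Finset.mem_Ioc, Finset.mem_Ico]
    omega
  rw [this, Finset.sum_Ico_eq_sum_range, Nat.add_sub_add_right]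

theorem size_avgEx_le {ι : Type} (a b : ℕ) (r : ℕ → Reg ι) :
    (avgEx a b r).size ≤ 3 * (b - a) + 3 := by
  have := Ex.size_sum_le (t := 2) (f := fun i : Fin (b - a) => Ex.nat (a + 1 + i) *
    .reg (r (a + 1 + i))) fun i => by simp
  simp only [avgEx, Ex.size_div, Ex.size_nat]
  omega

/-- Averages of the policies and of the kernels over the times in `(a, b]`. -/
def averages (a b : ℕ) (h : Hist N A S) : Comp (InVar N A S) ((Fin S → Fin A → Reg (InVar N A S)) ×
    (Fin S → Fin N → Fin A → Fin S → Reg (InVar N A S))) :=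
  (evalMat fun s i => avgEx a b fun t => h.x t s i).bind fun x =>
  (Comp.forFin S fun s => Comp.forFin N fun i => evalMat fun e s' =>
    avgEx a b fun t => h.y t s i e s').bind fun y => .ret (x, y)

theorem does_averages (hN : 0 < N) (hS : 0 < S) {a b : ℕ} {h : Hist N A S}
    {σ : Store (InVar N A S)}
    (hx : ∀ t ∈ Finset.Ioc a b, ∀ s i, σ.Valid (h.x t s i))
    (hy : ∀ t ∈ Finset.Ioc a b, ∀ s i e s', σ.Valid (h.y t s i e s')) :
    (averages a b h).Does σ (6 * (S * (N * (A * S)) * (b - a + 1))) fun r σ' =>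
      (∀ s i, σ'.Holds (r.1 s i) (linAvg (Finset.Ioc a b) fun t => h.xv σ t s i)) ∧
      ∀ s i e s', σ'.Holds (r.2 s i e s') (linAvg (Finset.Ioc a b) fun t => h.yv σ t s i e s') := by
  refine .bind (3 * (S * (N * (A * S)) * (b - a + 1)))
    (does_evalMat (t' := 3 * (S * (N * (A * S)) * (b - a + 1))) (3 * (b - a) + 3)
    (fun s i => has_avgEx fun t ht => ⟨hx t ht s i, rfl⟩) (fun s i => size_avgEx_le _ _ _) ?_)
    (by omega) fun x σ₁ e₁ hx' => ?_
  · have : A ≤ N * (A * S) := by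
      calc A ≤ A * S := Nat.le_mul_of_pos_right _ hS
        _ ≤ _ := Nat.le_mul_of_pos_left _ hN
    calc S * (A * (3 * (b - a) + 3)) = S * A * (3 * (b - a) + 3) := by ring
      _ ≤ S * (N * (A * S)) * (3 * (b - a) + 3) := by gcongr
      _ = _ := by ring
  · refine .bind 0 (Comp.Does.forFin (N * (A * (S * (3 * (b - a) + 3))))
      (Q := fun s (r : Fin N → Fin A → Fin S → Reg (InVar N A S)) σ' =>
        ∀ i e s', σ'.Holds (r i e s') (linAvg (Finset.Ioc a b) fun t => h.yv σ t s i e s'))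
      (t' := 3 * (S * (N * (A * S)) * (b - a + 1)))
      (fun s r σ σ' e h i a s' => (h i a s').ext e) (le_of_eq (by ring)) fun s σ' e =>
      Comp.Does.forFin (A * (S * (3 * (b - a) + 3))) (fun i => stable_holds₂ _) le_rfl
        fun i σ'' e' => does_evalMat (3 * (b - a) + 3)
          (fun a s' => has_avgEx fun t ht =>
          Store.Holds.ext ⟨hy t ht s i a s', rfl⟩ (e₁.trans (e.trans e')))
          (fun a s' => size_avgEx_le _ _ _) le_rfl) le_rfl fun y σ₂ e₂ hy' => .ret
      ⟨fun s i => (hx' s i).ext e₂, hy'⟩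

/-- The update of the value vector after epoch `l`. -/
def valueUpdate (l : ℕ) (h : Hist N A S) : Comp (InVar N A S) (Hist N A S) :=
  (averages (epochStart l) (epochStart (l + 1)) h).bind fun r =>
  (evalVec fun s => .sum fun a => .reg (r.1 s a) * (.reg (.inl (.cost s a)) +
    .reg (.inl .disc) * .sum fun s' => ((.nat 1 / .nat N) * .sum fun i => .reg (r.2 s i a s')) *
      .reg (h.v l s'))).bind fun vn =>
  .ret (h.setV (l + 1) vn)

/-- One epoch. -/
def epoch (d : Metric) (b : Bool) (j l : ℕ) (h : Hist N A S) : Comp (InVar N A S) (Hist N A S) :=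
  (Comp.iter (fun m => iteration d b j l (epochStart l + m)) (l ^ 2) h).bind (valueUpdate l)

/-- The whole computation. -/
def algorithm (N A S : ℕ) (d : Metric) (b : Bool) (k j : ℕ) :
    Comp (InVar N A S) (OutVar N A S → Reg (InVar N A S)) :=
  (Comp.iter (fun m => epoch d b j (m + 1)) k (Hist.start N A S)).bind fun h =>
  (averages 0 (epochStart (k + 1)) h).bind fun r => .ret fun
    | .x s a => r.1 s a
    | .y s i a s' => r.2 s i a s'

/-- The state of the computation at time `t` of epoch `l`. The requirements for the registers are
meant for all later stores. -/
structure Inv {P : Model N A S} {d : Metric} {p : ℝ≥0∞} (I : Start P d p) (δ : ℝ) (l t : ℕ)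
    (h : Hist N A S) (σ : Store (InVar N A S)) : Prop where
  inp : ∀ i, σ.val (.inl i) = inputOf I i
  x_zero : h.x 0 = (Hist.start N A S).x 0
  y_zero : h.y 0 = (Hist.start N A S).y 0
  v_one : h.v 1 = (Hist.start N A S).v 1
  x_valid : ∀ t' ≤ t, ∀ s a, σ.Valid (h.x t' s a)
  y_valid : ∀ t' ≤ t, ∀ s i a s', σ.Valid (h.y t' s i a s')
  v_valid : ∀ l', 1 ≤ l' → l' ≤ l → ∀ s, σ.Valid (h.v l' s)
  x_mem : h.xv σ t ∈ P.policies
  y_mem : ∀ s, h.yv σ t s ∈ P.feasible d p s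
  step_old : ∀ l', 1 ≤ l' → l' < l → ∀ t' ∈ Finset.Ico (epochStart l') (epochStart (l' + 1)),
    ∀ σ', σ.Ext σ' → StepAt P d p δ (h.vv σ' l') (h.xv σ' t') (h.yv σ' t') (h.xv σ' (t' + 1))
      (h.yv σ' (t' + 1))
  step_new : ∀ t' ∈ Finset.Ico (epochStart l) t, ∀ σ', σ.Ext σ' →
    StepAt P d p δ (h.vv σ' l) (h.xv σ' t') (h.yv σ' t') (h.xv σ' (t' + 1)) (h.yv σ' (t' + 1))
  value : ∀ l', 1 ≤ l' → l' < l → ∀ σ', σ.Ext σ' →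
    ValueAt P l' (h.xv σ') (h.yv σ') (h.vv σ' l') (h.vv σ' (l' + 1))

theorem Inv.start {P : Model N A S} {d : Metric} {p : ℝ≥0∞} (I : Start P d p) (δ : ℝ) :
    Inv I δ 1 0 (Hist.start N A S) ⟨0, Sum.elim (inputOf I) fun _ => 0⟩ where
  inp _ := rfl
  x_zero := rfl
  y_zero := rfl
  v_one := rfl
  x_valid _ _ _ _ := trivial
  y_valid _ _ _ _ _ _ := trivial
  v_valid _ _ _ _ := trivial
  x_mem := I.x_mem
  y_mem := I.y_mem
  step_old l' h1 h2 := by omega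
  step_new t' ht := by simp at ht
  value l' h1 h2 := by omega

theorem Inv.ext {P : Model N A S} {d : Metric} {p : ℝ≥0∞} {I : Start P d p} {δ : ℝ} {l t : ℕ}
    {h : Hist N A S} {σ σ' : Store (InVar N A S)} (H : Inv I δ l t h σ) (e : σ.Ext σ') :
    Inv I δ l t h σ' where
  inp i := (e.2 (.inl i) trivial).trans (H.inp i)
  x_zero := H.x_zero
  y_zero := H.y_zero
  v_one := H.v_one
  x_valid t' ht s a := e.valid (H.x_valid t' ht s a)
  y_valid t' ht s i a s' := e.valid (H.y_valid t' ht s i a s')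
  v_valid l' h1 h2 s := e.valid (H.v_valid l' h1 h2 s)
  x_mem := by
    have : h.xv σ' t = h.xv σ t := by
      ext s a
      exact e.2 _ (H.x_valid t le_rfl s a)
    rw [this]; exact H.x_mem
  y_mem s := by
    have : h.yv σ' t s = h.yv σ t s := by
      ext i a s'
      exact e.2 _ (H.y_valid t le_rfl s i a s')
    rw [this]; exact H.y_mem s
  step_old l' h1 h2 t' ht σ'' e' := H.step_old l' h1 h2 t' ht σ'' (e.trans e')
  step_new t' ht σ'' e' := H.step_new t' ht σ'' (e.trans e')
  value l' h1 h2 σ'' e' := H.value l' h1 h2 σ'' (e.trans e')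

theorem Model.feasible_subset {P : Model N A S} {d : Metric} {p : ℝ≥0∞} {s : Fin S}
    {y : Fin N → Fin A → Fin S → ℝ} (h : y ∈ P.feasible d p s) (i : Fin N) : y i ∈ U A S := h.1 i

theorem does_iteration {P : Model N A S} {d : Metric} {p : ℝ≥0∞} {I : Start P d p}
    (hdp : Admissible d p) {b : Bool} (hb : b = true ↔ p = ⊤) {δ : ℝ} {j l t : ℕ} (hN : 0 < N)
    (hA : 0 < A) (hS : 0 < S) {h : Hist N A S} {σ : Store (InVar N A S)} (H : Inv I δ l t h σ)
    (hl : 1 ≤ l) (hlt : epochStart l ≤ t) (hj : (A : ℝ) * S * (3 * A) ≤ 2 ^ j)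
    (hδ : P.invSigma (h.vv σ l) * (N * ((A * S * ((3 * A) ^ 2 + 1) + 1) * (1 / 2) ^ j)) ≤ δ) :
    (iteration d b j l t h).Does σ (S * (stepXCost N A S + stepYCost d j N A S)) fun h' σ' =>
      Inv I δ l (t + 1) h' σ' ∧ h'.v = h.v := by
  have hin : ∀ i, σ.Holds (.inl i) (inputOf I i) := fun i => ⟨trivial, H.inp i⟩
  have hx : ∀ s a, σ.Holds (h.x t s a) (h.xv σ t s a) := fun s a => ⟨H.x_valid t le_rfl s a, rfl⟩
  have hy : ∀ s i a s', σ.Holds (h.y t s i a s') (h.yv σ t s i a s') := fun s i a s' =>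
    ⟨H.y_valid t le_rfl s i a s', rfl⟩
  have hv : ∀ s, σ.Holds (h.v l s) (h.vv σ l s) := fun s => ⟨H.v_valid l hl le_rfl s, rfl⟩
  refine .bind _ (Comp.Does.forFin (stepXCost N A S) (t' := S * stepXCost N A S)
    (Q := fun s (r : Fin A → Reg (InVar N A S)) σ' => ∃ z : Fin A → ℝ, (∀ a, σ'.Holds (r a) (z a)) ∧
      z ∈ stdSimplex ℝ (Fin A) ∧ ∀ u ∈ stdSimplex ℝ (Fin A),
      P.proxObjX s (h.vv σ l) (h.yv σ t s) (h.xv σ t s) z ≤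
        P.proxObjX s (h.vv σ l) (h.yv σ t s) (h.xv σ t s) u)
    (fun s r σ₁ σ₂ e hz => ?_) le_rfl fun s σ' e =>
    does_stepX P hN hA hS ((hin .disc).ext e) (fun a => (hin (.cost s a)).ext e)
      (fun s => (hv s).ext e) (fun i a s' => (hy s i a s').ext e) (fun a => (hx s a).ext e)
      (H.x_mem s)) (by rw [mul_add]) fun xn σ₁ e₁ hxn => ?_
  · obtain ⟨z, h1, h2⟩ := hz
    exact ⟨z, fun a => (h1 a).ext e, h2⟩
  choose xn' hxn1 hxn2 hxn3 using hxn
  refine .bind 0 (Comp.Does.forFin (stepYCost d j N A S)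
    (Q := fun s (r : Fin N → Fin A → Fin S → Reg (InVar N A S)) σ' =>
      ∃ z : Fin N → Fin A → Fin S → ℝ, (∀ i a s', σ'.Holds (r i a s') (z i a s')) ∧
      z ∈ P.feasible d p s ∧ ∀ u ∈ P.feasible d p s,
      P.proxObjY (h.vv σ l) (h.xv σ t s) (xn' s) (h.yv σ t s) z ≤
        P.proxObjY (h.vv σ l) (h.xv σ t s) (xn' s) (h.yv σ t s) u + δ)
    (fun s r σ₁ σ₂ e hz => ?_) le_rfl fun s σ' e =>
    have e' := e₁.trans e
    does_stepY P hdp hb j hN hA hS ((hin .disc).ext e') ((hin .radius).ext e')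
      (fun s => (hv s).ext e') (fun a => (hx s a).ext e') (fun a => (hxn1 s a).ext e)
      (fun i a s' => (hy s i a s').ext e') (fun i a s' => (hin (.sample i s a s')).ext e')
      (H.x_mem s) (hxn2 s) (fun i => Model.feasible_subset (H.y_mem s) i) hj hδ) le_rfl
    fun yn σ₂ e₂ hyn => .ret ?_
  · obtain ⟨z, h1, h2⟩ := hz
    exact ⟨z, fun i a s' => (h1 i a s').ext e, h2⟩
  choose yn' hyn1 hyn2 hyn3 using hyn
  have e := e₁.trans e₂
  replace H := H.ext e
  have ux : ∀ σ' : Store (InVar N A S), ∀ t' ≤ t, (h.setXY (t + 1) xn yn).xv σ' t' = h.xv σ' t' :=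
    fun σ' t' ht => Hist.xv_setXY_of_ne _ (by omega)
  have uy : ∀ σ' : Store (InVar N A S), ∀ t' ≤ t, (h.setXY (t + 1) xn yn).yv σ' t' = h.yv σ' t' :=
    fun σ' t' ht => Hist.yv_setXY_of_ne _ (by omega)
  have wx : ∀ σ', σ₂.Ext σ' → (h.setXY (t + 1) xn yn).xv σ' (t + 1) = xn' := fun σ' e' => by
    ext s a
    rw [Hist.xv_setXY_self]
    exact ((hxn1 s a).ext (e₂.trans e')).2
  have wy : ∀ σ', σ₂.Ext σ' → (h.setXY (t + 1) xn yn).yv σ' (t + 1) = yn' := fun σ' e' => by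
    ext s i a s'
    rw [Hist.yv_setXY_self]
    exact ((hyn1 s i a s').ext e').2
  refine ⟨⟨H.inp, (Hist.setXY_x_of_ne (by omega)).trans H.x_zero,
    (Hist.setXY_y_of_ne (by omega)).trans H.y_zero, H.v_one, fun t' ht s a => ?_,
    fun t' ht s i a s' => ?_, H.v_valid, ?_, ?_, ?_, ?_, ?_⟩, rfl⟩
  · rcases Nat.lt_or_eq_of_le ht with ht | rfl
    · rw [Hist.setXY_x_of_ne (by omega)]; exact H.x_valid t' (by omega) s a
    · rw [Hist.setXY_x_self]; exact ((hxn1 s a).ext e₂).1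
  · rcases Nat.lt_or_eq_of_le ht with ht | rfl
    · rw [Hist.setXY_y_of_ne (by omega)]; exact H.y_valid t' (by omega) s i a s'
    · rw [Hist.setXY_y_self]; exact (hyn1 s i a s').1
  · rw [wx σ₂ (.refl _)]; exact hxn2
  · rw [wy σ₂ (.refl _)]; exact hyn2
  · intro l' h1 h2 t' ht σ' e'
    have htt : t' + 1 ≤ t := by
      have := epochStart_mono (show l' + 1 ≤ l by omega)
      rw [Finset.mem_Ico] at ht
      omega
    rw [ux _ _ (by omega), uy _ _ (by omega), ux _ _ htt, uy _ _ htt]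
    exact H.step_old l' h1 h2 t' ht σ' e'
  · intro t' ht σ' e'
    rw [Finset.mem_Ico] at ht
    rcases Nat.lt_or_eq_of_le (Nat.lt_succ_iff.mp ht.2) with ht' | rfl
    · rw [ux _ _ (by omega), uy _ _ (by omega), ux _ _ ht', uy _ _ ht']
      exact H.step_new t' (Finset.mem_Ico.2 ⟨ht.1, ht'⟩) σ' e'
    · have m1 : h.xv σ' t' = h.xv σ t' := by
        ext s a; exact ((hx s a).ext (e.trans e')).2
      have m2 : h.yv σ' t' = h.yv σ t' := by
        ext s i a s'; exact ((hy s i a s').ext (e.trans e')).2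
      have m3 : h.vv σ' l = h.vv σ l := by
        ext s; exact ((hv s).ext (e.trans e')).2
      rw [ux _ _ le_rfl, uy _ _ le_rfl, wx σ' e', wy σ' e', Hist.vv_setXY, m1, m2, m3]
      exact fun s => ⟨hxn2 s, hxn3 s, hyn2 s, hyn3 s⟩
  · intro l' h1 h2 σ' e'
    have hu : ∀ t' ∈ Finset.Ioc (epochStart l') (epochStart (l' + 1)), t' ≤ t := fun t' ht => by
      have := epochStart_mono (show l' + 1 ≤ l by omega)
      rw [Finset.mem_Ioc] at ht
      omega
    exact (H.value l' h1 h2 σ' e').congr (fun t' ht => (ux σ' t' (hu t' ht)).symm)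
      fun t' ht => (uy σ' t' (hu t' ht)).symm

end programs

/-! ### Weighted averages -/

theorem linAvg_eq_sum (I : Finset ℕ) (z : ℕ → ℝ) :
    linAvg I z = ∑ t ∈ I, ((t : ℝ) / ∑ t ∈ I, (t : ℝ)) * z t := by
  rw [linAvg, Finset.sum_div]
  exact Finset.sum_congr rfl fun t _ => by ring

theorem sum_Ioc_pos {a b : ℕ} (h : a < b) : 0 < ∑ t ∈ Finset.Ioc a b, (t : ℝ) := by
  refine Finset.sum_pos (fun t ht => ?_) ⟨b, by simpa using h⟩
  rw [Finset.mem_Ioc] at ht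
  exact_mod_cast (Nat.zero_le a).trans_lt ht.1

theorem sum_weights_eq_one {a b : ℕ} (h : a < b) :
    ∑ t ∈ Finset.Ioc a b, ((t : ℝ) / ∑ t ∈ Finset.Ioc a b, (t : ℝ)) = 1 := by
  rw [← Finset.sum_div, div_self (sum_Ioc_pos h).ne']

theorem weight_nonneg {I : Finset ℕ} (t : ℕ) : 0 ≤ (t : ℝ) / ∑ t ∈ I, (t : ℝ) :=
  div_nonneg (Nat.cast_nonneg _) (Finset.sum_nonneg fun _ _ => Nat.cast_nonneg _)

theorem linAvg_eq_sum₁ (I : Finset ℕ) {n : ℕ} (x : ℕ → Fin n → ℝ) :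
    (fun i => linAvg I fun t => x t i) = ∑ t ∈ I, ((t : ℝ) / ∑ t ∈ I, (t : ℝ)) • x t := by
  ext i
  simp [linAvg_eq_sum, Finset.sum_apply]

theorem linAvg_eq_sum₃ (I : Finset ℕ) {n A S : ℕ} (y : ℕ → Fin n → Fin A → Fin S → ℝ) :
    (fun i a s' => linAvg I fun t => y t i a s') =
      ∑ t ∈ I, ((t : ℝ) / ∑ t ∈ I, (t : ℝ)) • y t := by
  ext i a s'
  simp [linAvg_eq_sum, Finset.sum_apply]

theorem linAvg_mem₁ {n : ℕ} {K : Set (Fin n → ℝ)} (hK : Convex ℝ K) {a b : ℕ} (h : a < b)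
    {x : ℕ → Fin n → ℝ} (hx : ∀ t ∈ Finset.Ioc a b, x t ∈ K) :
    (fun i => linAvg (Finset.Ioc a b) fun t => x t i) ∈ K := by
  rw [linAvg_eq_sum₁]
  exact hK.sum_mem (fun t _ => weight_nonneg t) (sum_weights_eq_one h) hx

theorem linAvg_mem₃ {n A S : ℕ} {K : Set (Fin n → Fin A → Fin S → ℝ)} (hK : Convex ℝ K)
    {a b : ℕ} (h : a < b) {y : ℕ → Fin n → Fin A → Fin S → ℝ}
    (hy : ∀ t ∈ Finset.Ioc a b, y t ∈ K) :
    (fun i e s' => linAvg (Finset.Ioc a b) fun t => y t i e s') ∈ K := by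
  rw [linAvg_eq_sum₃]
  exact hK.sum_mem (fun t _ => weight_nonneg t) (sum_weights_eq_one h) hy

theorem linAvg_mem_stdSimplex {n : ℕ} {a b : ℕ} (h : a < b) {x : ℕ → Fin n → ℝ}
    (hx : ∀ t ∈ Finset.Ioc a b, x t ∈ stdSimplex ℝ (Fin n)) :
    (fun i => linAvg (Finset.Ioc a b) fun t => x t i) ∈ stdSimplex ℝ (Fin n) :=
  linAvg_mem₁ (convex_stdSimplex ℝ _) h hx

theorem linAvg_mem_U {A S : ℕ} {a b : ℕ} (h : a < b) {y : ℕ → Fin A → Fin S → ℝ}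
    (hy : ∀ t ∈ Finset.Ioc a b, y t ∈ U A S) :
    (fun e s' => linAvg (Finset.Ioc a b) fun t => y t e s') ∈ U A S := fun e =>
  linAvg_mem_stdSimplex h fun t ht => hy t ht e

/-! ### Bounds for the value vectors -/

theorem abs_sum_simplex_le {n : ℕ} {x : Fin n → ℝ} (hx : x ∈ stdSimplex ℝ (Fin n)) {r : Fin n → ℝ}
    {K : ℝ} (hr : ∀ i, |r i| ≤ K) : |∑ i, x i * r i| ≤ K := by
  calc |∑ i, x i * r i| ≤ ∑ i, |x i * r i| := Finset.abs_sum_le_sum_abs _ _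
    _ ≤ ∑ i, x i * K := Finset.sum_le_sum fun i _ => by
        rw [abs_mul, abs_of_nonneg (hx.1 i)]
        exact mul_le_mul_of_nonneg_left (hr i) (hx.1 i)
    _ = K := by rw [← Finset.sum_mul, hx.2, one_mul]

/-- The mean of the kernels `y i`. -/
def meanKernel {N A S : ℕ} (y : Fin N → Fin A → Fin S → ℝ) : Fin A → Fin S → ℝ :=
  fun a s' => (1 / (N : ℝ)) * ∑ i, y i a s'

theorem meanKernel_mem {N A S : ℕ} (hN : 0 < N) {y : Fin N → Fin A → Fin S → ℝ}
    (hy : ∀ i, y i ∈ U A S) : meanKernel y ∈ U A S := fun a => by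
  have hN' : (0 : ℝ) < N := by exact_mod_cast hN
  refine ⟨fun s' => mul_nonneg (by positivity) (Finset.sum_nonneg fun i _ => (hy i a).1 s'), ?_⟩
  simp only [meanKernel]
  rw [← Finset.mul_sum, Finset.sum_comm, Finset.sum_congr rfl fun i _ => (hy i a).2]
  simp [hN'.ne']

namespace Model

variable {N A S : ℕ} (P : Model N A S)

theorem abs_bellman_le (hN : 0 < N) {s : Fin S} {x : Fin A → ℝ} (hx : x ∈ stdSimplex ℝ (Fin A))
    {y : Fin N → Fin A → Fin S → ℝ} (hy : ∀ i, y i ∈ U A S) {v : Fin S → ℝ} {M V : ℝ}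
    (hc : ∀ s a, |P.cost s a| ≤ M) (hv : ∀ s, |v s| ≤ V) :
    |P.bellman s x y v| ≤ M + P.disc * V := by
  refine abs_sum_simplex_le hx fun a => (abs_add_le _ _).trans (add_le_add (hc s a) ?_)
  rw [abs_mul, abs_of_pos P.disc_pos]
  exact mul_le_mul_of_nonneg_left (abs_sum_simplex_le (meanKernel_mem hN hy a) hv) P.disc_pos.le

theorem l2norm_le {v : Fin S → ℝ} {V : ℝ} (hV : 0 ≤ V) (hv : ∀ s, |v s| ≤ V) :
    l2norm v ≤ √S * V := by
  rw [l2norm]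
  refine Real.sqrt_le_iff.2 ⟨by positivity, ?_⟩
  calc ∑ s, v s ^ 2 ≤ ∑ _s : Fin S, V ^ 2 := Finset.sum_le_sum fun s _ => by
        rw [← sq_abs]
        exact pow_le_pow_left₀ (abs_nonneg _) (hv s) 2
    _ = (√S * V) ^ 2 := by rw [mul_pow, Real.sq_sqrt (Nat.cast_nonneg _)]; simp

end Model

/-! ### Correctness and cost of the program -/

section program

variable {N A S : ℕ} {P : Model N A S} {d : Metric} {p : ℝ≥0∞} {I : Start P d p}

theorem does_valueUpdate {δ V : ℝ} {l : ℕ} (hN : 0 < N) (hA : 0 < A) (hS : 0 < S)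
    {h : Hist N A S} {σ : Store (InVar N A S)} (H : Inv I δ l (epochStart (l + 1)) h σ)
    (hl : 1 ≤ l) (hV : ∀ v : Fin S → ℝ, (∀ s, |v s| ≤ V) → ∀ s, ∀ x ∈ stdSimplex ℝ (Fin A),
      ∀ y : Fin N → Fin A → Fin S → ℝ, (∀ i, y i ∈ U A S) → |P.bellman s x y v| ≤ V)
    (hv : ∀ s, |h.vv σ l s| ≤ V) :
    (valueUpdate l h).Does σ (32 * (l ^ 2 * (S * (N * (A * S))))) fun h' σ' =>
      Inv I δ (l + 1) (epochStart (l + 1)) h' σ' ∧ ∀ s, |h'.vv σ' (l + 1) s| ≤ V := by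
  have hlt : epochStart l < epochStart (l + 1) := by
    rw [epochStart_succ]
    exact Nat.lt_add_of_pos_right (by positivity)
  have hin : ∀ i, σ.Holds (.inl i) (inputOf I i) := fun i => ⟨trivial, H.inp i⟩
  have hvl : ∀ s, σ.Holds (h.v l s) (h.vv σ l s) := fun s => ⟨H.v_valid l hl le_rfl s, rfl⟩
  have hcost : 1 ≤ l ^ 2 * (S * (N * (A * S))) := Nat.succ_le_of_lt (by positivity)
  have hcost' : S * (N * (A * S)) ≤ l ^ 2 * (S * (N * (A * S))) :=
    Nat.le_mul_of_pos_left _ (by positivity)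
  refine .bind (20 * (S * (N * (A * S)))) (does_averages hN hS
    (fun t ht s a => H.x_valid t (Finset.mem_Ioc.1 ht).2 s a)
    (fun t ht s i a s' => H.y_valid t (Finset.mem_Ioc.1 ht).2 s i a s')) ?_
    fun r σ₁ e₁ hr => ?_
  · rw [epochStart_succ, Nat.add_sub_cancel_left,
      show S * (N * (A * S)) * (l ^ 2 + 1) = l ^ 2 * (S * (N * (A * S))) + S * (N * (A * S)) by ring]
    omega
  set X : Fin S → Fin A → ℝ := fun s a =>
    linAvg (Finset.Ioc (epochStart l) (epochStart (l + 1))) fun t => h.xv σ t s a with hX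
  set Y : Fin S → Fin N → Fin A → Fin S → ℝ := fun s i a s' =>
    linAvg (Finset.Ioc (epochStart l) (epochStart (l + 1))) fun t => h.yv σ t s i a s' with hY
  refine .bind 0 (does_evalVec (t' := 20 * (S * (N * (A * S)))) (x := fun s => P.bellman s (X s) (Y s) (h.vv σ l))
    (20 * (N * (A * S))) (fun s => ?_) (fun s => ?_) (le_of_eq (by ring))) le_rfl
    fun vn σ₂ e₂ hvn => .ret ?_
  · refine Ex.Has.congr (Ex.Has.sum fun a => (Ex.Has.reg (hr.1 s a)).mul
      ((Ex.Has.reg ((hin (.cost s a)).ext e₁)).add ((Ex.Has.reg ((hin .disc).ext e₁)).mul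
        (Ex.Has.sum fun s' => (((Ex.Has.nat 1).div (Ex.Has.nat N)).mul
          (Ex.Has.sum fun i => Ex.Has.reg (hr.2 s i a s'))).mul
            (Ex.Has.reg ((hvl s').ext e₁)))))) ?_
    simp only [Nat.cast_one, inputOf, Model.bellman, hX, hY]
  · have hNS : N ≤ N * S ∧ S ≤ N * S ∧ 1 ≤ N * S := ⟨Nat.le_mul_of_pos_right _ hS,
      Nat.le_mul_of_pos_left _ hN, Nat.succ_le_of_lt (by positivity)⟩
    have hNAS : 1 ≤ N * (A * S) := Nat.succ_le_of_lt (by positivity)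
    refine (Ex.size_sum_le (t := 12 * (N * S)) fun a => ?_).trans ?_
    · have h1 := Ex.size_sum_le (t := N + 6) (f := fun s' : Fin S => ((.nat 1 / .nat N) *
        .sum fun i => .reg (r.2 s i a s')) * .reg (h.v l s')) fun s' => by
          have := Ex.size_sum_le (t := 0) (f := fun i : Fin N => .reg (r.2 s i a s'))
            fun i => by simp
          simp only [Ex.size_mul, Ex.size_div, Ex.size_nat, Ex.size_reg]
          omega
      rw [show S * (N + 6 + 1) = N * S + 7 * S by ring] at h1
      simp only [Ex.size_mul, Ex.size_add, Ex.size_reg]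
      omega
    · calc A * (12 * (N * S) + 1) + 1 ≤ A * (12 * (N * S) + N * S) + N * (A * S) := by
            (gcongr; omega)
        _ = 14 * (N * (A * S)) := by ring
        _ ≤ 20 * (N * (A * S)) := by omega
  have e := e₁.trans e₂
  have m1 : ∀ σ', σ₂.Ext σ' → ∀ t ∈ Finset.Ioc (epochStart l) (epochStart (l + 1)),
      h.xv σ t = h.xv σ' t := fun σ' e' t ht => by
    ext s a
    exact ((e.trans e').2 _ (H.x_valid t (Finset.mem_Ioc.1 ht).2 s a)).symm
  have m2 : ∀ σ', σ₂.Ext σ' → ∀ t ∈ Finset.Ioc (epochStart l) (epochStart (l + 1)),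
      h.yv σ t = h.yv σ' t := fun σ' e' t ht => by
    ext s i a s'
    exact ((e.trans e').2 _ (H.y_valid t (Finset.mem_Ioc.1 ht).2 s i a s')).symm
  have m3 : ∀ σ', σ₂.Ext σ' → (h.setV (l + 1) vn).vv σ' (l + 1) =
      fun s => P.bellman s (X s) (Y s) (h.vv σ l) := fun σ' e' => by
    rw [Hist.vv_setV_self]
    ext s
    exact ((hvn s).ext e').2
  have m4 : ∀ σ', σ₂.Ext σ' → h.vv σ l = h.vv σ' l := fun σ' e' => by
    ext s
    exact ((hvl s).ext (e.trans e')).2.symm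
  have hXm : ∀ t ∈ Finset.Ioc (epochStart l) (epochStart (l + 1)), ∀ s,
      h.xv σ t s ∈ stdSimplex ℝ (Fin A) ∧ h.yv σ t s ∈ P.feasible d p s := fun t ht s => by
    rw [Finset.mem_Ioc] at ht
    obtain ⟨t, rfl⟩ : ∃ t', t = t' + 1 := ⟨t - 1, by omega⟩
    have := H.step_new t (Finset.mem_Ico.2 ⟨by omega, by omega⟩) σ (.refl _) s
    exact ⟨this.1, this.2.2.1⟩
  replace H := H.ext e
  have hne : ∀ l' ≤ l, ∀ σ', (h.setV (l + 1) vn).vv σ' l' = h.vv σ' l' := fun l' hl' σ' =>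
    Hist.vv_setV_of_ne _ (by omega)
  refine ⟨⟨H.inp, H.x_zero, H.y_zero, (Hist.setV_v_of_ne (by omega)).trans H.v_one, H.x_valid,
    H.y_valid, fun l' h1 h2 s => ?_, H.x_mem, H.y_mem, fun l' h1 h2 t ht σ' e' => ?_,
    fun t ht => ?_, fun l' h1 h2 σ' e' => ?_⟩, fun s => ?_⟩
  · rcases Nat.lt_or_eq_of_le h2 with h2 | rfl
    · rw [Hist.setV_v_of_ne (by omega)]; exact H.v_valid l' h1 (by omega) s
    · rw [Hist.setV_v_self]; exact (hvn s).1
  · rw [hne l' (by omega), Hist.xv_setV, Hist.yv_setV]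
    rcases Nat.lt_or_eq_of_le (Nat.lt_succ_iff.1 h2) with h2 | rfl
    · exact H.step_old l' h1 h2 t ht σ' e'
    · exact H.step_new t ht σ' e'
  · simp at ht
  · rw [hne l' (by omega), Hist.xv_setV, Hist.yv_setV]
    rcases Nat.lt_or_eq_of_le (Nat.lt_succ_iff.1 h2) with h2 | rfl
    · rw [hne (l' + 1) (by omega)]
      exact H.value l' h1 h2 σ' e'
    · rw [m3 σ' e', ← m4 σ' e']
      exact ValueAt.congr (fun s => rfl) (m1 σ' e') (m2 σ' e')
  · rw [m3 σ₂ (.refl _)]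
    exact hV _ hv s _ (linAvg_mem_stdSimplex hlt fun t ht => (hXm t ht s).1) _ fun i =>
      linAvg_mem_U hlt fun t ht => (hXm t ht s).2.1 i

/-- The cost of an iteration. -/
def iterationCost (d : Metric) (j N A S : ℕ) : ℕ := S * (stepXCost N A S + stepYCost d j N A S)

theorem does_epoch (hdp : Admissible d p) {b : Bool} (hb : b = true ↔ p = ⊤) {δ V : ℝ} {j l : ℕ}
    (hN : 0 < N) (hA : 0 < A) (hS : 0 < S) {h : Hist N A S} {σ : Store (InVar N A S)}
    (H : Inv I δ l (epochStart l) h σ) (hl : 1 ≤ l) (hj : (A : ℝ) * S * (3 * A) ≤ 2 ^ j)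
    (hV : ∀ v : Fin S → ℝ, (∀ s, |v s| ≤ V) → ∀ s, ∀ x ∈ stdSimplex ℝ (Fin A),
      ∀ y : Fin N → Fin A → Fin S → ℝ, (∀ i, y i ∈ U A S) → |P.bellman s x y v| ≤ V)
    (hδ : ∀ v : Fin S → ℝ, (∀ s, |v s| ≤ V) →
      P.invSigma v * (N * ((A * S * ((3 * A) ^ 2 + 1) + 1) * (1 / 2) ^ j)) ≤ δ)
    (hv : ∀ s, |h.vv σ l s| ≤ V) :
    (epoch d b j l h).Does σ (l ^ 2 * (iterationCost d j N A S + 32 * (S * (N * (A * S)))))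
      fun h' σ' => Inv I δ (l + 1) (epochStart (l + 1)) h' σ' ∧ ∀ s, |h'.vv σ' (l + 1) s| ≤ V := by
  refine .bind _ (Comp.Does.iter (iterationCost d j N A S) (Q := fun m (h' : Hist N A S) σ' =>
    Inv I δ l (epochStart l + m) h' σ' ∧ ∀ s, |h'.vv σ' l s| ≤ V) le_rfl ⟨H, hv⟩
    fun m hm h' σ' e H' => ?_) (le_of_eq (by ring)) fun h' σ' e H' =>
      does_valueUpdate hN hA hS (by rw [epochStart_succ]; exact H'.1) hl hV H'.2
  refine (does_iteration hdp hb hN hA hS H'.1 hl (Nat.le_add_right _ _) hj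
    (hδ _ H'.2)).mono le_rfl fun h'' σ'' e'' H'' => ⟨H''.1, fun s => ?_⟩
  have : h''.vv σ'' l s = h'.vv σ' l s := by
    rw [Hist.vv, H''.2]
    exact e''.2 _ (H'.1.v_valid l hl le_rfl s)
  rw [this]
  exact H'.2 s

theorem epochStart_le (k : ℕ) : epochStart (k + 1) ≤ k ^ 3 := by
  induction k with
  | zero => simp [epochStart]
  | succ k ih =>
    rw [epochStart_succ]
    nlinarith

/-- Execution of the program: its outputs are those of a run, and the number of operations is
bounded by the number of iterations times the cost of one. -/
theorem does_algorithm (hdp : Admissible d p) {b : Bool} (hb : b = true ↔ p = ⊤) {δ V : ℝ}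
    {j k : ℕ} (hN : 0 < N) (hA : 0 < A) (hS : 0 < S) (hk : 1 ≤ k)
    (hj : (A : ℝ) * S * (3 * A) ≤ 2 ^ j)
    (hV : ∀ v : Fin S → ℝ, (∀ s, |v s| ≤ V) → ∀ s, ∀ x ∈ stdSimplex ℝ (Fin A),
      ∀ y : Fin N → Fin A → Fin S → ℝ, (∀ i, y i ∈ U A S) → |P.bellman s x y v| ≤ V)
    (hδ : ∀ v : Fin S → ℝ, (∀ s, |v s| ≤ V) →
      P.invSigma v * (N * ((A * S * ((3 * A) ^ 2 + 1) + 1) * (1 / 2) ^ j)) ≤ δ)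
    (hv : ∀ s, |I.v s| ≤ V) :
    (algorithm N A S d b k j).Does ⟨0, Sum.elim (inputOf I) fun _ => 0⟩
      (k ^ 3 * (iterationCost d j N A S + 44 * (S * (N * (A * S))))) fun out σ =>
        ∃ x y v, IsRun P d p I k δ x y v ∧ (∀ s a, σ.val (out (.x s a)) = outputX k x s a) ∧
          ∀ s i a s', σ.val (out (.y s i a s')) = outputY k y s i a s' := by
  set B := S * (N * (A * S)) with hB
  refine .bind (12 * (k ^ 3 * B)) (Comp.Does.iter
    (k ^ 2 * (iterationCost d j N A S + 32 * B)) (t' := k ^ 3 * (iterationCost d j N A S + 32 * B))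
    (Q := fun m (h : Hist N A S) σ =>
    Inv I δ (m + 1) (epochStart (m + 1)) h σ ∧ ∀ s, |h.vv σ (m + 1) s| ≤ V) (le_of_eq (by ring))
    ⟨by rw [epochStart_one]; exact Inv.start I δ, hv⟩ fun m hm h σ e H => ?_)
    (le_of_eq (by ring)) fun h σ e H => ?_
  · refine (does_epoch hdp hb hN hA hS H.1 (Nat.le_add_left _ _) hj hV hδ H.2).mono ?_
      fun _ _ _ h => h
    exact Nat.mul_le_mul_right _ (Nat.pow_le_pow_left hm 2)
  · obtain ⟨H, -⟩ := H
    refine .bind 0 (does_averages hN hS (fun t ht s a => H.x_valid t (Finset.mem_Ioc.1 ht).2 s a)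
      (fun t ht s i a s' => H.y_valid t (Finset.mem_Ioc.1 ht).2 s i a s')) ?_
      fun r σ₁ e₁ hr => .ret ?_
    · have h1 := epochStart_le k
      have h2 : 1 ≤ k ^ 3 := Nat.one_le_pow _ _ hk
      calc 6 * (B * (epochStart (k + 1) - 0 + 1)) + 0 ≤ 6 * (B * (k ^ 3 + k ^ 3)) := by
            rw [Nat.sub_zero, Nat.add_zero]; gcongr
        _ = _ := by ring
    · have hs : ∀ l ∈ Finset.Icc 1 k, ∀ t ∈ Finset.Ico (epochStart l) (epochStart (l + 1)),
        StepAt P d p δ (h.vv σ l) (h.xv σ t) (h.yv σ t) (h.xv σ (t + 1)) (h.yv σ (t + 1)) :=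
        fun l hl t ht => by
          rw [Finset.mem_Icc] at hl
          exact H.step_old l hl.1 (by omega) t ht σ (.refl _)
      refine ⟨h.xv σ, h.yv σ, h.vv σ, ⟨?_, ?_, ?_, fun l hl t ht s => (hs l hl t ht s).1,
        fun l hl t ht s => (hs l hl t ht s).2.1, fun l hl t ht s => (hs l hl t ht s).2.2.1,
        fun l hl t ht s => (hs l hl t ht s).2.2.2, fun l hl => ?_⟩, fun s a => (hr.1 s a).2,
        fun s i a s' => (hr.2 s i a s').2⟩
      · ext s a
        rw [Hist.xv, H.x_zero]
        exact H.inp (.x s a)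
      · ext s i a s'
        rw [Hist.yv, H.y_zero]
        exact H.inp (.y s i a s')
      · ext s
        rw [Hist.vv, H.v_one]
        exact H.inp (.v s)
      · rw [Finset.mem_Icc] at hl
        exact H.value l hl.1 (by omega) σ (.refl _)

/-- The program, as an algebraic computation tree. The flag `b` says whether the type of the
Wasserstein distance is `∞`, `k` is the number of epochs and `j` the depth of the searches for
Lagrange multipliers and radii. -/
def program (N A S : ℕ) (d : Metric) (b : Bool) (k j : ℕ) :
    ArithProg (InVar N A S) (OutVar N A S) := (algorithm N A S d b k j).compile 0

theorem program_spec (hdp : Admissible d p) {b : Bool} (hb : b = true ↔ p = ⊤) {δ V : ℝ}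
    {j k : ℕ} (hN : 0 < N) (hA : 0 < A) (hS : 0 < S) (hk : 1 ≤ k)
    (hj : (A : ℝ) * S * (3 * A) ≤ 2 ^ j)
    (hV : ∀ v : Fin S → ℝ, (∀ s, |v s| ≤ V) → ∀ s, ∀ x ∈ stdSimplex ℝ (Fin A),
      ∀ y : Fin N → Fin A → Fin S → ℝ, (∀ i, y i ∈ U A S) → |P.bellman s x y v| ≤ V)
    (hδ : ∀ v : Fin S → ℝ, (∀ s, |v s| ≤ V) →
      P.invSigma v * (N * ((A * S * ((3 * A) ^ 2 + 1) + 1) * (1 / 2) ^ j)) ≤ δ)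
    (hv : ∀ s, |I.v s| ≤ V) :
    Computes (program N A S d b k j) I k δ ∧ (program N A S d b k j).numOps (inputOf I) ≤
      k ^ 3 * (iterationCost d j N A S + 44 * (S * (N * (A * S)))) := by
  obtain ⟨-, h2, h3⟩ := does_algorithm (I := I) hdp hb hN hA hS hk hj hV hδ hv
  have key := Comp.exec_compile (algorithm N A S d b k j) ⟨0, Sum.elim (inputOf I) fun _ => 0⟩
  constructor
  · unfold Computes ArithProg.result program
    rw [key]
    exact h3
  · unfold ArithProg.numOps program
    rw [key]
    exact h2

end program

/-! ### The primal-dual iteration -/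

section abstract

variable {E F : Type*} [AddCommGroup E] [Module ℝ E] [AddCommGroup F] [Module ℝ F]

/-- The three-point inequality for an approximate proximal step: compare with a point at
fraction `r` of the way from `p` to `z`. -/
theorem prox_inequality {K : Set E} (hK : Convex ℝ K) (g : E →ₗ[ℝ] ℝ) (q : E →ₗ[ℝ] E →ₗ[ℝ] ℝ)
    (hq : ∀ a b, q a b = q b a) {b δ r : ℝ} {u p z : E} (hp : p ∈ K) (hz : z ∈ K)
    (h : ∀ w ∈ K, g p + b / 2 * q (p - u) (p - u) ≤ g w + b / 2 * q (w - u) (w - u) + δ)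
    (h0 : 0 < r) (h1 : r ≤ 1) :
    g p - g z ≤ b / 2 * (q (z - u) (z - u) - q (z - p) (z - p) - q (p - u) (p - u)) + δ / r +
      r * (b / 2 * q (z - p) (z - p)) := by
  have hw := h _ (hK.add_smul_sub_mem hp hz ⟨h0.le, h1⟩)
  rw [show p + r • (z - p) - u = (p - u) + r • (z - p) by abel] at hw
  have e : q (z - u) (z - u) = q (z - p) (z - p) + 2 * q (z - p) (p - u) + q (p - u) (p - u) := by
    rw [show z - u = (z - p) + (p - u) by abel, map_add, map_add, LinearMap.add_apply,
      LinearMap.add_apply, hq (p - u) (z - p)]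
    ring
  simp only [map_add, map_smul, LinearMap.add_apply, LinearMap.smul_apply, smul_eq_mul,
    hq (p - u) (z - p), map_sub g z p] at hw
  have key : (g p - g z) * r ≤ (b / 2 * (2 * q (z - p) (p - u)) +
      r * (b / 2 * q (z - p) (z - p))) * r + δ := by linarith
  have := (le_div_iff₀ h0).2 key
  rw [add_div, mul_div_cancel_right₀ _ h0.ne'] at this
  rw [e]
  linarith

/-- One step of the primal-dual method for the saddle function `c x + B x y`, with proximal terms
`β/2 ‖·‖²` and `κ/2 ‖·‖²` that dominate the coupling `B`: the gap against `(z, w)` is paid for by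
the decrease of the potential. -/
theorem saddle_step {K : Set E} {L : Set F} (hK : Convex ℝ K) (hL : Convex ℝ L) (c : E →ₗ[ℝ] ℝ)
    (B : E →ₗ[ℝ] F →ₗ[ℝ] ℝ) (q : E →ₗ[ℝ] E →ₗ[ℝ] ℝ) (r : F →ₗ[ℝ] F →ₗ[ℝ] ℝ)
    (hq : ∀ a b, q a b = q b a) (hr : ∀ a b, r a b = r b a) {β κ δ Q R : ℝ} (hβ : 0 ≤ β)
    (hκ : 0 ≤ κ)
    (hB : ∀ a b, B a b ≤ β / 2 * q a a + κ / 2 * r b b) (hQ : ∀ a ∈ K, ∀ b ∈ K, q (a - b) (a - b) ≤ Q)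
    (hR : ∀ a ∈ L, ∀ b ∈ L, r (a - b) (a - b) ≤ R) {x xn z : E} {y yn w : F} (hxn : xn ∈ K)
    (hz : z ∈ K) (hyn : yn ∈ L) (hw : w ∈ L) (h0 : 0 < δ) (h1 : δ ≤ 1)
    (hx : ∀ z ∈ K, c xn + B xn y + β / 2 * q (xn - x) (xn - x) ≤
      c z + B z y + β / 2 * q (z - x) (z - x))
    (hy : ∀ w ∈ L, -B ((2 : ℝ) • xn - x) yn + κ / 2 * r (yn - y) (yn - y) ≤
      -B ((2 : ℝ) • xn - x) w + κ / 2 * r (w - y) (w - y) + δ) :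
    (c xn + B xn w) - (c z + B z yn) ≤
      (β / 2 * q (z - x) (z - x) + κ / 2 * r (w - y) (w - y) - B (z - x) (w - y)) -
      (β / 2 * q (z - xn) (z - xn) + κ / 2 * r (w - yn) (w - yn) - B (z - xn) (w - yn)) +
      √δ * (2 + β / 2 * Q + κ / 2 * R) := by
  have hs : 0 < √δ := Real.sqrt_pos.2 h0
  have hs1 : √δ ≤ 1 := Real.sqrt_le_one.2 h1
  have p1 := prox_inequality hK (c + B.flip y) q hq hxn hz (b := β) (u := x) (δ := δ)
    (fun w hw => by simpa using (hx w hw).trans (le_add_of_nonneg_right h0.le)) hs hs1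
  have p2 := prox_inequality hL (-B ((2 : ℝ) • xn - x)) r hr hyn hw (b := κ) (u := y) (δ := δ)
    (fun w hw => by simpa using hy w hw) hs hs1
  have p3 := hB (xn - x) (yn - y)
  have p4 : √δ * (β / 2 * q (z - xn) (z - xn)) ≤ √δ * (β / 2 * Q) := by
    have := hQ z hz xn hxn
    gcongr
  have p5 : √δ * (κ / 2 * r (w - yn) (w - yn)) ≤ √δ * (κ / 2 * R) := by
    have := hR w hw yn hyn
    gcongr
  rw [Real.div_sqrt] at p1 p2
  simp only [LinearMap.add_apply, LinearMap.flip_apply, LinearMap.neg_apply] at p1 p2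
  have p6 : B xn w - B z yn = (B xn y - B z y) + (B ((2 : ℝ) • xn - x) w - B ((2 : ℝ) • xn - x) yn)
      + (B (z - xn) (w - yn) - B (z - x) (w - y) + B (xn - x) (yn - y)) := by
    simp only [map_sub, LinearMap.sub_apply, map_smul, LinearMap.smul_apply, smul_eq_mul]
    ring
  linarith

end abstract

/-- Summation of the step inequalities with weights `t`. -/
theorem sum_weighted_le {a b : ℕ} (hab : a ≤ b) {G D : ℕ → ℝ} {e K : ℝ}
    (h : ∀ t ∈ Finset.Ico a b, G (t + 1) ≤ D t - D (t + 1) + e) (h0 : ∀ t, 0 ≤ D t)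
    (hK : ∀ t ∈ Finset.Icc a b, D t ≤ K) :
    ∑ t ∈ Finset.Ioc a b, t * G t ≤ b * K + e * ∑ t ∈ Finset.Ioc a b, (t : ℝ) := by
  suffices H : ∀ n, a ≤ n → n ≤ b → ∑ t ∈ Finset.Ioc a n, t * G t + n * D n ≤
      n * K + e * ∑ t ∈ Finset.Ioc a n, (t : ℝ) by
    have := H b hab le_rfl
    have : 0 ≤ b * D b := mul_nonneg (Nat.cast_nonneg _) (h0 b)
    linarith
  intro n hn
  induction n, hn using Nat.le_induction with
  | base =>
    intro _
    simp only [Finset.Ioc_self, Finset.sum_empty, zero_add, mul_zero, add_zero]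
    exact mul_le_mul_of_nonneg_left (hK a (Finset.left_mem_Icc.2 hab)) (Nat.cast_nonneg _)
  | succ n hn ih =>
    intro hb
    have h1 := ih (by omega)
    have h2 := mul_le_mul_of_nonneg_left (h n (Finset.mem_Ico.2 ⟨hn, by omega⟩))
      (Nat.cast_nonneg (α := ℝ) (n + 1))
    have h3 := hK n (Finset.mem_Icc.2 ⟨hn, by omega⟩)
    rw [Finset.sum_Ioc_succ_top hn, Finset.sum_Ioc_succ_top hn]
    push_cast at h2 ⊢
    linarith

namespace Model

variable {N A S : ℕ} (P : Model N A S)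

/-- The expected cost of an action distribution. -/
def costMap (s : Fin S) : (Fin A → ℝ) →ₗ[ℝ] ℝ where
  toFun x := ∑ a, x a * P.cost s a
  map_add' x y := by simp only [Pi.add_apply, add_mul, Finset.sum_add_distrib]
  map_smul' r x := by simp only [Pi.smul_apply, smul_eq_mul, mul_assoc, Finset.mul_sum,
    RingHom.id_apply]

/-- The coupling term of the saddle function. -/
def coupling (v : Fin S → ℝ) : (Fin A → ℝ) →ₗ[ℝ] (Fin N → Fin A → Fin S → ℝ) →ₗ[ℝ] ℝ :=
  LinearMap.mk₂ ℝ (fun x y => ∑ i, ∑ a, ∑ s', P.disc / N * (x a * (y i a s' * v s')))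
    (fun x x' y => by simp only [Pi.add_apply, add_mul, mul_add, Finset.sum_add_distrib])
    (fun r x y => by
      simp only [Pi.smul_apply, smul_eq_mul, Finset.mul_sum]
      exact Finset.sum_congr rfl fun _ _ => Finset.sum_congr rfl fun _ _ =>
        Finset.sum_congr rfl fun _ _ => by ring)
    (fun x y y' => by simp only [Pi.add_apply, add_mul, mul_add, Finset.sum_add_distrib])
    (fun r x y => by
      simp only [Pi.smul_apply, smul_eq_mul, Finset.mul_sum]
      exact Finset.sum_congr rfl fun _ _ => Finset.sum_congr rfl fun _ _ =>
        Finset.sum_congr rfl fun _ _ => by ring)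

theorem coupling_apply (v : Fin S → ℝ) (x : Fin A → ℝ) (y : Fin N → Fin A → Fin S → ℝ) :
    P.coupling v x y = ∑ i, ∑ a, ∑ s', P.disc / N * (x a * (y i a s' * v s')) := rfl

theorem bellman_eq (s : Fin S) (x : Fin A → ℝ) (y : Fin N → Fin A → Fin S → ℝ) (v : Fin S → ℝ) :
    P.bellman s x y v = P.costMap s x + P.coupling v x y := by
  rw [coupling_apply, Finset.sum_comm, costMap, LinearMap.coe_mk, AddHom.coe_mk,
    ← Finset.sum_add_distrib]
  refine Finset.sum_congr rfl fun a _ => ?_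
  rw [mul_add, Finset.sum_comm]
  congr 1
  simp only [Finset.mul_sum, Finset.sum_mul]
  exact Finset.sum_congr rfl fun _ _ => Finset.sum_congr rfl fun _ _ => by ring

theorem sum_coefX (s : Fin S) (v : Fin S → ℝ) (x : Fin A → ℝ) (y : Fin N → Fin A → Fin S → ℝ) :
    ∑ a, P.coefX s v y a * x a = P.costMap s x + P.coupling v x y := by
  rw [coupling_apply, Finset.sum_comm, costMap, LinearMap.coe_mk, AddHom.coe_mk,
    ← Finset.sum_add_distrib]
  refine Finset.sum_congr rfl fun a _ => ?_
  rw [coefX, add_mul, mul_comm]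
  congr 1
  simp only [Finset.mul_sum, Finset.sum_mul]
  exact Finset.sum_congr rfl fun _ _ => Finset.sum_congr rfl fun _ _ => by ring

end Model

/-- The Euclidean inner product of action distributions. -/
def innerX (A : ℕ) : (Fin A → ℝ) →ₗ[ℝ] (Fin A → ℝ) →ₗ[ℝ] ℝ :=
  LinearMap.mk₂ ℝ (fun x y => ∑ a, x a * y a)
    (fun x x' y => by simp only [Pi.add_apply, add_mul, Finset.sum_add_distrib])
    (fun r x y => by simp only [Pi.smul_apply, smul_eq_mul, Finset.mul_sum, mul_assoc])
    (fun x y y' => by simp only [Pi.add_apply, mul_add, Finset.sum_add_distrib])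
    (fun r x y => by
      simp only [Pi.smul_apply, smul_eq_mul, Finset.mul_sum]
      exact Finset.sum_congr rfl fun _ _ => by ring)

theorem innerX_apply {A : ℕ} (x y : Fin A → ℝ) : innerX A x y = ∑ a, x a * y a := rfl

/-- The Euclidean inner product of families of kernels. -/
def innerY (N A S : ℕ) :
    (Fin N → Fin A → Fin S → ℝ) →ₗ[ℝ] (Fin N → Fin A → Fin S → ℝ) →ₗ[ℝ] ℝ :=
  LinearMap.mk₂ ℝ (fun x y => ∑ i, ∑ a, ∑ s, x i a s * y i a s)
    (fun x x' y => by simp only [Pi.add_apply, add_mul, Finset.sum_add_distrib])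
    (fun r x y => by simp only [Pi.smul_apply, smul_eq_mul, Finset.mul_sum, mul_assoc])
    (fun x y y' => by simp only [Pi.add_apply, mul_add, Finset.sum_add_distrib])
    (fun r x y => by
      simp only [Pi.smul_apply, smul_eq_mul, Finset.mul_sum]
      exact Finset.sum_congr rfl fun _ _ => Finset.sum_congr rfl fun _ _ =>
        Finset.sum_congr rfl fun _ _ => by ring)

theorem innerY_apply {N A S : ℕ} (x y : Fin N → Fin A → Fin S → ℝ) :
    innerY N A S x y = ∑ i, ∑ a, ∑ s, x i a s * y i a s := rfl

theorem innerX_sub_le {A : ℕ} {x y : Fin A → ℝ} (hx : x ∈ stdSimplex ℝ (Fin A))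
    (hy : y ∈ stdSimplex ℝ (Fin A)) : innerX A (x - y) (x - y) ≤ 2 := by
  have h : ∀ {z : Fin A → ℝ}, z ∈ stdSimplex ℝ (Fin A) → ∀ a, z a ≤ 1 := fun hz a => by
    rw [← hz.2]
    exact Finset.single_le_sum (fun i _ => hz.1 i) (Finset.mem_univ a)
  rw [innerX_apply]
  calc ∑ a, (x - y) a * (x - y) a ≤ ∑ a, (x a + y a) := Finset.sum_le_sum fun a _ => by
        simp only [Pi.sub_apply]
        nlinarith [hx.1 a, hy.1 a, h hx a, h hy a, mul_nonneg (hx.1 a) (hy.1 a)]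
    _ = 2 := by rw [Finset.sum_add_distrib, hx.2, hy.2]; norm_num

theorem innerY_sub_le {N A S : ℕ} {x y : Fin N → Fin A → Fin S → ℝ} (hx : ∀ i, x i ∈ U A S)
    (hy : ∀ i, y i ∈ U A S) : innerY N A S (x - y) (x - y) ≤ 2 * (A * N) := by
  rw [innerY_apply]
  calc ∑ i, ∑ a, ∑ s, (x - y) i a s * (x - y) i a s ≤ ∑ _i : Fin N, ∑ _a : Fin A, (2 : ℝ) :=
        Finset.sum_le_sum fun i _ => Finset.sum_le_sum fun a _ => innerX_sub_le (hx i a) (hy i a)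
    _ = 2 * (A * N) := by simp; ring

namespace Model

variable {N A S : ℕ} (P : Model N A S)

/-- The step sizes are small enough for the proximal terms to dominate the coupling. -/
theorem coupling_le (hN : 0 < N) (hA : 0 < A) (v : Fin S → ℝ) (x : Fin A → ℝ)
    (y : Fin N → Fin A → Fin S → ℝ) : P.coupling v x y ≤
      P.invTau v / 2 * innerX A x x + P.invSigma v / 2 * innerY N A S y y := by
  have hN' : (0 : ℝ) < N := by exact_mod_cast hN
  have hk : 0 < √(A : ℝ) := Real.sqrt_pos.2 (by exact_mod_cast hA)
  have hn := l2norm_nonneg v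
  have hl := P.disc_pos
  set k := √(A : ℝ)
  set n := l2norm v with hn'
  have key : ∀ i a, ∑ s', P.disc / N * (x a * (y i a s' * v s')) ≤
      P.disc / N * (n * (k / 2 * (x a * x a) + 1 / (2 * k) * ∑ s', y i a s' * y i a s')) := by
    intro i a
    rw [← Finset.mul_sum, ← Finset.mul_sum]
    refine mul_le_mul_of_nonneg_left ?_ (by positivity)
    set q := ∑ s', y i a s' * v s' with hq
    set r := ∑ s', y i a s' * y i a s' with hr
    have hr0 : 0 ≤ r := Finset.sum_nonneg fun _ _ => mul_self_nonneg _
    have hqr : |q| ≤ n * √r := by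
      rw [← Real.sqrt_sq_eq_abs, hn', l2norm, mul_comm, ← Real.sqrt_mul hr0]
      refine Real.sqrt_le_sqrt ?_
      simpa [hr, sq] using Finset.sum_mul_sq_le_sq_mul_sq Finset.univ (y i a) v
    calc x a * q ≤ |x a| * |q| := by rw [← abs_mul]; exact le_abs_self _
      _ ≤ |x a| * (n * √r) := by gcongr
      _ = n * (|x a| * √r) := by ring
      _ ≤ _ := by
        gcongr
        have h1 : 0 ≤ 1 / (2 * k) * (k * |x a| - √r) ^ 2 := by positivity
        have h2 : 1 / (2 * k) * (k * |x a| - √r) ^ 2 =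
            k / 2 * |x a| ^ 2 + 1 / (2 * k) * √r ^ 2 - |x a| * √r := by
          field_simp; ring
        rw [sq_abs, Real.sq_sqrt hr0] at h2
        linarith
  rw [coupling_apply]
  refine (Finset.sum_le_sum fun i _ => Finset.sum_le_sum fun a _ => key i a).trans (le_of_eq ?_)
  simp only [← Finset.mul_sum, Finset.sum_add_distrib]
  rw [Finset.sum_const, Finset.card_univ, Fintype.card_fin, nsmul_eq_mul, innerX_apply,
    innerY_apply, invTau, invSigma]
  change _ = k * (P.disc * n) / 2 * _ + P.disc * n / (N * k) / 2 * _
  field_simp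

end Model

/-! ### The gap of an epoch -/

section gap

variable {N A S : ℕ} {P : Model N A S} {d : Metric} {p : ℝ≥0∞} {I : Start P d p}

theorem Metric.penalty_combination_le {A S : ℕ} (d : Metric) (y z z' : Fin A → Fin S → ℝ) {a b : ℝ}
    (ha : 0 ≤ a) (hb : 0 ≤ b) (hab : a + b = 1) :
    d.penalty (a • z + b • z') y ≤ a * d.penalty z y + b * d.penalty z' y := by
  convert d.penalty_convex y z z' hb (by linarith) using 2
  · ext e s
    simp only [Pi.add_apply, Pi.smul_apply, smul_eq_mul]
    rw [← eq_sub_iff_add_eq] at hab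
    rw [hab]
    ring
  · rw [← hab]; ring

theorem Admissible.convex_feasible (h : Admissible d p) (hN : 0 < N) (s : Fin S) :
    Convex ℝ (P.feasible d p s) := by
  intro y hy z hz a b ha hb hab
  by_cases hp : p = ⊤
  · subst hp
    rw [Model.mem_feasible_top_iff] at hy hz ⊢
    refine ⟨fun i => U.convex (hy.1 i) (hz.1 i) ha hb hab, fun i => ?_⟩
    refine (d.penalty_combination_le _ (y i) (z i) ha hb hab).trans ?_
    have := mul_le_mul_of_nonneg_left (hy.2 i) ha
    have := mul_le_mul_of_nonneg_left (hz.2 i) hb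
    have : a * d.budget P.radius + b * d.budget P.radius = d.budget P.radius := by
      rw [← add_mul, hab, one_mul]
    linarith
  · rw [Model.mem_feasible_iff P h hp hN] at hy hz ⊢
    refine ⟨fun i => U.convex (hy.1 i) (hz.1 i) ha hb hab, ?_⟩
    refine (Finset.sum_le_sum fun i _ =>
      d.penalty_combination_le _ (y i) (z i) ha hb hab).trans ?_
    rw [Finset.sum_add_distrib, ← Finset.mul_sum, ← Finset.mul_sum]
    have := mul_le_mul_of_nonneg_left hy.2 ha
    have := mul_le_mul_of_nonneg_left hz.2 hb
    have : a * (N * d.budget P.radius) + b * (N * d.budget P.radius) = N * d.budget P.radius := by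
      rw [← add_mul, hab, one_mul]
    linarith

theorem Admissible.sample_mem_feasible (h : Admissible d p) (hN : 0 < N) (s : Fin S) :
    (fun i => P.sample i s) ∈ P.feasible d p s := by
  have hb := d.budget_nonneg P.radius_nonneg
  by_cases hp : p = ⊤
  · subst hp
    exact P.mem_feasible_top_iff.2 ⟨fun i => P.sample_mem i s, fun i => by rwa [d.penalty_self]⟩
  · refine (P.mem_feasible_iff h hp hN).2 ⟨fun i => P.sample_mem i s, ?_⟩
    simp only [d.penalty_self, Finset.sum_const_zero]
    positivity

theorem Model.invSigma_mul_card (hN : 0 < N) (hA : 0 < A) (v : Fin S → ℝ) :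
    P.invSigma v * (A * N) = P.invTau v := by
  have := P.invSigma_mul hN hA v
  rw [invTau, ← this]
  nth_rewrite 1 [← Real.mul_self_sqrt (Nat.cast_nonneg (α := ℝ) A)]
  ring

/-- The potential that decreases during an epoch. -/
def Model.potential (P : Model N A S) (v : Fin S → ℝ) (z : Fin A → ℝ) (w : Fin N → Fin A → Fin S → ℝ)
    (x : Fin A → ℝ) (y : Fin N → Fin A → Fin S → ℝ) : ℝ :=
  P.invTau v / 2 * innerX A (z - x) (z - x) + P.invSigma v / 2 * innerY N A S (w - y) (w - y) -
    P.coupling v (z - x) (w - y)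

theorem Model.potential_nonneg (hN : 0 < N) (hA : 0 < A) (v : Fin S → ℝ) (z : Fin A → ℝ)
    (w : Fin N → Fin A → Fin S → ℝ) (x : Fin A → ℝ) (y : Fin N → Fin A → Fin S → ℝ) :
    0 ≤ P.potential v z w x y := sub_nonneg.2 (P.coupling_le hN hA v _ _)

theorem Model.potential_le (hN : 0 < N) (hA : 0 < A) (v : Fin S → ℝ) {z x : Fin A → ℝ}
    {w y : Fin N → Fin A → Fin S → ℝ} (hz : z ∈ stdSimplex ℝ (Fin A)) (hx : x ∈ stdSimplex ℝ (Fin A))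
    (hw : ∀ i, w i ∈ U A S) (hy : ∀ i, y i ∈ U A S) :
    P.potential v z w x y ≤ 4 * P.invTau v := by
  have h1 := P.coupling_le hN hA v (-(z - x)) (w - y)
  have h2 := mul_le_mul_of_nonneg_left (innerX_sub_le hz hx) (P.invTau_nonneg v)
  have h3 := mul_le_mul_of_nonneg_left (innerY_sub_le hw hy) (P.invSigma_nonneg v)
  have h4 := P.invSigma_mul_card hN hA v
  simp only [map_neg, LinearMap.neg_apply, neg_neg] at h1
  unfold potential
  linarith

theorem StepAt.gap_le (hdp : Admissible d p) (hN : 0 < N) (hA : 0 < A) {δ : ℝ} (h0 : 0 < δ)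
    (h1 : δ ≤ 1) {v : Fin S → ℝ} {x xn : Fin S → Fin A → ℝ}
    {y yn : Fin S → Fin N → Fin A → Fin S → ℝ} (H : StepAt P d p δ v x y xn yn) (s : Fin S)
    {z : Fin A → ℝ} (hz : z ∈ stdSimplex ℝ (Fin A)) {w : Fin N → Fin A → Fin S → ℝ}
    (hw : w ∈ P.feasible d p s) : P.bellman s (xn s) w v - P.bellman s z (yn s) v ≤
      P.potential v z w (x s) (y s) - P.potential v z w (xn s) (yn s) +
        √δ * (2 + 2 * P.invTau v) := by
  obtain ⟨hx1, hx2, hy1, hy2⟩ := H s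
  have key := saddle_step (convex_stdSimplex ℝ (Fin A)) (hdp.convex_feasible hN s (P := P))
    (P.costMap s) (P.coupling v) (innerX A) (innerY N A S)
    (fun a b => by simp only [innerX_apply, mul_comm]) (fun a b => by
      simp only [innerY_apply, mul_comm]) (P.invTau_nonneg v) (P.invSigma_nonneg v)
    (P.coupling_le hN hA v) (fun a ha b hb => innerX_sub_le ha hb)
    (fun a ha b hb => innerY_sub_le ha.1 hb.1) (x := x s) (y := y s) hx1 hz hy1 hw h0 h1
    (fun u hu => ?_) (fun u hu => ?_)
  · rw [P.bellman_eq, P.bellman_eq]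
    have h4 := P.invSigma_mul_card hN hA v
    have : P.invTau v / 2 * 2 + P.invSigma v / 2 * (2 * (A * N)) = 2 * P.invTau v := by linarith
    rw [add_assoc 2, this] at key
    exact key
  · have := hx2 u hu
    change ∑ a, P.coefX s v (y s) a * xn s a + _ ≤ ∑ a, P.coefX s v (y s) a * u a + _ at this
    rw [P.sum_coefX, P.sum_coefX] at this
    simpa only [innerX_apply, Pi.sub_apply, ← sq] using this
  · have := hy2 u hu
    have e : ∀ u : Fin N → Fin A → Fin S → ℝ, P.proxObjY v (x s) (xn s) (y s) u =
        -P.coupling v ((2 : ℝ) • xn s - x s) u +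
          P.invSigma v / 2 * innerY N A S (u - y s) (u - y s) := fun u => by
      rw [Model.coupling_apply, innerY_apply, Model.proxObjY, Finset.mul_sum, ← Finset.sum_neg_distrib,
        ← Finset.sum_add_distrib]
      refine Finset.sum_congr rfl fun i _ => ?_
      congr 1
      · rw [← Finset.sum_neg_distrib]
        refine Finset.sum_congr rfl fun a _ => ?_
        rw [← Finset.sum_neg_distrib]
        refine Finset.sum_congr rfl fun s' _ => ?_
        simp only [Pi.sub_apply, Pi.smul_apply, smul_eq_mul]
        ring
      · simp only [Pi.sub_apply, sq]
    rw [e, e] at this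
    exact this

namespace IsRun

variable {k : ℕ} {δ : ℝ} {x : ℕ → Fin S → Fin A → ℝ}
  {y : ℕ → Fin S → Fin N → Fin A → Fin S → ℝ} {v : ℕ → Fin S → ℝ}

theorem stepAt (H : IsRun P d p I k δ x y v) {l : ℕ} (hl : l ∈ Finset.Icc 1 k) {t : ℕ}
    (ht : t ∈ Finset.Ico (epochStart l) (epochStart (l + 1))) :
    StepAt P d p δ (v l) (x t) (y t) (x (t + 1)) (y (t + 1)) := fun s =>
  ⟨H.x_mem l hl t ht s, H.x_min l hl t ht s, H.y_mem l hl t ht s, H.y_min l hl t ht s⟩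

theorem mem_of_le (H : IsRun P d p I k δ x y v) {l : ℕ} (hl : l ≤ k + 1) {t : ℕ}
    (ht : t ≤ epochStart l) (s : Fin S) :
    x t s ∈ stdSimplex ℝ (Fin A) ∧ y t s ∈ P.feasible d p s := by
  have h0 : x 0 s ∈ stdSimplex ℝ (Fin A) ∧ y 0 s ∈ P.feasible d p s := by
    rw [H.x_zero, H.y_zero]
    exact ⟨I.x_mem s, I.y_mem s⟩
  induction l generalizing t with
  | zero =>
    obtain rfl : t = 0 := by simpa [epochStart] using ht
    exact h0
  | succ l ih =>
    rcases le_or_gt t (epochStart l) with h | h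
    · exact ih (by omega) h
    · rcases Nat.eq_zero_or_pos l with rfl | hl0
      · rw [epochStart_one] at ht
        omega
      · obtain ⟨t, rfl⟩ : ∃ t', t = t' + 1 := ⟨t - 1, by omega⟩
        have := H.stepAt (Finset.mem_Icc.2 ⟨hl0, by omega⟩)
          (Finset.mem_Ico.2 ⟨by omega, by omega⟩ : t ∈ _) s
        exact ⟨this.1, this.2.2.1⟩

/-- The gap, summed over an epoch with the weights of the averages. -/
theorem sum_gap_le (hdp : Admissible d p) (hN : 0 < N) (hA : 0 < A) (h0 : 0 < δ)
    (h1 : δ ≤ 1) (H : IsRun P d p I k δ x y v) {l : ℕ} (hl : l ∈ Finset.Icc 1 k) (s : Fin S)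
    {z : Fin A → ℝ} (hz : z ∈ stdSimplex ℝ (Fin A)) {w : Fin N → Fin A → Fin S → ℝ}
    (hw : w ∈ P.feasible d p s) {R : ℝ} (hR : P.invTau (v l) ≤ R) :
    ∑ t ∈ Finset.Ioc (epochStart l) (epochStart (l + 1)),
      t * (P.bellman s (x t s) w (v l) - P.bellman s z (y t s) (v l)) ≤
    epochStart (l + 1) * (4 * R) + √δ * (2 + 2 * R) *
      ∑ t ∈ Finset.Ioc (epochStart l) (epochStart (l + 1)), (t : ℝ) := by
  refine sum_weighted_le (epochStart_mono (Nat.le_succ l))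
    (D := fun t => P.potential (v l) z w (x t s) (y t s)) (fun t ht => ?_)
    (fun t => P.potential_nonneg hN hA _ _ _ _ _) fun t ht => ?_
  · refine ((H.stepAt hl ht).gap_le hdp hN hA h0 h1 s hz hw).trans ?_
    gcongr
  · have := H.mem_of_le (l := l + 1) (by rw [Finset.mem_Icc] at hl; omega)
      (Finset.mem_Icc.1 ht).2 s
    refine (P.potential_le hN hA _ hz this.1 hw.1 this.2.1).trans ?_
    gcongr

end IsRun

/-- The saddle function is affine in both arguments, so averages of the iterates have the average
gap. -/
theorem Model.bellman_linAvg_sub {a b : ℕ} (hab : a < b) (s : Fin S) (x : ℕ → Fin A → ℝ)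
    (y : ℕ → Fin N → Fin A → Fin S → ℝ) (z : Fin A → ℝ) (w : Fin N → Fin A → Fin S → ℝ)
    (v : Fin S → ℝ) :
    P.bellman s (fun e => linAvg (Finset.Ioc a b) fun t => x t e) w v -
      P.bellman s z (fun i e s' => linAvg (Finset.Ioc a b) fun t => y t i e s') v =
    (∑ t ∈ Finset.Ioc a b, t * (P.bellman s (x t) w v - P.bellman s z (y t) v)) /
      ∑ t ∈ Finset.Ioc a b, (t : ℝ) := by
  rw [linAvg_eq_sum₁, linAvg_eq_sum₃]
  have hone := sum_weights_eq_one hab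
  set W := ∑ t ∈ Finset.Ioc a b, (t : ℝ)
  simp only [bellman_eq, map_sum, map_smul, LinearMap.sum_apply, LinearMap.smul_apply, smul_eq_mul]
  have : P.costMap s z = ∑ t ∈ Finset.Ioc a b, (t : ℝ) / W * P.costMap s z := by
    rw [← Finset.sum_mul, hone, one_mul]
  rw [this, Finset.sum_div, ← Finset.sum_add_distrib, ← Finset.sum_add_distrib,
    ← Finset.sum_sub_distrib]
  exact Finset.sum_congr rfl fun t _ => by rw [← this]; ring

/-! ### The robust value operator -/

namespace Model

theorem exists_abs_bellman_le (P : Model N A S) (hN : 0 < N) (v : Fin S → ℝ) :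
    ∃ C, ∀ s, ∀ x ∈ stdSimplex ℝ (Fin A), ∀ y : Fin N → Fin A → Fin S → ℝ, (∀ i, y i ∈ U A S) →
      |P.bellman s x y v| ≤ C :=
  ⟨∑ s, ∑ a, |P.cost s a| + P.disc * ‖v‖, fun _ _ hx _ hy => P.abs_bellman_le hN hx hy
    (fun s a => (Finset.single_le_sum (f := fun a => |P.cost s a|) (fun _ _ => abs_nonneg _)
      (Finset.mem_univ a)).trans (Finset.single_le_sum (f := fun s => ∑ a, |P.cost s a|)
        (fun _ _ => Finset.sum_nonneg fun _ _ => abs_nonneg _) (Finset.mem_univ s)))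
    fun s => norm_le_pi_norm v s⟩

theorem abs_bellman_sub_le (P : Model N A S) (hN : 0 < N) {s : Fin S} {x : Fin A → ℝ}
    (hx : x ∈ stdSimplex ℝ (Fin A)) {y : Fin N → Fin A → Fin S → ℝ} (hy : ∀ i, y i ∈ U A S)
    (v v' : Fin S → ℝ) : |P.bellman s x y v - P.bellman s x y v'| ≤ P.disc * ‖v - v'‖ := by
  have : P.bellman s x y v - P.bellman s x y v' =
      ∑ a, x a * (P.disc * ∑ s', meanKernel y a s' * (v - v') s') := by
    simp only [bellman, meanKernel, ← Finset.sum_sub_distrib, Pi.sub_apply, mul_sub]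
    refine Finset.sum_congr rfl fun a _ => ?_
    rw [Finset.sum_sub_distrib]
    ring
  rw [this]
  refine abs_sum_simplex_le hx fun a => ?_
  rw [abs_mul, abs_of_pos P.disc_pos]
  exact mul_le_mul_of_nonneg_left (abs_sum_simplex_le (meanKernel_mem hN hy a) fun s =>
    norm_le_pi_norm (v - v') s) P.disc_pos.le

variable (P d p)

/-- The worst case of the Bellman update of `v` with the action distribution `x`. -/
def upper (s : Fin S) (x : Fin A → ℝ) (v : Fin S → ℝ) : ℝ :=
  ⨆ w : P.feasible d p s, P.bellman s x w v

/-- The robust Bellman operator. -/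
def robust (v : Fin S → ℝ) (s : Fin S) : ℝ := ⨅ x : stdSimplex ℝ (Fin A), P.upper d p s x v

variable {P d p} {s : Fin S} {x : Fin A → ℝ} {v : Fin S → ℝ}

theorem bellman_le_upper (hN : 0 < N) (hx : x ∈ stdSimplex ℝ (Fin A))
    {w : Fin N → Fin A → Fin S → ℝ} (hw : w ∈ P.feasible d p s) :
    P.bellman s x w v ≤ P.upper d p s x v := by
  obtain ⟨C, hC⟩ := P.exists_abs_bellman_le hN v
  refine le_ciSup (f := fun w : P.feasible d p s => P.bellman s x w v) ⟨C, ?_⟩ ⟨w, hw⟩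
  rintro _ ⟨w, rfl⟩
  exact (le_abs_self _).trans (hC s x hx _ w.2.1)

theorem upper_le (hdp : Admissible d p) (hN : 0 < N) {r : ℝ}
    (h : ∀ w ∈ P.feasible d p s, P.bellman s x w v ≤ r) : P.upper d p s x v ≤ r := by
  have : Nonempty (P.feasible d p s) := ⟨⟨_, hdp.sample_mem_feasible hN s⟩⟩
  exact ciSup_le fun w => h w w.2

theorem robust_le_upper (hdp : Admissible d p) (hN : 0 < N) (hx : x ∈ stdSimplex ℝ (Fin A)) :
    P.robust d p v s ≤ P.upper d p s x v := by
  obtain ⟨C, hC⟩ := P.exists_abs_bellman_le hN v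
  refine ciInf_le (f := fun x : stdSimplex ℝ (Fin A) => P.upper d p s x v) ⟨-C, ?_⟩ ⟨x, hx⟩
  rintro _ ⟨x, rfl⟩
  have hs := hdp.sample_mem_feasible (P := P) hN s
  exact (neg_le_of_abs_le (hC s x x.2 _ hs.1)).trans (bellman_le_upper hN x.2 hs)

theorem nonempty_simplex (hA : 0 < A) : Nonempty (stdSimplex ℝ (Fin A)) :=
  ⟨⟨_, single_mem_stdSimplex ℝ (⟨0, hA⟩ : Fin A)⟩⟩

theorem le_robust (hA : 0 < A) {r : ℝ}
    (h : ∀ x ∈ stdSimplex ℝ (Fin A), r ≤ P.upper d p s x v) : r ≤ P.robust d p v s := by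
  have := nonempty_simplex hA
  exact le_ciInf fun x => h x x.2

theorem robust_le_add (hdp : Admissible d p) (hN : 0 < N) (hA : 0 < A) (v v' : Fin S → ℝ) :
    P.robust d p v s ≤ P.robust d p v' s + P.disc * ‖v - v'‖ := by
  rw [← sub_le_iff_le_add]
  refine le_robust hA fun x hx => sub_le_iff_le_add.2 ?_
  refine (robust_le_upper hdp hN hx).trans (upper_le hdp hN fun w hw => ?_)
  have h1 := (le_abs_self _).trans (P.abs_bellman_sub_le hN (s := s) hx hw.1 v v')
  have h2 := bellman_le_upper hN hx hw (v := v')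
  linarith

theorem norm_robust_sub_le (hdp : Admissible d p) (hN : 0 < N) (hA : 0 < A) (v v' : Fin S → ℝ) :
    ‖P.robust d p v - P.robust d p v'‖ ≤ P.disc * ‖v - v'‖ := by
  have := P.disc_pos
  refine (pi_norm_le_iff_of_nonneg (by positivity)).2 fun s => ?_
  rw [Real.norm_eq_abs, abs_le, Pi.sub_apply]
  have h1 := robust_le_add (P := P) (s := s) hdp hN hA v v'
  have h2 := robust_le_add (P := P) (s := s) hdp hN hA v' v
  rw [norm_sub_rev] at h2
  constructor <;> linarith

/-- The robust Bellman operator is a contraction in the maximum norm. -/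
theorem exists_robust_fixed (hdp : Admissible d p) (hN : 0 < N) (hA : 0 < A) :
    ∃ v, P.robust d p v = v := by
  have : ContractingWith ⟨P.disc, P.disc_pos.le⟩ (P.robust d p) :=
    ⟨P.disc_lt_one, LipschitzWith.of_dist_le_mul fun v v' => by
      rw [dist_eq_norm, dist_eq_norm]
      exact norm_robust_sub_le hdp hN hA v v'⟩
  exact ⟨_, this.fixedPoint_isFixedPt⟩

theorem abs_fixed_le (hdp : Admissible d p) (hN : 0 < N) (hA : 0 < A) {M V : ℝ}
    (hc : ∀ s a, |P.cost s a| ≤ M) (hM : 0 ≤ M) (hMV : M + P.disc * V ≤ V)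
    (h : P.robust d p v = v) : ‖v‖ ≤ V := by
  have h0 := P.disc_pos
  have key : ‖v‖ ≤ M + P.disc * ‖v‖ := by
    refine (pi_norm_le_iff_of_nonneg (by positivity)).2 fun s => ?_
    have hb : ∀ x ∈ stdSimplex ℝ (Fin A), ∀ w ∈ P.feasible d p s,
        |P.bellman s x w v| ≤ M + P.disc * ‖v‖ := fun x hx w hw =>
      P.abs_bellman_le hN hx hw.1 hc fun s => norm_le_pi_norm v s
    have hs := hdp.sample_mem_feasible (P := P) hN s
    have hv : v s = P.robust d p v s := by rw [h]
    rw [Real.norm_eq_abs, abs_le, hv]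
    constructor
    · exact le_robust hA fun x hx => (neg_le_of_abs_le (hb x hx _ hs)).trans
        (bellman_le_upper hN hx hs)
    · obtain ⟨x, hx⟩ := nonempty_simplex hA
      exact (robust_le_upper hdp hN hx).trans (upper_le hdp hN fun w hw =>
        (le_abs_self _).trans (hb x hx w hw))
  have := P.disc_lt_one
  by_contra! hlt
  nlinarith

end Model

end gap

/-! ### Convergence of the value vectors and of the output -/

theorem two_mul_sum_Ioc {a b : ℕ} (h : a ≤ b) :
    2 * ∑ t ∈ Finset.Ioc a b, (t : ℝ) = ((b : ℝ) - a) * (a + b + 1) := by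
  induction b, h using Nat.le_induction with
  | base => simp
  | succ n hn ih =>
    rw [Finset.sum_Ioc_succ_top hn, mul_add, ih]
    push_cast
    ring

theorem epochStart_sub (l : ℕ) : ((epochStart (l + 1) : ℝ) - epochStart l) = (l : ℝ) ^ 2 := by
  rw [epochStart_succ]
  push_cast
  ring

theorem epoch_weight_ge (l : ℕ) : (l : ℝ) ^ 2 * epochStart (l + 1) ≤
    2 * ∑ t ∈ Finset.Ioc (epochStart l) (epochStart (l + 1)), (t : ℝ) := by
  rw [two_mul_sum_Ioc (epochStart_mono (Nat.le_succ l)), epochStart_sub]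
  have : (0 : ℝ) ≤ epochStart l := Nat.cast_nonneg _
  gcongr
  linarith

theorem epoch_weight_le (l : ℕ) :
    ∑ t ∈ Finset.Ioc (epochStart l) (epochStart (l + 1)), (t : ℝ) ≤ (l : ℝ) ^ 2 * (l : ℝ) ^ 3 := by
  calc _ ≤ ∑ t ∈ Finset.Ioc (epochStart l) (epochStart (l + 1)), (l : ℝ) ^ 3 :=
        Finset.sum_le_sum fun t ht => by
          exact_mod_cast (Finset.mem_Ioc.1 ht).2.trans (epochStart_le l)
    _ = _ := by
        rw [Finset.sum_const, Nat.card_Ioc, nsmul_eq_mul, epochStart_succ, Nat.add_sub_cancel_left]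
        push_cast
        ring

theorem le_epochStart (k : ℕ) : k ^ 3 ≤ 3 * epochStart (k + 1) := by
  induction k with
  | zero => simp
  | succ k ih =>
    rw [epochStart_succ]
    nlinarith

theorem total_weight_ge (k : ℕ) :
    (k : ℝ) ^ 6 ≤ 18 * ∑ t ∈ Finset.Ioc 0 (epochStart (k + 1)), (t : ℝ) := by
  have h1 := two_mul_sum_Ioc (Nat.zero_le (epochStart (k + 1)))
  have h2 : (k : ℝ) ^ 3 ≤ 3 * epochStart (k + 1) := by exact_mod_cast le_epochStart k
  have h3 : (0 : ℝ) ≤ (k : ℝ) ^ 3 := by positivity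
  push_cast at h1
  nlinarith [mul_le_mul h2 h2 h3 (h3.trans h2)]

theorem sum_epochs (k : ℕ) (f : ℕ → ℝ) : ∑ t ∈ Finset.Ioc 0 (epochStart (k + 1)), f t =
    ∑ l ∈ Finset.Icc 1 k, ∑ t ∈ Finset.Ioc (epochStart l) (epochStart (l + 1)), f t := by
  induction k with
  | zero => simp [epochStart]
  | succ k ih =>
    rw [Finset.sum_Icc_succ_top (by omega), ← ih,
      Finset.sum_Ioc_consecutive f (Nat.zero_le _) (epochStart_mono (Nat.le_succ _))]

theorem sum_cubes_le (k : ℕ) : ∑ l ∈ Finset.Icc 1 k, (l : ℝ) ^ 3 ≤ (k : ℝ) ^ 4 := by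
  induction k with
  | zero => simp
  | succ k ih =>
    rw [Finset.sum_Icc_succ_top (by omega)]
    push_cast
    have : (0 : ℝ) ≤ k := Nat.cast_nonneg _
    nlinarith [pow_nonneg this 2, pow_nonneg this 3]

/-- A contraction with errors `G / l ^ 2 + e` in step `l` has distance `O(1 / l ^ 2) + O(e)` to its
fixed point: from `n₀` on, `1 / l ^ 2` decreases more slowly than the contraction. -/
theorem contraction_rate {q G e V : ℝ} (hq0 : 0 ≤ q) (hq1 : q < 1) (hG : 0 ≤ G) (he : 0 ≤ e)
    (hV : 0 ≤ V) {n₀ : ℕ} (hn0 : 1 ≤ n₀)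
    (hn : ∀ l : ℕ, n₀ ≤ l → (1 + q) / 2 * ((l : ℝ) + 1) ^ 2 ≤ (l : ℝ) ^ 2) {r : ℕ → ℝ} {k : ℕ}
    (hr : ∀ l ∈ Finset.Icc 1 k, r (l + 1) ≤ q * r l + G / (l : ℝ) ^ 2 + e)
    (hrV : ∀ l ∈ Finset.Icc 1 (k + 1), r l ≤ 2 * V) {l : ℕ} (hl : l ∈ Finset.Icc 1 (k + 1)) :
    r l ≤ (2 * V * n₀ ^ 2 + 2 * G / (1 - q)) / (l : ℝ) ^ 2 + e / (1 - q) := by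
  have hq : 0 < 1 - q := sub_pos.2 hq1
  set B := 2 * V * n₀ ^ 2 + 2 * G / (1 - q) with hB
  have hBG : 2 * G ≤ B * (1 - q) := by
    rw [hB, add_mul, div_mul_cancel₀ _ hq.ne']
    have : 0 ≤ 2 * V * n₀ ^ 2 * (1 - q) := by positivity
    linarith
  have hB0 : 0 ≤ B := by positivity
  have he' : 0 ≤ e / (1 - q) := by positivity
  have small : ∀ l ∈ Finset.Icc 1 (k + 1), l ≤ n₀ → r l ≤ B / (l : ℝ) ^ 2 + e / (1 - q) := by
    intro l hl hln
    have hl1 := (Finset.mem_Icc.1 hl).1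
    have hl0 : (0 : ℝ) < l := by exact_mod_cast hl1
    have : r l ≤ B / (l : ℝ) ^ 2 := by
      rw [le_div_iff₀ (by positivity)]
      calc r l * (l : ℝ) ^ 2 ≤ 2 * V * (l : ℝ) ^ 2 := by gcongr; exact hrV l hl
        _ ≤ 2 * V * (n₀ : ℝ) ^ 2 := by gcongr
        _ ≤ B := by rw [hB]; exact le_add_of_nonneg_right (by positivity)
    linarith
  rcases le_or_gt l n₀ with h | h
  · exact small l hl h
  · have hl2 := (Finset.mem_Icc.1 hl).2
    clear hl
    induction l, h.le using Nat.le_induction with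
    | base => exact small n₀ (Finset.mem_Icc.2 ⟨hn0, hl2⟩) le_rfl
    | succ l hnl ih =>
      have ih' : r l ≤ B / (l : ℝ) ^ 2 + e / (1 - q) := by
        rcases hnl.eq_or_lt with rfl | hlt
        · exact small _ (Finset.mem_Icc.2 ⟨hn0, by omega⟩) le_rfl
        · exact ih hlt (by omega)
      have hl0 : (0 : ℝ) < l := by exact_mod_cast hn0.trans hnl
      have h1 := hr l (Finset.mem_Icc.2 ⟨hn0.trans hnl, by omega⟩)
      have h2 : q * r l ≤ q * (B / (l : ℝ) ^ 2 + e / (1 - q)) := by gcongr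
      have h3 : q * (e / (1 - q)) + e = e / (1 - q) := by
        field_simp
        ring
      have h4 : (q * B + G) / (l : ℝ) ^ 2 ≤ B / ((l + 1 : ℕ) : ℝ) ^ 2 := by
        push_cast
        rw [div_le_div_iff₀ (by positivity) (by positivity)]
        calc (q * B + G) * ((l : ℝ) + 1) ^ 2 ≤ ((1 + q) / 2 * B) * ((l : ℝ) + 1) ^ 2 := by
              gcongr; linarith
          _ = B * ((1 + q) / 2 * ((l : ℝ) + 1) ^ 2) := by ring
          _ ≤ B * (l : ℝ) ^ 2 := by gcongr; exact hn l hnl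
      have h5 : q * (B / (l : ℝ) ^ 2) + G / (l : ℝ) ^ 2 = (q * B + G) / (l : ℝ) ^ 2 := by ring
      linarith

theorem exists_rate_threshold {q : ℝ} (hq1 : q < 1) :
    ∃ n₀ : ℕ, 1 ≤ n₀ ∧ ∀ l : ℕ, n₀ ≤ l → (1 + q) / 2 * ((l : ℝ) + 1) ^ 2 ≤ (l : ℝ) ^ 2 := by
  obtain ⟨n, hn⟩ := exists_nat_gt (6 / (1 - q))
  have hq : 0 < 1 - q := sub_pos.2 hq1
  rw [div_lt_iff₀ hq] at hn
  refine ⟨n + 1, by omega, fun l hl => ?_⟩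
  have hl' : (n : ℝ) + 1 ≤ l := by exact_mod_cast hl
  have : (1 : ℝ) ≤ l := le_trans (by simp) hl'
  nlinarith [mul_le_mul_of_nonneg_right hl' hq.le, mul_nonneg hq.le (sub_nonneg.2 this)]

section convergence

variable {N A S : ℕ} {P : Model N A S} {d : Metric} {p : ℝ≥0∞} {I : Start P d p}

namespace IsRun

variable {k : ℕ} {δ : ℝ} {x : ℕ → Fin S → Fin A → ℝ}
  {y : ℕ → Fin S → Fin N → Fin A → Fin S → ℝ} {v : ℕ → Fin S → ℝ}

theorem mem_of_mem_Ioc (H : IsRun P d p I k δ x y v) {l l' : ℕ} (hl : l ≤ k + 1) {t : ℕ}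
    (ht : t ∈ Finset.Ioc l' (epochStart l)) (s : Fin S) :
    x t s ∈ stdSimplex ℝ (Fin A) ∧ y t s ∈ P.feasible d p s :=
  H.mem_of_le hl (Finset.mem_Ioc.1 ht).2 s

theorem epochStart_lt_succ {l : ℕ} (hl : 1 ≤ l) : epochStart l < epochStart (l + 1) := by
  rw [epochStart_succ]
  exact Nat.lt_add_of_pos_right (by positivity)

/-- The value vectors stay bounded. -/
theorem abs_value_le (hN : 0 < N) (H : IsRun P d p I k δ x y v) {M V : ℝ}
    (hc : ∀ s a, |P.cost s a| ≤ M) (hMV : M + P.disc * V ≤ V) (hI : ∀ s, |I.v s| ≤ V) {l : ℕ}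
    (hl : l ∈ Finset.Icc 1 (k + 1)) (s : Fin S) : |v l s| ≤ V := by
  obtain ⟨h1, h2⟩ := Finset.mem_Icc.1 hl
  clear hl
  induction l, h1 using Nat.le_induction generalizing s with
  | base => rw [H.v_one]; exact hI s
  | succ l hl ih =>
    rw [H.v_step l (Finset.mem_Icc.2 ⟨hl, by omega⟩)]
    exact (P.abs_bellman_le hN (linAvg_mem_stdSimplex (epochStart_lt_succ hl) fun t ht =>
      (H.mem_of_mem_Ioc h2 ht s).1) (fun i => linAvg_mem_U (epochStart_lt_succ hl) fun t ht =>
        (H.mem_of_mem_Ioc h2 ht s).2.1 i) hc fun s => ih s (by omega)).trans hMV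

/-- The value update is an approximate application of the robust Bellman operator: an
approximate saddle point determines the saddle value. -/
theorem abs_value_sub_robust_le (hdp : Admissible d p) (hN : 0 < N) (hA : 0 < A) (h0 : 0 < δ)
    (h1 : δ ≤ 1) (H : IsRun P d p I k δ x y v) {l : ℕ} (hl : l ∈ Finset.Icc 1 k) {R : ℝ}
    (hR0 : 0 ≤ R) (hR : P.invTau (v l) ≤ R) (s : Fin S) :
    |v (l + 1) s - P.robust d p (v l) s| ≤ 8 * R / (l : ℝ) ^ 2 + √δ * (2 + 2 * R) := by
  obtain ⟨hl1, hl2⟩ := Finset.mem_Icc.1 hl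
  have hl0 : (0 : ℝ) < l := by exact_mod_cast hl1
  have hlt := epochStart_lt_succ hl1
  have hW := sum_Ioc_pos hlt
  have hW2 := epoch_weight_ge l
  rw [H.v_step l hl s]
  set xa := fun a => linAvg (Finset.Ioc (epochStart l) (epochStart (l + 1))) fun t => x t s a
  set ya := fun i a s' => linAvg (Finset.Ioc (epochStart l) (epochStart (l + 1))) fun t =>
    y t s i a s'
  have hxa : xa ∈ stdSimplex ℝ (Fin A) := linAvg_mem_stdSimplex hlt fun t ht =>
    (H.mem_of_mem_Ioc (by omega) ht s).1
  have hya : ya ∈ P.feasible d p s := linAvg_mem₃ (hdp.convex_feasible hN s) hlt fun t ht =>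
    (H.mem_of_mem_Ioc (by omega) ht s).2
  have gap : ∀ z ∈ stdSimplex ℝ (Fin A), ∀ w ∈ P.feasible d p s, P.bellman s xa w (v l) ≤
      P.bellman s z ya (v l) + (8 * R / (l : ℝ) ^ 2 + √δ * (2 + 2 * R)) := by
    intro z hz w hw
    rw [← sub_le_iff_le_add']
    refine (Model.bellman_linAvg_sub hlt s (fun t => x t s) (fun t => y t s) z w (v l)).trans_le ?_
    rw [div_le_iff₀ hW, add_mul]
    refine (H.sum_gap_le hdp hN hA h0 h1 hl s hz hw hR).trans (add_le_add_left ?_ _)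
    rw [div_mul_eq_mul_div, le_div_iff₀ (by positivity)]
    nlinarith
  rw [abs_le]
  constructor
  · obtain ⟨z, hz⟩ := Model.nonempty_simplex hA
    have : P.robust d p (v l) s ≤ P.bellman s xa ya (v l) +
        (8 * R / (l : ℝ) ^ 2 + √δ * (2 + 2 * R)) :=
      (Model.robust_le_upper hdp hN hxa).trans (Model.upper_le hdp hN fun w hw => gap xa hxa w hw)
    linarith
  · have : P.bellman s xa ya (v l) - (8 * R / (l : ℝ) ^ 2 + √δ * (2 + 2 * R)) ≤
        P.robust d p (v l) s := Model.le_robust hA fun z hz =>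
      (sub_le_iff_le_add.2 (gap z hz ya hya)).trans (Model.bellman_le_upper hN hz hya)
    linarith

theorem norm_value_sub_fixed_le (hdp : Admissible d p) (hN : 0 < N) (hA : 0 < A) (h0 : 0 < δ)
    (h1 : δ ≤ 1) (H : IsRun P d p I k δ x y v) {l : ℕ} (hl : l ∈ Finset.Icc 1 k) {R : ℝ}
    (hR0 : 0 ≤ R) (hR : P.invTau (v l) ≤ R) {u : Fin S → ℝ} (hu : P.robust d p u = u) :
    ‖v (l + 1) - u‖ ≤ P.disc * ‖v l - u‖ + 8 * R / (l : ℝ) ^ 2 + √δ * (2 + 2 * R) := by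
  have e : v (l + 1) - u = (P.robust d p (v l) - P.robust d p u) +
      (v (l + 1) - P.robust d p (v l)) := by rw [hu]; abel
  rw [e, add_assoc]
  refine (norm_add_le _ _).trans (add_le_add (Model.norm_robust_sub_le hdp hN hA _ _) ?_)
  exact (pi_norm_le_iff_of_nonneg (by positivity)).2 fun s =>
    H.abs_value_sub_robust_le hdp hN hA h0 h1 hl hR0 hR s

/-- The policy that is returned solves the Bellman equation of the robust problem up to a small
error: it is worst-case optimal for the value function `u` of the robust problem. -/
theorem upper_output_le (hdp : Admissible d p) (hN : 0 < N) (hA : 0 < A) (hS : 0 < S) (hk : 1 ≤ k)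
    (h0 : 0 < δ) (h1 : δ ≤ 1) (H : IsRun P d p I k δ x y v) {M V R : ℝ} (hM : 0 ≤ M)
    (hc : ∀ s a, |P.cost s a| ≤ M) (hMV : M + P.disc * V ≤ V) (hV : 0 ≤ V)
    (hI : ∀ s, |I.v s| ≤ V)
    (hR : √A * (√S * V) ≤ R) {u : Fin S → ℝ} (hu : P.robust d p u = u) {n₀ : ℕ} (hn0 : 1 ≤ n₀)
    (hn : ∀ l : ℕ, n₀ ≤ l → (1 + P.disc) / 2 * ((l : ℝ) + 1) ^ 2 ≤ (l : ℝ) ^ 2) (s : Fin S) :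
    P.upper d p s (outputX k x s) u ≤ u s +
      (18 * (4 * R + 2 * (2 * V * n₀ ^ 2 + 2 * (8 * R) / (1 - P.disc))) / (k : ℝ) ^ 2 +
        3 * (√δ * (2 + 2 * R) / (1 - P.disc))) := by
  have hq : 0 < 1 - P.disc := sub_pos.2 P.disc_lt_one
  have hR0 : 0 ≤ R := le_trans (by positivity) hR
  have hu' := Model.abs_fixed_le hdp hN hA hc hM hMV hu
  have hvV : ∀ l ∈ Finset.Icc 1 (k + 1), ∀ s, |v l s| ≤ V := fun l hl s =>
    H.abs_value_le hN hc hMV hI hl s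
  have hRl : ∀ l ∈ Finset.Icc 1 k, P.invTau (v l) ≤ R := fun l hl => by
    refine le_trans ?_ hR
    have := Model.l2norm_le hV (hvV l (by rw [Finset.mem_Icc] at hl ⊢; omega))
    unfold Model.invTau
    exact mul_le_mul_of_nonneg_left
      ((mul_le_of_le_one_left (Model.l2norm_nonneg _) P.disc_lt_one.le).trans this)
      (Real.sqrt_nonneg _)
  set e := √δ * (2 + 2 * R) with he
  have he0 : 0 ≤ e := by positivity
  set B := 2 * V * n₀ ^ 2 + 2 * (8 * R) / (1 - P.disc) with hB
  have hB0 : 0 ≤ B := by positivity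
  have hr : ∀ l ∈ Finset.Icc 1 k, ‖v l - u‖ ≤ B / (l : ℝ) ^ 2 + e / (1 - P.disc) := fun l hl =>
    contraction_rate (r := fun l => ‖v l - u‖) P.disc_pos.le P.disc_lt_one
      (by positivity : 0 ≤ 8 * R) he0 hV hn0 hn
      (fun l hl => H.norm_value_sub_fixed_le hdp hN hA h0 h1 hl hR0 (hRl l hl) hu)
      (fun l hl => (norm_sub_le _ _).trans (by
        have := (pi_norm_le_iff_of_nonneg hV (x := v l)).2 (hvV l hl)
        linarith)) (by rw [Finset.mem_Icc] at hl ⊢; omega)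
  have hT : 0 < epochStart (k + 1) := (Nat.zero_le _).trans_lt (epochStart_lt_succ hk)
  have hW := sum_Ioc_pos hT
  have hW2 := total_weight_ge k
  have hk0 : (0 : ℝ) < k := by exact_mod_cast hk
  set W := ∑ t ∈ Finset.Ioc 0 (epochStart (k + 1)), (t : ℝ) with hWdef
  have hxa : outputX k x s ∈ stdSimplex ℝ (Fin A) := linAvg_mem_stdSimplex hT fun t ht =>
    (H.mem_of_mem_Ioc le_rfl ht s).1
  have hya : outputY k y s ∈ P.feasible d p s := linAvg_mem₃ (hdp.convex_feasible hN s) hT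
    fun t ht => (H.mem_of_mem_Ioc le_rfl ht s).2
  have gap : ∀ z ∈ stdSimplex ℝ (Fin A), ∀ w ∈ P.feasible d p s,
      P.bellman s (outputX k x s) w u ≤ P.bellman s z (outputY k y s) u +
        (18 * (4 * R + 2 * B) / (k : ℝ) ^ 2 + 3 * (e / (1 - P.disc))) := by
    intro z hz w hw
    rw [← sub_le_iff_le_add']
    refine (Model.bellman_linAvg_sub hT s (fun t => x t s) (fun t => y t s) z w u).trans_le ?_
    rw [div_le_iff₀ hW]
    have step : ∀ l ∈ Finset.Icc 1 k, ∑ t ∈ Finset.Ioc (epochStart l) (epochStart (l + 1)),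
        t * (P.bellman s (x t s) w u - P.bellman s z (y t s) u) ≤ (4 * R + 2 * B) * (l : ℝ) ^ 3 +
          3 * (e / (1 - P.disc)) *
            ∑ t ∈ Finset.Ioc (epochStart l) (epochStart (l + 1)), (t : ℝ) := by
      intro l hl
      obtain ⟨hl1, hl2⟩ := Finset.mem_Icc.1 hl
      have hl0 : (0 : ℝ) < l := by exact_mod_cast hl1
      have g1 := H.sum_gap_le hdp hN hA h0 h1 hl s hz hw (hRl l hl)
      have g2 : ∑ t ∈ Finset.Ioc (epochStart l) (epochStart (l + 1)),
          t * (P.bellman s (x t s) w u - P.bellman s z (y t s) u) ≤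
          ∑ t ∈ Finset.Ioc (epochStart l) (epochStart (l + 1)),
          (t * (P.bellman s (x t s) w (v l) - P.bellman s z (y t s) (v l)) +
            t * (2 * ‖v l - u‖)) := by
        refine Finset.sum_le_sum fun t ht => ?_
        obtain ⟨m1, m2⟩ := H.mem_of_mem_Ioc (by omega) ht s
        have b1 := abs_le.1 (P.abs_bellman_sub_le hN (s := s) m1 hw.1 (v l) u)
        have b2 := abs_le.1 (P.abs_bellman_sub_le hN (s := s) hz m2.1 (v l) u)
        have b3 := mul_le_of_le_one_left (norm_nonneg (v l - u)) P.disc_lt_one.le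
        rw [← mul_add]
        refine mul_le_mul_of_nonneg_left ?_ (Nat.cast_nonneg _)
        linarith
      rw [Finset.sum_add_distrib, ← Finset.sum_mul] at g2
      have w1 := epoch_weight_le l
      have w2 : (epochStart (l + 1) : ℝ) ≤ (l : ℝ) ^ 3 := by exact_mod_cast epochStart_le l
      have w0 := (sum_Ioc_pos (epochStart_lt_succ hl1)).le
      set Wl := ∑ t ∈ Finset.Ioc (epochStart l) (epochStart (l + 1)), (t : ℝ)
      have g3 : Wl * ‖v l - u‖ ≤ B * (l : ℝ) ^ 3 + e / (1 - P.disc) * Wl := by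
        calc Wl * ‖v l - u‖ ≤ Wl * (B / (l : ℝ) ^ 2 + e / (1 - P.disc)) := by
              gcongr; exact hr l hl
          _ = B * (Wl / (l : ℝ) ^ 2) + e / (1 - P.disc) * Wl := by ring
          _ ≤ _ := by
            gcongr
            rw [div_le_iff₀ (by positivity)]
            linarith
      have g4 : e ≤ e / (1 - P.disc) := by
        rw [le_div_iff₀ hq]
        nlinarith [P.disc_pos]
      have g5 := mul_le_mul_of_nonneg_right g4 w0
      have g6 : (epochStart (l + 1) : ℝ) * (4 * R) ≤ (l : ℝ) ^ 3 * (4 * R) := by gcongr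
      linarith
    rw [sum_epochs]
    refine (Finset.sum_le_sum step).trans ?_
    rw [Finset.sum_add_distrib, ← Finset.mul_sum, ← Finset.mul_sum, ← sum_epochs,
      add_mul (18 * (4 * R + 2 * B) / (k : ℝ) ^ 2)]
    refine add_le_add_left ?_ _
    have c1 := sum_cubes_le k
    rw [mul_comm 18, mul_div_assoc, mul_assoc]
    refine mul_le_mul_of_nonneg_left (c1.trans ?_) (by positivity)
    rw [div_mul_eq_mul_div, le_div_iff₀ (by positivity)]
    calc (k : ℝ) ^ 4 * (k : ℝ) ^ 2 = (k : ℝ) ^ 6 := by ring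
      _ ≤ _ := hW2
  refine Model.upper_le hdp hN fun w hw => ?_
  have : P.bellman s (outputX k x s) w u -
      (18 * (4 * R + 2 * B) / (k : ℝ) ^ 2 + 3 * (e / (1 - P.disc))) ≤ P.robust d p u s :=
    Model.le_robust hA fun z hz =>
      (sub_le_iff_le_add.2 (gap z hz w hw)).trans (Model.bellman_le_upper hN hz hya)
  rw [hu] at this
  linarith

end IsRun

end convergence

/-! ### Mean kernels of the ambiguity set -/

section uniform

variable {X Y : Type*} [MeasurableSpace X] [MeasurableSpace Y] {N : ℕ}

/-- The uniform distribution on finitely many points. -/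
def uniformMeasure (x : Fin N → X) : Measure X := (N : ℝ≥0∞)⁻¹ • ∑ i, Measure.dirac (x i)

theorem isProbabilityMeasure_uniformMeasure (hN : 0 < N) (x : Fin N → X) :
    IsProbabilityMeasure (uniformMeasure x) := by
  refine ⟨?_⟩
  simp only [uniformMeasure, Measure.smul_apply, Measure.finsetSum_apply, measure_univ,
    Finset.sum_const, Finset.card_univ, Fintype.card_fin, smul_eq_mul, nsmul_eq_mul, mul_one]
  exact ENNReal.inv_mul_cancel (by exact_mod_cast hN.ne') (ENNReal.natCast_ne_top N)

theorem integral_uniformMeasure [MeasurableSingletonClass X] (x : Fin N → X) (f : X → ℝ) :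
    ∫ a, f a ∂uniformMeasure x = (1 / (N : ℝ)) * ∑ i, f (x i) := by
  rw [uniformMeasure, integral_smul_measure, integral_finsetSum_measure fun i _ =>
    integrable_dirac (by simp)]
  simp

theorem ae_uniformMeasure_iff [MeasurableSingletonClass X] (x : Fin N → X) {q : X → Prop} :
    (∀ᵐ a ∂uniformMeasure x, q a) ↔ ∀ i, q (x i) := by
  rw [ae_iff]
  simp [uniformMeasure, Measure.dirac_apply]

theorem map_uniformMeasure {f : X → Y} (hf : Measurable f) (x : Fin N → X) :
    (uniformMeasure x).map f = uniformMeasure fun i => f (x i) := by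
  rw [uniformMeasure, Measure.map_smul, Measure.map_finset_sum hf.aemeasurable]
  simp only [Measure.map_dirac' hf, uniformMeasure]

end uniform

theorem Metric.continuous_dist {A S : ℕ} (d : Metric) :
    Continuous fun z : (Fin A → Fin S → ℝ) × (Fin A → Fin S → ℝ) => d.dist z.1 z.2 := by
  cases d <;> unfold Metric.dist <;> fun_prop

theorem Metric.continuous_penalty {A S : ℕ} (d : Metric) :
    Continuous fun z : (Fin A → Fin S → ℝ) × (Fin A → Fin S → ℝ) => d.penalty z.1 z.2 := by
  cases d <;> unfold Metric.penalty <;> fun_prop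

theorem Metric.continuous_penalty_left {A S : ℕ} (d : Metric) (y : Fin A → Fin S → ℝ) :
    Continuous fun z => d.penalty z y := by
  cases d <;> unfold Metric.penalty <;> fun_prop

theorem Metric.continuous_budget (d : Metric) : Continuous d.budget := by
  cases d <;> unfold Metric.budget <;> fun_prop

theorem Metric.convexOn_penalty {A S : ℕ} (d : Metric) (y : Fin A → Fin S → ℝ) :
    ConvexOn ℝ Set.univ fun z => d.penalty z y :=
  ⟨convex_univ, fun _ _ _ _ _ _ ha hb hab => d.penalty_combination_le y _ _ ha hb hab⟩

section kernels

variable {N A S : ℕ}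

theorem U.isCompact : IsCompact (U A S) := by
  have : U A S = Set.pi Set.univ fun _ => stdSimplex ℝ (Fin S) := by
    ext y
    simp [U]
  rw [this]
  exact isCompact_univ_pi fun _ => isCompact_stdSimplex ℝ _

instance : CompactSpace (U A S) := isCompact_iff_compactSpace.1 U.isCompact

instance : StandardBorelSpace (U A S) :=
  MeasurableSet.standardBorel U.isCompact.isClosed.measurableSet

theorem integrable_of_compact {X E : Type*} [TopologicalSpace X] [CompactSpace X]
    [MeasurableSpace X] [OpensMeasurableSpace X] [SecondCountableTopology X]
    [NormedAddCommGroup E] (μ : Measure X) [IsFiniteMeasure μ] {f : X → E} (hf : Continuous f) :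
    Integrable f μ := by
  obtain ⟨C, hC⟩ := isCompact_univ.exists_bound_of_continuousOn hf.continuousOn
  exact Integrable.of_bound
    ((hf.stronglyMeasurable_of_hasCompactSupport (.of_compactSpace f)).aestronglyMeasurable) C
    (.of_forall fun x => hC x trivial)

/-- The mean of a distribution on the kernels. -/
def meanOf (μ : Measure (U A S)) : Fin A → Fin S → ℝ := ∫ y, (y : Fin A → Fin S → ℝ) ∂μ

theorem meanOf_apply (μ : Measure (U A S)) [IsFiniteMeasure μ] (a : Fin A) (s : Fin S) :
    meanOf μ a s = ∫ y : U A S, (y : Fin A → Fin S → ℝ) a s ∂μ := by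
  rw [meanOf, eval_integral, eval_integral]
  · exact fun i => integrable_of_compact μ ((continuous_apply_apply a i).comp continuous_subtype_val)
  · exact fun i => integrable_of_compact μ ((continuous_apply i).comp continuous_subtype_val)

theorem meanOf_mem (μ : Measure (U A S)) [IsProbabilityMeasure μ] : meanOf μ ∈ U A S :=
  U.convex.integral_mem U.isCompact.isClosed (.of_forall fun y => y.2)
    (integrable_of_compact μ continuous_subtype_val)

theorem meanOf_uniformMeasure (hN : 0 < N) (y : Fin N → U A S) :
    meanOf (uniformMeasure y) = meanKernel fun i => (y i : Fin A → Fin S → ℝ) := by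
  have := isProbabilityMeasure_uniformMeasure hN y
  ext a s
  rw [meanOf_apply, integral_uniformMeasure]
  rfl

/-- Bounds for the type-`p` norm of the distance under a coupling, in terms of the penalty. -/
theorem eLpNorm_dist_le_iff {d : Metric} {p : ℝ≥0∞} (h : Admissible d p) (hp : p ≠ ⊤)
    (κ : Measure (U A S × U A S)) [IsProbabilityMeasure κ] {θ : ℝ} (hθ : 0 ≤ θ) :
    eLpNorm (fun z : U A S × U A S => d.dist (z.1 : Fin A → Fin S → ℝ) z.2) p κ ≤
      ENNReal.ofReal θ ↔
    ∫ z : U A S × U A S, d.penalty (z.1 : Fin A → Fin S → ℝ) z.2 ∂κ ≤ d.budget θ := by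
  have hp0 : p ≠ 0 := by
    rcases h with ⟨-, rfl | rfl⟩ | ⟨-, rfl | rfl⟩ | ⟨-, rfl | rfl⟩ <;> simp
  have hpr : 0 < p.toReal := ENNReal.toReal_pos hp0 hp
  have hc : Continuous fun z : U A S × U A S => d.dist (z.1 : Fin A → Fin S → ℝ) z.2 :=
    d.continuous_dist.comp (continuous_subtype_val.prodMap continuous_subtype_val)
  obtain ⟨C, hC⟩ := isCompact_univ.exists_bound_of_continuousOn hc.continuousOn
  have hm : MemLp (fun z : U A S × U A S => d.dist (z.1 : Fin A → Fin S → ℝ) z.2) p κ :=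
    MemLp.of_bound (integrable_of_compact κ hc).aestronglyMeasurable C
      (.of_forall fun z => hC z trivial)
  rw [hm.eLpNorm_eq_integral_rpow_norm hp0 hp, ENNReal.ofReal_le_ofReal_iff hθ]
  simp only [Real.norm_of_nonneg (Metric.dist_nonneg d _ _), h.dist_rpow hp]
  rw [Real.rpow_inv_le_iff_of_pos (integral_nonneg fun z => d.penalty_nonneg _ _) hθ hpr,
    h.budget_eq hp]

/-- The same for `p = ∞`. -/
theorem eLpNorm_top_dist_le_iff {d : Metric} (κ : Measure (U A S × U A S)) {θ : ℝ} (hθ : 0 ≤ θ) :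
    eLpNorm (fun z : U A S × U A S => d.dist (z.1 : Fin A → Fin S → ℝ) z.2) ⊤ κ ≤
      ENNReal.ofReal θ ↔
    ∀ᵐ z ∂κ, d.penalty (z.1 : Fin A → Fin S → ℝ) z.2 ≤ d.budget θ := by
  have e : ∀ z : U A S × U A S, ‖d.dist (z.1 : Fin A → Fin S → ℝ) z.2‖ₑ ≤ ENNReal.ofReal θ ↔
      d.penalty (z.1 : Fin A → Fin S → ℝ) z.2 ≤ d.budget θ := fun z => by
    rw [Real.enorm_of_nonneg (d.dist_nonneg _ _), ENNReal.ofReal_le_ofReal_iff hθ,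
      d.dist_le_iff _ _ hθ]
  rw [eLpNorm_exponent_top]
  constructor
  · intro h
    filter_upwards [enorm_ae_le_eLpNormEssSup
      (fun z : U A S × U A S => d.dist (z.1 : Fin A → Fin S → ℝ) z.2) κ] with z hz
    exact (e z).1 (hz.trans h)
  · intro h
    refine essSup_le_of_ae_le _ ?_
    filter_upwards [h] with z hz
    exact (e z).2 hz

/-- A coupling with a uniform distribution on `N` points splits a distribution into `N` parts of
mass `1 / N`, one for each point. -/
theorem exists_conditional (hN : 0 < N) {y : Fin N → U A S} {κ : Measure (U A S × U A S)}
    [IsProbabilityMeasure κ] (hκ : κ.snd = uniformMeasure y) :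
    ∃ q : Fin N → Measure (U A S), (∀ i, IsProbabilityMeasure (q i)) ∧
      (∀ f : U A S × U A S → ℝ, Continuous f →
        ∫ z, f z ∂κ = (1 / (N : ℝ)) * ∑ i, ∫ b, f (b, y i) ∂q i) ∧
      ∀ r : U A S × U A S → Prop, (∀ᵐ z ∂κ, r z) → ∀ i, ∀ᵐ b ∂q i, r (b, y i) := by
  have : Nonempty (U A S) := ⟨y ⟨0, hN⟩⟩
  set ρ := κ.map Prod.swap with hρ
  have hρp : IsProbabilityMeasure ρ := Measure.isProbabilityMeasure_map measurable_swap.aemeasurable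
  have hfst : ρ.fst = uniformMeasure y := by rw [hρ, Measure.fst_map_swap, hκ]
  obtain ⟨k, hk, hdis⟩ : ∃ k : ProbabilityTheory.Kernel (U A S) (U A S),
      ProbabilityTheory.IsMarkovKernel k ∧ (uniformMeasure y).compProd k = ρ :=
    ⟨ρ.condKernel, inferInstance, by rw [← hfst]; exact ρ.disintegrate ρ.condKernel⟩
  have := isProbabilityMeasure_uniformMeasure hN y
  refine ⟨fun i => k (y i), fun i => inferInstance, fun f hf => ?_, fun r hr => ?_⟩
  · have h1 : ∫ z, f z ∂κ = ∫ z, f z.swap ∂ρ := by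
      rw [hρ, integral_map measurable_swap.aemeasurable]
      · simp
      · exact (integrable_of_compact _ (hf.comp continuous_swap)).aestronglyMeasurable
    have hi : Integrable (fun z : U A S × U A S => f z.swap) ((uniformMeasure y).compProd k) := by
      rw [hdis]
      exact integrable_of_compact ρ (hf.comp continuous_swap)
    rw [h1, ← hdis, Measure.integral_compProd hi, integral_uniformMeasure]
    rfl
  · have h1 : ∀ᵐ z ∂ρ, r z.swap := by
      rw [hρ]
      exact (MeasurableEquiv.prodComm.measurableEmbedding.ae_map_iff).2 hr
    rw [← hdis] at h1
    exact (ae_uniformMeasure_iff y).1 (Measure.ae_ae_of_ae_compProd h1)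

theorem continuous_meanKernel :
    Continuous (meanKernel : (Fin N → Fin A → Fin S → ℝ) → Fin A → Fin S → ℝ) := by
  unfold meanKernel
  fun_prop

theorem exists_mean_of_approx {Φ : (Fin N → Fin A → Fin S → ℝ) → ℝ} (hΦ : Continuous Φ)
    {m : Fin A → Fin S → ℝ} {b : ℝ → ℝ} (hb : Continuous b) {θ : ℝ}
    (h : ∀ η > 0, ∃ w : Fin N → Fin A → Fin S → ℝ, (∀ i, w i ∈ U A S) ∧ meanKernel w = m ∧
      Φ w ≤ b (θ + η)) :
    ∃ w : Fin N → Fin A → Fin S → ℝ, (∀ i, w i ∈ U A S) ∧ meanKernel w = m ∧ Φ w ≤ b θ := by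
  have hK : IsCompact ((Set.pi Set.univ fun _ : Fin N => U A S) ∩ meanKernel ⁻¹' {m}) :=
    (isCompact_univ_pi fun _ => U.isCompact).inter_right
      (isClosed_singleton.preimage continuous_meanKernel)
  obtain ⟨w₁, h1, h2, -⟩ := h 1 one_pos
  obtain ⟨w, ⟨hw1, hw2⟩, hmin⟩ := hK.exists_isMinOn ⟨w₁, fun i _ => h1 i, h2⟩ hΦ.continuousOn
  refine ⟨w, fun i => hw1 i trivial, hw2, ?_⟩
  have hlim : Filter.Tendsto (fun η => b (θ + η)) (nhdsWithin 0 (Set.Ioi 0)) (nhds (b θ)) := by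
    have : Filter.Tendsto (fun η => b (θ + η)) (nhds 0) (nhds (b (θ + 0))) :=
      (hb.comp (continuous_const.add continuous_id)).tendsto 0
    rw [add_zero] at this
    exact this.mono_left nhdsWithin_le_nhds
  refine ge_of_tendsto hlim ?_
  filter_upwards [self_mem_nhdsWithin] with η hη
  obtain ⟨w', k1, k2, k3⟩ := h η hη
  exact (hmin ⟨fun i _ => k1 i, k2⟩).trans k3

end kernels

section ball

variable {N A S : ℕ} {P : Model N A S} {d : Metric} {p : ℝ≥0∞}

/-- The conditional means, given the observations, under a coupling with the nominal distribution.
By Jensen's inequality they are no farther from the observations than the coupled kernels. -/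
theorem exists_mean_of_coupling (hN : 0 < N) {s : Fin S} {κ : Measure (U A S × U A S)}
    [IsProbabilityMeasure κ] (d : Metric) (h2 : κ.snd = P.nominal s) :
    ∃ w : Fin N → Fin A → Fin S → ℝ, (∀ i, w i ∈ U A S) ∧ meanKernel w = meanOf κ.fst ∧
      (1 / (N : ℝ)) * ∑ i, d.penalty (w i) (P.sample i s) ≤
        ∫ z : U A S × U A S, d.penalty (z.1 : Fin A → Fin S → ℝ) z.2 ∂κ ∧
      ∀ r, (∀ᵐ z ∂κ, d.penalty ((z.1 : U A S) : Fin A → Fin S → ℝ) (z.2 : U A S) ≤ r) →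
        ∀ i, d.penalty (w i) (P.sample i s) ≤ r := by
  have hcont₂ : Continuous fun z : U A S × U A S => d.penalty (z.1 : Fin A → Fin S → ℝ) z.2 :=
    d.continuous_penalty.comp (continuous_subtype_val.prodMap continuous_subtype_val)
  obtain ⟨q, hq, hq1, hq2⟩ := exists_conditional hN
    (y := fun i => ⟨P.sample i s, P.sample_mem i s⟩) h2
  have hc : ∀ i, Continuous fun z => d.penalty z (P.sample i s) := fun i =>
    d.continuous_penalty_left (P.sample i s)
  have hjensen : ∀ i, d.penalty (meanOf (q i)) (P.sample i s) ≤
      ∫ b : U A S, d.penalty (b : Fin A → Fin S → ℝ) (P.sample i s) ∂q i := fun i =>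
    (d.convexOn_penalty (P.sample i s)).map_integral_le (hc i).continuousOn isClosed_univ
      (.of_forall fun _ => trivial) (integrable_of_compact (q i) continuous_subtype_val)
      (integrable_of_compact (q i) ((hc i).comp continuous_subtype_val))
  refine ⟨fun i => meanOf (q i), fun i => meanOf_mem _, ?_, ?_, fun r hr i => ?_⟩
  · ext a s'
    have hc : Continuous fun z : U A S × U A S => (z.1 : Fin A → Fin S → ℝ) a s' :=
      (continuous_apply_apply a s').comp (continuous_subtype_val.comp continuous_fst)
    have hc' : Continuous fun b : U A S => (b : Fin A → Fin S → ℝ) a s' :=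
      (continuous_apply_apply a s').comp continuous_subtype_val
    rw [meanOf_apply, Measure.fst,
      integral_map measurable_fst.aemeasurable hc'.aestronglyMeasurable, hq1 _ hc]
    simp only [meanKernel, meanOf_apply]
  · rw [hq1 _ hcont₂]
    gcongr with i
    exact hjensen i
  · refine (hjensen i).trans ?_
    calc ∫ b : U A S, d.penalty (b : Fin A → Fin S → ℝ) (P.sample i s) ∂q i ≤ ∫ _b, r ∂q i :=
          integral_mono_ae (integrable_of_compact (q i) ((hc i).comp continuous_subtype_val))
            (integrable_const r) (hq2 _ hr i)
      _ = r := by simp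

/-- Couplings that are optimal up to `η`. -/
theorem exists_coupling {s : Fin S} {μ : Measure (U A S)}
    [IsProbabilityMeasure μ] (hμ : wasserstein d p μ (P.nominal s) ≤ ENNReal.ofReal P.radius)
    {η : ℝ} (hη : 0 < η) : ∃ κ : Measure (U A S × U A S), IsProbabilityMeasure κ ∧
      κ.fst = μ ∧ κ.snd = P.nominal s ∧
      eLpNorm (fun z : U A S × U A S => d.dist (z.1 : Fin A → Fin S → ℝ) z.2) p κ ≤
        ENNReal.ofReal (P.radius + η) := by
  have hlt : wasserstein d p μ (P.nominal s) < ENNReal.ofReal (P.radius + η) :=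
    hμ.trans_lt ((ENNReal.ofReal_lt_ofReal_iff (by linarith [P.radius_nonneg])).2 (by linarith))
  obtain ⟨⟨κ, h1, h2⟩, hκ⟩ := iInf_lt_iff.1 hlt
  refine ⟨κ, ⟨?_⟩, h1, h2, hκ.le⟩
  rw [← Measure.fst_univ, h1, measure_univ]

/-- Every distribution in the Wasserstein ball has the mean of a feasible family of kernels: the
conditional means, given the observations, under a coupling. Jensen's inequality shows that they
are no farther from the observations; a compactness argument spares the existence of optimal
couplings. -/
theorem exists_feasible_mean (hdp : Admissible d p) (hN : 0 < N) {s : Fin S} {μ : Measure (U A S)}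
    [IsProbabilityMeasure μ] (hμ : wasserstein d p μ (P.nominal s) ≤ ENNReal.ofReal P.radius) :
    ∃ w ∈ P.feasible d p s, meanKernel w = meanOf μ := by
  have hN' : (0 : ℝ) < N := by exact_mod_cast hN
  have hcont : ∀ i, Continuous fun w : Fin N → Fin A → Fin S → ℝ =>
      d.penalty (w i) (P.sample i s) := fun i =>
    (d.continuous_penalty_left (P.sample i s)).comp (continuous_apply i)
  by_cases hp : p = ⊤
  · subst hp
    obtain ⟨w, h1, h2, h3⟩ := exists_mean_of_approx (m := meanOf μ) (θ := P.radius)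
      (Φ := fun w : Fin N → Fin A → Fin S → ℝ => ‖fun i => d.penalty (w i) (P.sample i s)‖)
      (continuous_pi hcont).norm d.continuous_budget fun η hη => by
        have hθ : 0 ≤ P.radius + η := by linarith [P.radius_nonneg, hη.lt]
        obtain ⟨κ, hκ, e1, e2, h3⟩ := exists_coupling hμ hη
        obtain ⟨w, h1, h2, -, h4⟩ := exists_mean_of_coupling hN d e2
        rw [e1] at h2
        refine ⟨w, h1, h2, (pi_norm_le_iff_of_nonneg (d.budget_nonneg hθ)).2 fun i => ?_⟩
        rw [Real.norm_of_nonneg (d.penalty_nonneg _ _)]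
        exact h4 _ ((eLpNorm_top_dist_le_iff κ hθ).1 h3) i
    refine ⟨w, P.mem_feasible_top_iff.2 ⟨h1, fun i => ?_⟩, h2⟩
    have := (pi_norm_le_iff_of_nonneg (d.budget_nonneg P.radius_nonneg)).1 h3 i
    rwa [Real.norm_of_nonneg (d.penalty_nonneg _ _)] at this
  · obtain ⟨w, h1, h2, h3⟩ := exists_mean_of_approx (m := meanOf μ) (θ := P.radius)
      (Φ := fun w : Fin N → Fin A → Fin S → ℝ =>
        (1 / (N : ℝ)) * ∑ i, d.penalty (w i) (P.sample i s))
      (continuous_const.mul (continuous_finsetSum _ fun i _ => hcont i)) d.continuous_budget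
      fun η hη => by
        have hθ : 0 ≤ P.radius + η := by linarith [P.radius_nonneg, hη.lt]
        obtain ⟨κ, hκ, e1, e2, h3⟩ := exists_coupling hμ hη
        obtain ⟨w, h1, h2, h4, -⟩ := exists_mean_of_coupling hN d e2
        rw [e1] at h2
        exact ⟨w, h1, h2, h4.trans ((eLpNorm_dist_le_iff hdp hp κ hθ).1 h3)⟩
    refine ⟨w, (P.mem_feasible_iff hdp hp hN).2 ⟨h1, ?_⟩, h2⟩
    rwa [one_div, inv_mul_le_iff₀ hN'] at h3

/-- Conversely, the uniform distribution on a feasible family of kernels is in the ball. -/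
theorem wasserstein_uniformMeasure_le (hdp : Admissible d p) (hN : 0 < N) {s : Fin S}
    {w : Fin N → U A S} (hw : (fun i => (w i : Fin A → Fin S → ℝ)) ∈ P.feasible d p s) :
    wasserstein d p (uniformMeasure w) (P.nominal s) ≤ ENNReal.ofReal P.radius := by
  have hN' : (0 : ℝ) < N := by exact_mod_cast hN
  let y : Fin N → U A S := fun i => ⟨P.sample i s, P.sample_mem i s⟩
  let κ : Measure (U A S × U A S) := uniformMeasure fun i => (w i, y i)
  have hκ : IsProbabilityMeasure κ := isProbabilityMeasure_uniformMeasure hN _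
  refine (iInf_le _ ⟨κ, map_uniformMeasure measurable_fst _,
    map_uniformMeasure measurable_snd _⟩).trans ?_
  by_cases hp : p = ⊤
  · subst hp
    exact (eLpNorm_top_dist_le_iff κ P.radius_nonneg).2
      ((ae_uniformMeasure_iff _).2 (P.mem_feasible_top_iff.1 hw).2)
  · refine (eLpNorm_dist_le_iff hdp hp κ P.radius_nonneg).2 ?_
    rw [integral_uniformMeasure, one_div, inv_mul_le_iff₀ hN']
    exact ((P.mem_feasible_iff hdp hp hN).1 hw).2

end ball

/-! ### Robust policy evaluation -/

/-- Discounted sums telescope. -/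
theorem tsum_discounted_le {q : ℝ} (hq0 : 0 ≤ q) (hq1 : q < 1) {f g : ℕ → ℝ} {γ K L : ℝ}
    (hf : ∀ t, |f t| ≤ K) (hg : ∀ t, |g t| ≤ L) (h : ∀ t, f t + q * g (t + 1) ≤ g t + γ) :
    ∑' t, q ^ t * f t ≤ g 0 + γ / (1 - q) := by
  have hgeo := summable_geometric_of_lt_one hq0 hq1
  have hsum : Summable fun t => q ^ t * f t :=
    Summable.of_norm_bounded (hgeo.mul_right K) fun t => by
      rw [norm_mul, Real.norm_eq_abs, Real.norm_eq_abs, abs_of_nonneg (pow_nonneg hq0 t)]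
      exact mul_le_mul_of_nonneg_left (hf t) (pow_nonneg hq0 t)
  have hpart : ∀ n, ∑ t ∈ Finset.range n, q ^ t * f t + q ^ n * g n ≤
      g 0 + γ * ∑ t ∈ Finset.range n, q ^ t := by
    intro n
    induction n with
    | zero => simp
    | succ n ih =>
      rw [Finset.sum_range_succ, Finset.sum_range_succ, pow_succ]
      have := mul_le_mul_of_nonneg_left (h n) (pow_nonneg hq0 n)
      linarith
  have hlim0 : Filter.Tendsto (fun n => q ^ n * g n) Filter.atTop (nhds 0) := by
    refine squeeze_zero_norm (a := fun n => q ^ n * L) (fun n => ?_) ?_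
    · rw [norm_mul, Real.norm_eq_abs, Real.norm_eq_abs, abs_of_nonneg (pow_nonneg hq0 n)]
      exact mul_le_mul_of_nonneg_left (hg n) (pow_nonneg hq0 n)
    · simpa using (tendsto_pow_atTop_nhds_zero_of_lt_one hq0 hq1).mul_const L
  have h1 := hsum.hasSum.tendsto_sum_nat.add hlim0
  have h2 := (hgeo.hasSum.tendsto_sum_nat.const_mul γ).const_add (g 0)
  rw [tsum_geometric_of_lt_one hq0 hq1] at h2
  have := le_of_tendsto_of_tendsto' h1 h2 hpart
  rwa [add_zero, ← div_eq_mul_inv] at this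

section evaluation

variable {N A S : ℕ} {P : Model N A S} {d : Metric} {p : ℝ≥0∞}

theorem stateLaw_succ (P : Model N A S) (x : Fin S → Fin A → ℝ) (μ : Fin S → Measure (U A S))
    [∀ s, IsProbabilityMeasure (μ s)] (t : ℕ) (s' : Fin S) :
    P.stateLaw x μ (t + 1) s' =
      ∑ s, P.stateLaw x μ t s * ∑ a, x s a * meanOf (μ s) a s' := by
  simp only [Model.stateLaw]
  refine Finset.sum_congr rfl fun s _ => ?_
  rw [integral_finsetSum]
  · simp only [integral_const_mul, meanOf_apply]
  · exact fun a _ => (integrable_of_compact (μ s)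
      ((continuous_apply_apply a s').comp continuous_subtype_val)).const_mul _

theorem stateLaw_mem {x : Fin S → Fin A → ℝ} (hx : x ∈ P.policies) (μ : Fin S → Measure (U A S))
    [∀ s, IsProbabilityMeasure (μ s)] (t : ℕ) : P.stateLaw x μ t ∈ stdSimplex ℝ (Fin S) := by
  induction t with
  | zero => exact P.init_mem
  | succ t ih =>
    refine ⟨fun s' => ?_, ?_⟩
    · rw [stateLaw_succ]
      exact Finset.sum_nonneg fun s _ => mul_nonneg (ih.1 s) (Finset.sum_nonneg fun a _ =>
        mul_nonneg ((hx s).1 a) ((meanOf_mem (μ s) a).1 s'))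
    · simp only [stateLaw_succ]
      rw [Finset.sum_comm]
      simp only [← Finset.mul_sum]
      refine Eq.trans (Finset.sum_congr rfl fun s _ => ?_) ih.2
      rw [Finset.sum_comm]
      simp only [← Finset.mul_sum, (meanOf_mem (μ s) _).2, mul_one, (hx s).2]

/-- The Bellman update with a mean kernel. -/
def Model.update (P : Model N A S) (x : Fin S → Fin A → ℝ) (m : Fin S → Fin A → Fin S → ℝ)
    (u : Fin S → ℝ) (s : Fin S) : ℝ :=
  ∑ a, x s a * (P.cost s a + P.disc * ∑ s', m s a s' * u s')

theorem stateLaw_update (P : Model N A S) (x : Fin S → Fin A → ℝ) (μ : Fin S → Measure (U A S))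
    [∀ s, IsProbabilityMeasure (μ s)] (u : Fin S → ℝ) (t : ℕ) :
    ∑ s, P.stateLaw x μ t s * ∑ a, x s a * P.cost s a +
      P.disc * ∑ s', P.stateLaw x μ (t + 1) s' * u s' =
    ∑ s, P.stateLaw x μ t s * P.update x (fun s => meanOf (μ s)) u s := by
  simp only [stateLaw_succ, Finset.sum_mul, Finset.mul_sum, Model.update, mul_add,
    Finset.sum_add_distrib]
  congr 1
  rw [Finset.sum_comm]
  refine Finset.sum_congr rfl fun s _ => ?_
  rw [Finset.sum_comm]
  exact Finset.sum_congr rfl fun a _ => Finset.sum_congr rfl fun s' _ => by ring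

theorem abs_expected_le {x : Fin S → Fin A → ℝ} (hx : x ∈ P.policies) {K : ℝ}
    (hc : ∀ s a, |P.cost s a| ≤ K) {μ : Fin S → Measure (U A S)}
    [∀ s, IsProbabilityMeasure (μ s)] (t : ℕ) :
    |∑ s, P.stateLaw x μ t s * ∑ a, x s a * P.cost s a| ≤ K :=
  abs_sum_simplex_le (stateLaw_mem hx μ t) fun s => abs_sum_simplex_le (hx s) (hc s)

theorem Model.exists_abs_cost_le (P : Model N A S) : ∃ K, ∀ s a, |P.cost s a| ≤ K :=
  ⟨‖P.cost‖, fun s a => (norm_le_pi_norm (P.cost s) a).trans (norm_le_pi_norm P.cost s)⟩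

theorem expectedCost_le {x : Fin S → Fin A → ℝ} (hx : x ∈ P.policies)
    (μ : Fin S → Measure (U A S)) [∀ s, IsProbabilityMeasure (μ s)] {u : Fin S → ℝ} {γ : ℝ}
    (h : ∀ s, P.update x (fun s => meanOf (μ s)) u s ≤ u s + γ) :
    P.expectedCost x μ ≤ ∑ s, P.init s * u s + γ / (1 - P.disc) := by
  obtain ⟨K, hK⟩ := P.exists_abs_cost_le
  refine tsum_discounted_le (g := fun t => ∑ s, P.stateLaw x μ t s * u s) P.disc_pos.le
    P.disc_lt_one (fun t => abs_expected_le hx hK t)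
    (fun t => abs_sum_simplex_le (stateLaw_mem hx μ t) fun s => norm_le_pi_norm u s) fun t => ?_
  rw [stateLaw_update]
  calc ∑ s, P.stateLaw x μ t s * P.update x (fun s => meanOf (μ s)) u s ≤
        ∑ s, P.stateLaw x μ t s * (u s + γ) := Finset.sum_le_sum fun s _ =>
          mul_le_mul_of_nonneg_left (h s) ((stateLaw_mem hx μ t).1 s)
    _ = _ := by
      simp only [mul_add, Finset.sum_add_distrib]
      rw [← Finset.sum_mul, (stateLaw_mem hx μ t).2, one_mul]

theorem le_expectedCost {x : Fin S → Fin A → ℝ} (hx : x ∈ P.policies)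
    (μ : Fin S → Measure (U A S)) [∀ s, IsProbabilityMeasure (μ s)] {u : Fin S → ℝ} {γ : ℝ}
    (h : ∀ s, u s - γ ≤ P.update x (fun s => meanOf (μ s)) u s) :
    ∑ s, P.init s * u s - γ / (1 - P.disc) ≤ P.expectedCost x μ := by
  obtain ⟨K, hK⟩ := P.exists_abs_cost_le
  have key := tsum_discounted_le (f := fun t => -∑ s, P.stateLaw x μ t s * ∑ a, x s a * P.cost s a)
    (g := fun t => -∑ s, P.stateLaw x μ t s * u s) (γ := γ) P.disc_pos.le
    P.disc_lt_one (fun t => by rw [abs_neg]; exact abs_expected_le hx hK t)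
    (fun t => by
      rw [abs_neg]
      exact abs_sum_simplex_le (stateLaw_mem hx μ t) fun s => norm_le_pi_norm u s) fun t => by
      have h1 := stateLaw_update P x μ u t
      have h2 : ∑ s, P.stateLaw x μ t s * (u s - γ) ≤
          ∑ s, P.stateLaw x μ t s * P.update x (fun s => meanOf (μ s)) u s :=
        Finset.sum_le_sum fun s _ =>
          mul_le_mul_of_nonneg_left (h s) ((stateLaw_mem hx μ t).1 s)
      simp only [mul_sub, Finset.sum_sub_distrib] at h2
      rw [← Finset.sum_mul, (stateLaw_mem hx μ t).2, one_mul] at h2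
      linarith
  simp only [mul_neg, tsum_neg] at key
  have e : P.expectedCost x μ =
    ∑' t, P.disc ^ t * ∑ s, P.stateLaw x μ t s * ∑ a, x s a * P.cost s a := rfl
  have e0 : P.stateLaw x μ 0 = P.init := rfl
  rw [← e, e0] at key
  linarith

theorem bddAbove_expectedCost {x : Fin S → Fin A → ℝ} (hx : x ∈ P.policies) :
    BddAbove ((fun μ => P.expectedCost x μ) '' P.ambiguitySet d p) := by
  obtain ⟨K, hK⟩ := P.exists_abs_cost_le
  refine ⟨∑ s, P.init s * (0 : Fin S → ℝ) s + K / (1 - P.disc), ?_⟩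
  rintro _ ⟨μ, hμ, rfl⟩
  have : ∀ s, IsProbabilityMeasure (μ s) := fun s => (hμ s).1
  refine expectedCost_le hx μ fun s => ?_
  simp only [Model.update, Pi.zero_apply, mul_zero, Finset.sum_const_zero, add_zero, zero_add]
  exact (le_abs_self _).trans (abs_sum_simplex_le (hx s) (hK s))

/-- Feasible families of kernels as members of the ambiguity set. -/
theorem exists_mem_ambiguitySet (hdp : Admissible d p) (hN : 0 < N)
    {w : Fin S → Fin N → Fin A → Fin S → ℝ} (hw : ∀ s, w s ∈ P.feasible d p s) :
    ∃ μ ∈ P.ambiguitySet d p, ∀ s, meanOf (μ s) = meanKernel (w s) :=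
  ⟨fun s => uniformMeasure fun i => ⟨w s i, (hw s).1 i⟩, fun s =>
    ⟨isProbabilityMeasure_uniformMeasure hN _, wasserstein_uniformMeasure_le hdp hN (hw s)⟩,
    fun _ => meanOf_uniformMeasure hN _⟩

/-- A policy that solves the robust Bellman equation up to `γ` is optimal up to `γ / (1 - λ)`. -/
theorem isEpsOptimal_of_upper_le (hdp : Admissible d p) (hN : 0 < N)
    {u : Fin S → ℝ} (hu : P.robust d p u = u) {x : Fin S → Fin A → ℝ} (hx : x ∈ P.policies) {γ ε : ℝ}
    (h : ∀ s, P.upper d p s (x s) u ≤ u s + γ) (hε : γ / (1 - P.disc) ≤ ε) :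
    P.IsEpsOptimal d p ε x := by
  have hq : 0 < 1 - P.disc := sub_pos.2 P.disc_lt_one
  refine ⟨hx, fun x' hx' => ?_⟩
  have h1 : P.worstCost d p x ≤ ∑ s, P.init s * u s + γ / (1 - P.disc) := by
    obtain ⟨μ₀, hμ₀, -⟩ := exists_mem_ambiguitySet hdp hN (P := P)
      fun s => hdp.sample_mem_feasible hN s
    refine csSup_le ⟨_, μ₀, hμ₀, rfl⟩ ?_
    rintro _ ⟨μ, hμ, rfl⟩
    have : ∀ s, IsProbabilityMeasure (μ s) := fun s => (hμ s).1
    refine expectedCost_le hx μ fun s => ?_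
    obtain ⟨w, hw, hm⟩ := exists_feasible_mean hdp hN (hμ s).2
    have := Model.bellman_le_upper hN (hx s) hw (v := u)
    refine le_trans (le_of_eq ?_) (this.trans (h s))
    simp only [Model.update, ← hm]
    rfl
  refine le_of_forall_pos_le_add fun η hη => ?_
  have h2 : ∀ s, ∃ w ∈ P.feasible d p s, u s - η * (1 - P.disc) ≤ P.bellman s (x' s) w u := by
    intro s
    by_contra! hcon
    have k1 := Model.upper_le hdp hN fun w hw => (hcon w hw).le
    have k2 := Model.robust_le_upper (P := P) (s := s) hdp hN (hx' s) (v := u)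
    rw [hu] at k2
    linarith [mul_pos hη hq]
  choose w hw hwu using h2
  obtain ⟨μ, hμ, hm⟩ := exists_mem_ambiguitySet hdp hN hw
  have : ∀ s, IsProbabilityMeasure (μ s) := fun s => (hμ s).1
  have h3 : ∑ s, P.init s * u s - η * (1 - P.disc) / (1 - P.disc) ≤ P.expectedCost x' μ := by
    refine le_expectedCost hx' μ fun s => (hwu s).trans (le_of_eq ?_)
    simp only [Model.update, hm]
    rfl
  rw [mul_div_cancel_right₀ _ hq.ne'] at h3
  have h4 : P.expectedCost x' μ ≤ P.worstCost d p x' :=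
    le_csSup (bddAbove_expectedCost hx') ⟨μ, hμ, rfl⟩
  linarith

end evaluation

/-! ### The number of operations -/

theorem rowDepth_le {n : ℕ} (hn : 0 < n) {l : ℝ} (hl : 1 ≤ 2 * l) (h : Real.log n ≤ l) :
    (rowDepth n : ℝ) ≤ 8 * l := by
  have h2 : (1 : ℝ) / 2 < Real.log 2 := by linarith [Real.log_two_gt_d9]
  have h1 : (2 : ℝ) ^ Nat.log 2 (4 * n) ≤ 4 * n := by
    exact_mod_cast Nat.pow_log_le_self 2 (by omega : 4 * n ≠ 0)
  have h3 := Real.log_le_log (by positivity) h1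
  have hn' : (n : ℝ) ≠ 0 := by exact_mod_cast hn.ne'
  rw [Real.log_pow, Real.log_mul (by norm_num) hn', show (4 : ℝ) = 2 ^ 2 by norm_num,
    Real.log_pow] at h3
  push_cast at h3
  rw [rowDepth]
  push_cast
  have h4 : (((Nat.log 2 (4 * n) : ℕ) : ℝ) - 2) * Real.log 2 ≤ l := by linarith
  have h5 : ((Nat.log 2 (4 * n) : ℕ) : ℝ) - 2 ≤ 2 * l := by
    by_contra! hc
    nlinarith
  linarith

/-- An exponent `j` of logarithmic size with `X ≤ 2 ^ j`. -/
theorem exists_two_pow_ge {X : ℝ} (hX : 1 ≤ X) :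
    ∃ j : ℕ, X ≤ 2 ^ j ∧ (j : ℝ) ≤ 2 * Real.log X + 1 := by
  have h2 : (1 : ℝ) / 2 < Real.log 2 := by linarith [Real.log_two_gt_d9]
  have h0 : 0 ≤ Real.log X := Real.log_nonneg hX
  refine ⟨⌈2 * Real.log X⌉₊, ?_, (Nat.ceil_lt_add_one (by positivity)).le⟩
  rw [← Real.log_le_log_iff (by positivity) (by positivity), Real.log_pow]
  have := Nat.le_ceil (2 * Real.log X)
  nlinarith

theorem cost_le (d : Metric) {j N A S : ℕ} (hN : 0 < N) (hA : 0 < A) (hS : 0 < S) {l : ℝ}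
    (hl : 1 ≤ 2 * l) (hlA : Real.log A ≤ l) (hlS : Real.log S ≤ l) :
    ((iterationCost d j N A S + 44 * (S * (N * (A * S))) : ℕ) : ℝ) ≤
      1000 * (S * (N * (A * S)) * l) * ((j + 1) * d.innerSteps j) := by
  have hA1 : (1 : ℝ) ≤ A := by exact_mod_cast hA
  have hN1 : (1 : ℝ) ≤ N := by exact_mod_cast hN
  have hS1 : (1 : ℝ) ≤ S := by exact_mod_cast hS
  have hj0 : (0 : ℝ) ≤ j := Nat.cast_nonneg _
  have hI : (1 : ℝ) ≤ d.innerSteps j := by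
    have : 1 ≤ d.innerSteps j := by cases d <;> simp [Metric.innerSteps]
    exact_mod_cast this
  have hl0 : 0 < l := by linarith
  have rA := rowDepth_le hA hl hlA
  have rS := rowDepth_le hS hl hlS
  have hrow : ∀ n : ℕ, (rowDepth n : ℝ) ≤ 8 * l → (rowCost n : ℝ) ≤ n * (200 * l) := fun n h => by
    rw [rowCost]
    push_cast
    gcongr
    linarith
  have cA := hrow A rA
  have cS := hrow S rS
  set I : ℝ := ((d.innerSteps j : ℕ) : ℝ)
  have hD : (1 : ℝ) ≤ A * S := one_le_mul_of_one_le_of_one_le hA1 hS1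
  have hND : (1 : ℝ) ≤ N * (A * S) := one_le_mul_of_one_le_of_one_le hN1 hD
  have hJI : 1 ≤ ((j : ℝ) + 1) * I := one_le_mul_of_one_le_of_one_le (by linarith) hI
  have kc : (kernelCost A S : ℝ) ≤ 260 * (A * S * l) := by
    rw [kernelCost]
    push_cast
    have := mul_le_mul_of_nonneg_left cS (by positivity : (0 : ℝ) ≤ A)
    have := mul_le_mul_of_nonneg_left hl (by positivity : (0 : ℝ) ≤ A * S)
    linarith
  have cc : (constrainedCost d j N A S : ℝ) ≤ 560 * (N * (A * S) * l * ((j + 1) * I)) := by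
    rw [constrainedCost]
    push_cast
    have h1 : (10 : ℝ) ≤ 20 * (I * (A * S * l)) := by
      have : 1 ≤ I * (A * S) := one_le_mul_of_one_le_of_one_le hI hD
      nlinarith
    calc (2 * (j : ℝ) + 2) * (N * (I * kernelCost A S + 10)) ≤
          (2 * (j : ℝ) + 2) * (N * (I * (260 * (A * S * l)) + 20 * (I * (A * S * l)))) := by
            gcongr
      _ = _ := by ring
  have base : (N : ℝ) * (A * S) ≤ 2 * (N * (A * S) * l * ((j + 1) * I)) := by
    have h1 : 1 ≤ 2 * l * ((j + 1) * I) := one_le_mul_of_one_le_of_one_le hl hJI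
    nlinarith
  have cx : (stepXCost N A S : ℝ) ≤ 260 * (N * (A * S) * l * ((j + 1) * I)) := by
    rw [stepXCost]
    push_cast
    have h1 : (A : ℝ) ≤ N * (A * S) := by
      have : 1 ≤ (N : ℝ) * S := one_le_mul_of_one_le_of_one_le hN1 hS1
      nlinarith
    have h2 : (A : ℝ) * (200 * l) ≤ N * (A * S) * (200 * l) := by gcongr
    have h3 : (N : ℝ) * (A * S) * l ≤ N * (A * S) * l * ((j + 1) * I) :=
      le_mul_of_one_le_right (by positivity) hJI
    linarith
  have cy : (stepYCost d j N A S : ℝ) ≤ 620 * (N * (A * S) * l * ((j + 1) * I)) := by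
    rw [stepYCost]
    push_cast
    linarith
  rw [iterationCost]
  push_cast
  calc (S : ℝ) * (stepXCost N A S + stepYCost d j N A S) + 44 * (S * (N * (A * S))) =
        S * (stepXCost N A S + stepYCost d j N A S + 44 * (N * (A * S))) := by ring
    _ ≤ S * (1000 * (N * (A * S) * l * ((j + 1) * I))) := by
        gcongr
        have : 0 ≤ (N : ℝ) * (A * S) * l * ((j + 1) * I) := by positivity
        linarith
    _ = _ := by ring

theorem steps_le (d : Metric) {j : ℕ} {c l L : ℝ} (hl : 1 ≤ 2 * l) (hL : 1 ≤ 2 * L)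
    (hj : (j : ℝ) + 1 ≤ c * (l * L)) :
    ((j : ℝ) + 1) * d.innerSteps j ≤ (2 * c + 16 * c ^ 2) * (l ^ 2 * L ^ logExponent d) := by
  have hj0 : (0 : ℝ) ≤ j := Nat.cast_nonneg _
  have hl0 : 0 < l := by linarith
  have hL0 : 0 < L := by linarith
  have hc : 0 < c := by
    by_contra! h
    have : c * (l * L) ≤ 0 := mul_nonpos_of_nonpos_of_nonneg h (by positivity)
    linarith
  have h1 : c * (l * L) ≤ (2 * c + 16 * c ^ 2) * (l ^ 2 * L ^ 1) := by
    have a1 : l * L ≤ 2 * (l ^ 2 * L) := by nlinarith [mul_pos hl0 hL0]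
    have a2 : 0 ≤ 16 * c ^ 2 * (l ^ 2 * L) := by positivity
    nlinarith
  cases d with
  | l1 => simpa [Metric.innerSteps, logExponent] using hj.trans h1
  | l2 => simpa [Metric.innerSteps, logExponent] using hj.trans h1
  | linf =>
    simp only [Metric.innerSteps, logExponent]
    push_cast
    have a1 : ((j : ℝ) + 1) * (8 * j + 1) ≤ 8 * (c * (l * L)) ^ 2 := by
      have : ((j : ℝ) + 1) ^ 2 ≤ (c * (l * L)) ^ 2 := by gcongr
      nlinarith
    have a2 : 8 * (c * (l * L)) ^ 2 ≤ 16 * c ^ 2 * (l ^ 2 * L ^ 3) := by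
      have : 0 ≤ 8 * (c ^ 2 * l ^ 2 * L ^ 2) := by positivity
      nlinarith
    have a3 : 0 ≤ 2 * c * (l ^ 2 * L ^ 3) := by positivity
    linarith

theorem log_le_four_mul_rpow {D : ℝ} (hD : 0 ≤ D) : Real.log D ≤ 4 * D ^ (1 / 4 : ℝ) := by
  have := Real.log_le_rpow_div hD (by norm_num : (0 : ℝ) < 1 / 4)
  linarith

theorem rpow_sizes {A S : ℝ} (hA : 0 < A) (hS : 0 < S) :
    A ^ (2.5 : ℝ) * S ^ (3.5 : ℝ) = S * ((A * S) ^ (1 / 4 : ℝ)) ^ 10 := by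
  rw [← Real.rpow_natCast, ← Real.rpow_mul (by positivity), Real.mul_rpow hA.le hS.le,
    show (3.5 : ℝ) = 1 + 2.5 by norm_num, Real.rpow_add hS, Real.rpow_one]
  norm_num
  ring

theorem rpow_eps {ε : ℝ} (hε : 0 < ε) : ε ^ (-1.5 : ℝ) = (ε ^ (-1 / 2 : ℝ)) ^ 3 := by
  rw [← Real.rpow_natCast, ← Real.rpow_mul hε.le]
  norm_num

/-- The final estimate of the number of operations. -/
theorem total_cost_le (d : Metric) {j k N A S : ℕ} (hN : 0 < N) (hA : 0 < A) (hS : 2 ≤ S) {ε : ℝ}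
    (hε : 0 < ε) (hε2 : ε ≤ 1 / 2) {b c : ℝ}
    (hk : (k : ℝ) ≤ b * (((A : ℝ) * S) ^ (1 / 4 : ℝ) * ε ^ (-1 / 2 : ℝ)))
    (hj : (j : ℝ) + 1 ≤ c * (Real.log (A * S) * Real.log (1 / ε))) :
    ((k ^ 3 * (iterationCost d j N A S + 44 * (S * (N * (A * S)))) : ℕ) : ℝ) ≤
      (128000 * b ^ 3 * (2 * c + 16 * c ^ 2)) * ((N : ℝ) * (A : ℝ) ^ (2.5 : ℝ) * (S : ℝ) ^ (3.5 : ℝ) *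
        Real.log S * Real.log (1 / ε) ^ logExponent d * ε ^ (-1.5 : ℝ)) := by
  have hA1 : (1 : ℝ) ≤ A := by exact_mod_cast hA
  have hN1 : (1 : ℝ) ≤ N := by exact_mod_cast hN
  have hS2 : (2 : ℝ) ≤ S := by exact_mod_cast hS
  have h2 : (1 : ℝ) / 2 < Real.log 2 := by linarith [Real.log_two_gt_d9]
  have hlS : 1 ≤ 2 * Real.log S := by
    have := Real.log_le_log two_pos hS2
    linarith
  have hlS' : Real.log S ≤ Real.log (A * S) :=
    Real.log_le_log (by linarith) (le_mul_of_one_le_left (by linarith) hA1)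
  have hlA' : Real.log A ≤ Real.log (A * S) :=
    Real.log_le_log (by linarith) (le_mul_of_one_le_right (by linarith) (by linarith))
  have hL : 1 ≤ 2 * Real.log (1 / ε) := by
    have : (2 : ℝ) ≤ 1 / ε := by rw [le_div_iff₀ hε]; linarith
    have := Real.log_le_log two_pos this
    linarith
  have hl : 1 ≤ 2 * Real.log (A * S) := by linarith
  have hl4 := log_le_four_mul_rpow (by positivity : (0 : ℝ) ≤ A * S)
  have h1 := cost_le d (j := j) hN hA (by omega) hl hlA' hlS'
  have h3 := steps_le d hl hL hj
  have hD : ((A : ℝ) * S) = (((A : ℝ) * S) ^ (1 / 4 : ℝ)) ^ 4 := by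
    rw [← Real.rpow_natCast, ← Real.rpow_mul (by positivity)]
    norm_num
  have e1 : (N : ℝ) * (A : ℝ) ^ (2.5 : ℝ) * (S : ℝ) ^ (3.5 : ℝ) =
      N * (S * (((A : ℝ) * S) ^ (1 / 4 : ℝ)) ^ 10) := by
    rw [mul_assoc, rpow_sizes (by linarith) (by linarith)]
  rw [e1, rpow_eps hε, Nat.cast_mul, Nat.cast_pow]
  have hw0 : 0 < ((A : ℝ) * S) ^ (1 / 4 : ℝ) := by positivity
  have he0 : 0 < ε ^ (-1 / 2 : ℝ) := by positivity
  have hc : 0 < 2 * c + 16 * c ^ 2 := by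
    have : 0 < c := by
      by_contra! h
      have : c * (Real.log (A * S) * Real.log (1 / ε)) ≤ 0 :=
        mul_nonpos_of_nonpos_of_nonneg h (mul_nonneg (by linarith) (by linarith))
      have : (0 : ℝ) ≤ j := Nat.cast_nonneg _
      linarith
    positivity
  have hb : 0 ≤ b := by
    by_contra! h
    have : b * (((A : ℝ) * S) ^ (1 / 4 : ℝ) * ε ^ (-1 / 2 : ℝ)) < 0 :=
      mul_neg_of_neg_of_pos h (by positivity)
    have : (0 : ℝ) ≤ k := Nat.cast_nonneg _
    linarith
  set w := ((A : ℝ) * S) ^ (1 / 4 : ℝ)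
  set e := ε ^ (-1 / 2 : ℝ)
  set l := Real.log (A * S)
  set L := Real.log (1 / ε) ^ logExponent d with hLdef
  have hl0 : 0 < l := by linarith
  have hL0 : 0 < L := by
    have : 0 < Real.log (1 / ε) := by linarith
    positivity
  have hS0 : (0 : ℝ) < S := by linarith
  calc (k : ℝ) ^ 3 * ((iterationCost d j N A S + 44 * (S * (N * (A * S))) : ℕ) : ℝ) ≤
        (b * (w * e)) ^ 3 * (1000 * (S * (N * w ^ 4) * l) * ((2 * c + 16 * c ^ 2) * (l ^ 2 * L))) := by
          rw [← hD]
          refine mul_le_mul (by gcongr) (h1.trans (by gcongr)) (by positivity) (by positivity)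
    _ = 1000 * b ^ 3 * (2 * c + 16 * c ^ 2) * (N * S * w ^ 7 * l ^ 3 * L * e ^ 3) := by ring
    _ ≤ 1000 * b ^ 3 * (2 * c + 16 * c ^ 2) * (N * S * w ^ 7 * (4 * w) ^ 3 * L * e ^ 3) := by gcongr
    _ = 64000 * b ^ 3 * (2 * c + 16 * c ^ 2) * (N * S * w ^ 10 * L * e ^ 3) * 1 := by ring
    _ ≤ 64000 * b ^ 3 * (2 * c + 16 * c ^ 2) * (N * S * w ^ 10 * L * e ^ 3) *
        (2 * Real.log S) := by gcongr
    _ = _ := by ring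

/-! ### Choice of the parameters -/

theorem sq_rpow_quarter {A S : ℝ} (hA : 0 ≤ A) (hS : 0 ≤ S) :
    ((A * S) ^ (1 / 4 : ℝ)) ^ 2 = √A * √S := by
  rw [← Real.sqrt_mul hA, Real.sqrt_eq_rpow, ← Real.rpow_natCast, ← Real.rpow_mul (by positivity)]
  norm_num

theorem sq_rpow_neg_half {ε : ℝ} (hε : 0 < ε) : (ε ^ (-1 / 2 : ℝ)) ^ 2 = 1 / ε := by
  rw [← Real.rpow_natCast, ← Real.rpow_mul hε.le, one_div, ← Real.rpow_neg_one]
  norm_num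

/-- The number of epochs. -/
theorem exists_epochs {D w e K : ℝ} (hw : 1 ≤ w) (he : 1 ≤ e) (hK : 1 ≤ K)
    (hD : D = K * (w ^ 2 * e ^ 2)) :
    ∃ k : ℕ, 1 ≤ k ∧ D ≤ (k : ℝ) ^ 2 ∧ (k : ℝ) ≤ 2 * √K * (w * e) := by
  have hr : 1 ≤ √K * (w * e) :=
    one_le_mul_of_one_le_of_one_le (Real.one_le_sqrt.2 hK) (one_le_mul_of_one_le_of_one_le hw he)
  refine ⟨⌈√K * (w * e)⌉₊, Nat.one_le_iff_ne_zero.2 (Nat.ceil_pos.2 (by linarith)).ne', ?_, ?_⟩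
  · have h1 := Nat.le_ceil (√K * (w * e))
    calc D = (√K * (w * e)) ^ 2 := by
          rw [hD, mul_pow, mul_pow, Real.sq_sqrt (by linarith)]
      _ ≤ _ := by gcongr
  · have := Nat.ceil_lt_add_one (zero_le_one.trans hr)
    linarith

/-- The precision parameter. -/
theorem exists_precision {c : ℝ} (hc : 1 ≤ c) {D ε : ℝ} (hD : 2 ≤ D) (hε : 0 < ε)
    (hε2 : ε ≤ 1 / 2) : ∃ j : ℕ, c * D ^ 6 / ε ^ 2 ≤ 2 ^ j ∧
      (j : ℝ) + 1 ≤ (8 * Real.log c + 40) * (Real.log D * Real.log (1 / ε)) := by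
  have h2 : (1 : ℝ) / 2 < Real.log 2 := by linarith [Real.log_two_gt_d9]
  have hl : 1 ≤ 2 * Real.log D := by
    have := Real.log_le_log two_pos hD
    linarith
  have hL : 1 ≤ 2 * Real.log (1 / ε) := by
    have : (2 : ℝ) ≤ 1 / ε := by rw [le_div_iff₀ hε]; linarith
    have := Real.log_le_log two_pos this
    linarith
  have hX : 1 ≤ c * D ^ 6 / ε ^ 2 := by
    rw [le_div_iff₀ (by positivity), one_mul]
    have h1 : ε ^ 2 ≤ 1 := pow_le_one₀ hε.le (by linarith)
    exact h1.trans (one_le_mul_of_one_le_of_one_le hc (one_le_pow₀ (by linarith)))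
  obtain ⟨j, h3, h4⟩ := exists_two_pow_ge hX
  refine ⟨j, h3, ?_⟩
  have e : Real.log (c * D ^ 6 / ε ^ 2) =
      Real.log c + 6 * Real.log D + 2 * Real.log (1 / ε) := by
    rw [Real.log_div (by positivity) (by positivity), Real.log_mul (by positivity) (by positivity),
      Real.log_pow, Real.log_pow, one_div, Real.log_inv]
    push_cast
    ring
  rw [e] at h4
  have hc0 := Real.log_nonneg hc
  set l := Real.log D
  set L := Real.log (1 / ε)
  have k1 : l ≤ 2 * (l * L) := by nlinarith
  have k2 : L ≤ 2 * (l * L) := by nlinarith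
  have k3 : 1 ≤ 4 * (l * L) := by nlinarith
  have k4 : Real.log c ≤ Real.log c * (4 * (l * L)) := le_mul_of_one_le_right hc0 k3
  linarith

/-- Elementary bounds that make the bisection depth and the accuracy of the inner solver fit. -/
theorem precision_suffices {A S V q ε δ R : ℝ} {j : ℕ} (hA : 1 ≤ A) (hS : 1 ≤ S) (hV : 1 ≤ V)
    (hq : 0 < q) (hq1 : q ≤ 1) (hε : 0 < ε) (hε2 : ε ≤ 1 / 2) (hR1 : 1 ≤ R) (hR : R ≤ A * S * V)
    (hδ : δ = (ε * q ^ 2 / (12 * (1 + R))) ^ 2)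
    (hj : 6336 * V ^ 3 / q ^ 4 * (A * S) ^ 6 / ε ^ 2 ≤ 2 ^ j) :
    A * S * (3 * A) ≤ 2 ^ j ∧ R * ((A * S * ((3 * A) ^ 2 + 1) + 1) * (1 / 2) ^ j) ≤ δ := by
  have hD : 1 ≤ A * S := one_le_mul_of_one_le_of_one_le hA hS
  have hAD : A ≤ A * S := le_mul_of_one_le_right (by linarith) hS
  set D := A * S with hDdef
  have hR0 : 0 < R := by linarith
  have hV0 : 0 < V := by linarith
  have hD0 : 0 < D := by linarith
  constructor
  · refine le_trans ?_ hj
    calc D * (3 * A) ≤ D * (3 * D) := by gcongr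
      _ = 3 * 1 * D ^ 2 / 1 := by ring
      _ ≤ 6336 * V ^ 3 / q ^ 4 * D ^ 6 / ε ^ 2 := by
        have h1 : (3 : ℝ) * 1 ≤ 6336 * V ^ 3 / q ^ 4 := by
          rw [le_div_iff₀ (by positivity)]
          have a1 : q ^ 4 ≤ 1 := pow_le_one₀ hq.le hq1
          have a2 : 1 ≤ V ^ 3 := one_le_pow₀ hV
          linarith
        have h2 : ε ^ 2 ≤ 1 := pow_le_one₀ hε.le (by linarith)
        have h3 : D ^ 2 ≤ D ^ 6 := pow_le_pow_right₀ hD (by norm_num)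
        gcongr
  · have h2j : (0 : ℝ) < 2 ^ j := by positivity
    have h1 : D * ((3 * A) ^ 2 + 1) + 1 ≤ 11 * D ^ 3 := by
      have a1 : D * ((3 * A) ^ 2 + 1) ≤ D * ((3 * D) ^ 2 + 1) := by gcongr
      have a2 : 1 ≤ D ^ 3 := one_le_pow₀ hD
      have a3 : D ≤ D ^ 3 := le_self_pow₀ hD (by norm_num)
      nlinarith
    have h3 : (1 + R) ^ 2 ≤ 4 * (D * V) ^ 2 := by
      have : 1 + R ≤ 2 * (D * V) := by linarith
      calc (1 + R) ^ 2 ≤ (2 * (D * V)) ^ 2 := by gcongr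
        _ = _ := by ring
    rw [one_div, inv_pow, ← div_eq_mul_inv, mul_div_assoc', div_le_iff₀ h2j, hδ]
    calc R * (D * ((3 * A) ^ 2 + 1) + 1) ≤ D * V * (11 * D ^ 3) := by gcongr
      _ = (ε * q ^ 2) ^ 2 / (144 * (4 * (D * V) ^ 2)) *
          (6336 * V ^ 3 / q ^ 4 * D ^ 6 / ε ^ 2) := by
        field_simp
        ring
      _ ≤ (ε * q ^ 2) ^ 2 / (144 * (1 + R) ^ 2) * 2 ^ j := by gcongr
      _ = _ := by
        rw [div_pow, mul_pow 12]
        norm_num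

theorem gap_suffices {q ε R V n K k : ℝ} (hq : 0 < q) (hε : 0 < ε) (hR1 : 1 ≤ R)
    (hVR : V ≤ R) (hK : K = 18 * (4 + 4 * n ^ 2 + 32 / q)) (hk0 : 0 < k)
    (hk : 2 * R * K / (q * ε) ≤ k ^ 2) :
    (18 * (4 * R + 2 * (2 * V * n ^ 2 + 2 * (8 * R) / q)) / k ^ 2 +
      3 * (√((ε * q ^ 2 / (12 * (1 + R))) ^ 2) * (2 + 2 * R) / q)) / q ≤ ε := by
  have hK0 : 0 < K := by rw [hK]; positivity
  have h1 : 18 * (4 * R + 2 * (2 * V * n ^ 2 + 2 * (8 * R) / q)) ≤ R * K := by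
    have a1 : V * n ^ 2 ≤ R * n ^ 2 := by gcongr
    have a2 : R * K = 18 * (4 * R + 2 * (2 * (R * n ^ 2) + 2 * (8 * R) / q)) := by
      rw [hK]; ring
    rw [a2]
    linarith
  have h2 : 18 * (4 * R + 2 * (2 * V * n ^ 2 + 2 * (8 * R) / q)) / k ^ 2 ≤ q * ε / 2 := by
    rw [div_le_iff₀ (by positivity)]
    rw [div_le_iff₀ (by positivity)] at hk
    linarith
  have h3 : 3 * (√((ε * q ^ 2 / (12 * (1 + R))) ^ 2) * (2 + 2 * R) / q) = q * ε / 2 := by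
    rw [Real.sqrt_sq (by positivity)]
    field_simp
    norm_num
  rw [h3, div_le_iff₀ hq]
  linarith

theorem sqrt_size_bounds {A S : ℝ} (hA : 1 ≤ A) (hS : 1 ≤ S) :
    1 ≤ √A * √S ∧ √A * √S ≤ A * S := by
  have h : ∀ {x : ℝ}, 1 ≤ x → √x ≤ x := fun hx => by
    rw [Real.sqrt_le_left (by linarith)]
    nlinarith
  exact ⟨one_le_mul_of_one_le_of_one_le (Real.one_le_sqrt.2 hA) (Real.one_le_sqrt.2 hS),
    mul_le_mul (h hA) (h hS) (Real.sqrt_nonneg _) (by linarith)⟩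

/-- The choice of the parameters for models with discount factor `1 - q` whose value vectors are
bounded by `V`. -/
theorem exists_parameters {q V : ℝ} (hq : 0 < q) (hq1 : q ≤ 1) (hV : 1 ≤ V) (n : ℕ) :
    ∃ b c : ℝ, 0 < b ∧ 0 < c ∧ ∀ A S : ℕ, 1 ≤ A → 2 ≤ S → ∀ ε : ℝ, 0 < ε → ε ≤ 1 / 2 →
      ∃ (k j : ℕ) (δ : ℝ), 1 ≤ k ∧ 0 < δ ∧ δ ≤ ε ∧
        (18 * (4 * (√A * (√S * V)) + 2 * (2 * V * n ^ 2 + 2 * (8 * (√A * (√S * V))) / q)) /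
          (k : ℝ) ^ 2 + 3 * (√δ * (2 + 2 * (√A * (√S * V))) / q)) / q ≤ ε ∧
        (A : ℝ) * S * (3 * A) ≤ 2 ^ j ∧
        √A * (√S * V) * ((A * S * ((3 * A) ^ 2 + 1) + 1) * (1 / 2) ^ j) ≤ δ ∧
        (k : ℝ) ≤ b * (((A : ℝ) * S) ^ (1 / 4 : ℝ) * ε ^ (-1 / 2 : ℝ)) ∧
        (j : ℝ) + 1 ≤ c * (Real.log (A * S) * Real.log (1 / ε)) := by
  obtain ⟨K, hK⟩ : ∃ K : ℝ, K = 18 * (4 + 4 * (n : ℝ) ^ 2 + 32 / q) := ⟨_, rfl⟩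
  have hK1 : 1 ≤ K := by
    have : 0 ≤ (n : ℝ) ^ 2 := by positivity
    have : 0 ≤ 32 / q := by positivity
    linarith
  have hc2 : 1 ≤ 6336 * V ^ 3 / q ^ 4 := by
    rw [le_div_iff₀ (by positivity)]
    have a1 : q ^ 4 ≤ 1 := pow_le_one₀ hq.le hq1
    have a2 : 1 ≤ V ^ 3 := one_le_pow₀ hV
    linarith
  have hK2 : 1 ≤ 2 * V * K / q := by
    rw [le_div_iff₀ hq]
    have : 1 ≤ V * K := one_le_mul_of_one_le_of_one_le hV hK1
    linarith
  refine ⟨2 * √(2 * V * K / q), 8 * Real.log (6336 * V ^ 3 / q ^ 4) + 40,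
    mul_pos two_pos (Real.sqrt_pos.2 (by linarith)),
    by linarith [Real.log_nonneg hc2], fun A S hA hS ε hε hε2 => ?_⟩
  have hA1 : (1 : ℝ) ≤ A := by exact_mod_cast hA
  have hS2 : (2 : ℝ) ≤ S := by exact_mod_cast hS
  have hS1 : (1 : ℝ) ≤ S := by linarith
  have hD2 : (2 : ℝ) ≤ A * S := hS2.trans (le_mul_of_one_le_left (by linarith) hA1)
  obtain ⟨hs1, hs2⟩ := sqrt_size_bounds hA1 hS1
  obtain ⟨R, hR⟩ : ∃ R : ℝ, R = √A * (√S * V) := ⟨_, rfl⟩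
  have hVR : V ≤ R := by rw [hR, ← mul_assoc]; exact le_mul_of_one_le_left (by linarith) hs1
  have hR1 : 1 ≤ R := hV.trans hVR
  have hRD : R ≤ A * S * V := by rw [hR, ← mul_assoc]; gcongr
  rw [← hR]
  obtain ⟨k, hk1, hk2, hk3⟩ := exists_epochs (K := 2 * V * K / q) (D := 2 * R * K / (q * ε))
    (Real.one_le_rpow (by linarith : (1 : ℝ) ≤ A * S) (by norm_num : (0 : ℝ) ≤ 1 / 4))
    (Real.one_le_rpow_of_pos_of_le_one_of_nonpos hε (by linarith)
      (by norm_num : (-1 / 2 : ℝ) ≤ 0)) hK2 (by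
      rw [sq_rpow_quarter (by linarith) (by linarith), sq_rpow_neg_half hε, hR]
      field_simp)
  obtain ⟨j, hj1, hj2⟩ := exists_precision hc2 hD2 hε hε2
  obtain ⟨p1, p2⟩ := precision_suffices hA1 hS1 hV hq hq1 hε hε2 hR1 hRD rfl hj1
  have hδ : ε * q ^ 2 / (12 * (1 + R)) ≤ ε := by
    rw [div_le_iff₀ (by positivity)]
    have : q ^ 2 ≤ 1 := pow_le_one₀ hq.le hq1
    nlinarith
  refine ⟨k, j, (ε * q ^ 2 / (12 * (1 + R))) ^ 2, hk1, by positivity, ?_,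
    gap_suffices hq hε hR1 hVR hK (by exact_mod_cast hk1) hk2, p1, p2, hk3, hj2⟩
  calc (ε * q ^ 2 / (12 * (1 + R))) ^ 2 ≤ ε ^ 2 := by gcongr
    _ ≤ ε := by nlinarith

end WDRMDP

end

theorem theorem2 (d : WDRMDP.Metric) (p : ENNReal)
    (hdp : (d = WDRMDP.Metric.l2 ∧ (p = 2 ∨ p = ⊤)) ∨
      (d = WDRMDP.Metric.l1 ∧ (p = 1 ∨ p = ⊤)) ∨
      (d = WDRMDP.Metric.linf ∧ (p = 1 ∨ p = ⊤))) :
    -- one family of programs: sizes `N`, `A`, `S`, number `k` of epochs, precision parameter `j`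
    ∃ prog : ∀ N A S : ℕ, ℕ → ℕ →
        WDRMDP.ArithProg (WDRMDP.InVar N A S) (WDRMDP.OutVar N A S),
      ∀ (disc : ℝ), 0 < disc → disc < 1 → ∀ (M : ℝ),
        ∃ C : ℝ, 0 < C ∧
          ∀ (N A S : ℕ), 1 ≤ N → 1 ≤ A → 2 ≤ S → ∀ ε : ℝ, 0 < ε → ε ≤ 1 / 2 →
            ∃ (k j : ℕ) (δ : ℝ), 0 < δ ∧ δ ≤ ε ∧
              ∀ (P : WDRMDP.Model N A S) (I : WDRMDP.Start P d p), P.disc = disc →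
                (∀ s a, |P.cost s a| ≤ M) → (∀ s, |I.v s| ≤ M) →
                (∀ x y v, WDRMDP.IsRun P d p I k δ x y v →
                  P.IsEpsOptimal d p ε (WDRMDP.outputX k x)) ∧
                WDRMDP.Computes (prog N A S k j) I k δ ∧
                ((prog N A S k j).numOps (WDRMDP.inputOf I) : ℝ) ≤
                  C * ((N : ℝ) * (A : ℝ) ^ (2.5 : ℝ) * (S : ℝ) ^ (3.5 : ℝ) * Real.log S *
                    Real.log (1 / ε) ^ WDRMDP.logExponent d * ε ^ (-1.5 : ℝ)) := by
  obtain ⟨b, hb⟩ : ∃ b : Bool, b = true ↔ p = ⊤ := by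
    by_cases h : p = ⊤
    · exact ⟨true, by simp [h]⟩
    · exact ⟨false, by simp [h]⟩
  refine ⟨fun N A S k j => WDRMDP.program N A S d b k j, fun disc h0 h1 M => ?_⟩
  have hq : 0 < 1 - disc := sub_pos.2 h1
  have hM : 0 ≤ |M| + 1 := by positivity
  -- the value vectors stay in the ball whose radius `V` solves `M' + λ V = V`, with `M' = |M| + 1`
  obtain ⟨V, hV⟩ : ∃ V, V = (|M| + 1) / (1 - disc) := ⟨_, rfl⟩
  have hMV : |M| + 1 + disc * V ≤ V := by
    have : V * (1 - disc) = |M| + 1 := by rw [hV, div_mul_cancel₀ _ hq.ne']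
    linarith
  have hVM : |M| + 1 ≤ V := by
    rw [hV, le_div_iff₀ hq]
    nlinarith
  have hV1 : 1 ≤ V := le_trans (by linarith [abs_nonneg M]) hVM
  obtain ⟨n, hn1, hn⟩ := WDRMDP.exists_rate_threshold h1
  obtain ⟨β, c, hβ, hc, hpar⟩ := WDRMDP.exists_parameters hq (by linarith) hV1 n
  refine ⟨128000 * β ^ 3 * (2 * c + 16 * c ^ 2), by positivity,
    fun N A S hN hA hS ε hε hε2 => ?_⟩
  obtain ⟨k, j, δ, hk, hδ0, hδε, hgap, hj1, hj2, hkb, hjc⟩ := hpar A S hA hS ε hε hε2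
  refine ⟨k, j, δ, hδ0, hδε, fun P I hP hcost hI => ?_⟩
  subst hP
  have hcost' : ∀ s a, |P.cost s a| ≤ |M| + 1 := fun s a =>
    (hcost s a).trans ((le_abs_self M).trans (by linarith))
  have hI' : ∀ s, |I.v s| ≤ V := fun s =>
    (hI s).trans ((le_abs_self M).trans (by linarith))
  have hA1 : (1 : ℝ) ≤ √(A : ℝ) := Real.one_le_sqrt.2 (by exact_mod_cast hA)
  constructor
  · intro x y v H
    obtain ⟨u, hu⟩ := WDRMDP.Model.exists_robust_fixed (P := P) hdp hN hA
    refine WDRMDP.isEpsOptimal_of_upper_le hdp hN hu (fun s => ?_) (fun s =>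
      H.upper_output_le hdp hN hA (by omega) hk hδ0 (by linarith) hM hcost' hMV (by linarith) hI'
        le_rfl hu hn1 hn s) hgap
    exact WDRMDP.linAvg_mem_stdSimplex
      ((Nat.zero_le _).trans_lt (WDRMDP.IsRun.epochStart_lt_succ hk)) fun t ht =>
        (H.mem_of_mem_Ioc le_rfl ht s).1
  · have hδ : ∀ v : Fin S → ℝ, (∀ s, |v s| ≤ V) →
        P.invSigma v * (N * ((A * S * ((3 * A) ^ 2 + 1) + 1) * (1 / 2) ^ j)) ≤ δ := fun v hv => by
      have e1 := WDRMDP.Model.l2norm_le (by linarith) hv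
      have e2 := P.invSigma_nonneg v
      have e3 : P.invSigma v * N ≤ √(A : ℝ) * (√(S : ℝ) * V) := by
        calc P.invSigma v * N ≤ P.invSigma v * N * √(A : ℝ) :=
              le_mul_of_one_le_right (by positivity) hA1
          _ = P.disc * WDRMDP.Model.l2norm v := P.invSigma_mul hN hA v
          _ ≤ WDRMDP.Model.l2norm v :=
              mul_le_of_le_one_left (WDRMDP.Model.l2norm_nonneg _) h1.le
          _ ≤ √(S : ℝ) * V := e1
          _ ≤ √(A : ℝ) * (√(S : ℝ) * V) := le_mul_of_one_le_left (by positivity) hA1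
      rw [← mul_assoc]
      exact (mul_le_mul_of_nonneg_right e3 (by positivity)).trans hj2
    obtain ⟨s1, s2⟩ := WDRMDP.program_spec (I := I) hdp hb (j := j) (δ := δ) (V := V) hN hA
      (by omega) hk hj1 (fun v hv s x hx y hy => (P.abs_bellman_le hN hx hy hcost' hv).trans hMV)
      hδ hI'
    exact ⟨s1, (Nat.cast_le.2 s2).trans (WDRMDP.total_cost_le d hN hA hS hε hε2 hkb hjc)⟩
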